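/- Let $n\in\mathbf N$, $1\le p<\infty$, $s\ge 0$, and fix a window $\phi\in\mathcal S(\mathbf R^n)\setminus\{0\}$. For a tempered distribution $u\in\mathcal S'(\mathbf R^n)$ let $$V_\phi u(x,\xi)=\langle u,M_\xi T_x\phi\rangle=\int_{\mathbf R^n}u(t)\,\overline{\phi(t-x)}\,e^{-it\cdot\xi}\,dt$$ be its short-time Fourier transform (the integral being understood as the action of $u$ on the Schwartz function $t\mapsto\overline{\phi(t-x)}e^{-it\cdot\xi}$). Let $M^{p,1}_s(\mathbf R^n)$ be the space of all $u\in\mathcal S'(\mathbf R^n)$ with $$\|u\|_{M^{p,1}_s}=\int_{\mathbf R^n}(1+|\xi|^2)^{s/2}\Big(\int_{\mathbf R^n}|V_\phi u(x,\xi)|^p\,dx\Big)^{1/p}d\xi<\infty .$$ A closed ideal of $M^{p,1}_s(\mathbf R^n)$ is a linear subspace $I\subset M^{p,1}_s(\mathbf R^n)$ that is closed in the norm $\|\cdot\|_{M^{p,1}_s}$ and such that, for all $h\in M^{p,1}_s(\mathbf R^n)$ and $g\in I$, both $h$ and $g$ are given by continuous functions and their pointwise product $hg$ belongs to $I$. The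 closed ideal generated by $f$ is the intersection of all closed ideals of $M^{p,1}_s(\mathbf R^n)$ that contain $f$. Theorem (Wiener's general Tauberian theorem for $M^{p,1}_s$). Every $f\in M^{p,1}_s(\mathbf R^n)$ is given by a continuous function on $\mathbf R^n$, again denoted by $f$, and the closed ideal $I$ of $M^{p,1}_s(\mathbf R^n)$ generated by $f$ satisfies $$I=M^{p,1}_s(\mathbf R^n)\quad\Longleftrightarrow\quad f(x)\neq 0\ \text{ for all } x\in\mathbf R^n .$$ -/

import Mathlib

open MeasureTheory
open scoped SchwartzMap ENNReal ComplexConjugate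

namespace ModulationSpace

noncomputable section

/-- The character `t ↦ exp (-i t·ξ)` on `ℝⁿ`. -/
def character {n : ℕ} (ξ : EuclideanSpace ℝ (Fin n)) (t : EuclideanSpace ℝ (Fin n)) : ℂ :=
  Complex.exp (-(Complex.I * ((inner ℝ t ξ : ℝ) : ℂ)))

theorem hasTemperateGrowth_cexp_I :
    (fun r : ℝ => Complex.exp (-Complex.I * (r : ℂ))).HasTemperateGrowth := by
  have hd : ∀ k : ℕ, iteratedDeriv k (fun r : ℝ => Complex.exp (-Complex.I * (r : ℂ))) =
      fun r : ℝ => (-Complex.I) ^ k * Complex.exp (-Complex.I * (r : ℂ)) := by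
    intro k
    induction k with
    | zero => simp
    | succ k ih =>
      rw [iteratedDeriv_succ, ih]
      funext r
      have h1 : HasDerivAt (fun r : ℝ => -Complex.I * (r : ℂ)) (-Complex.I) r := by
        simpa using (Complex.ofRealCLM.hasDerivAt (x := r)).const_mul (-Complex.I)
      have h2 := (h1.cexp).const_mul ((-Complex.I) ^ k)
      rw [h2.deriv]
      ring
  refine ⟨?_, fun k => ⟨0, 1, fun r => ?_⟩⟩
  · exact Complex.contDiff_exp.comp (contDiff_const.mul Complex.ofRealCLM.contDiff)
  · rw [norm_iteratedFDeriv_eq_norm_iteratedDeriv, hd]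
    simp [Complex.norm_exp]

theorem hasTemperateGrowth_character {n : ℕ} (ξ : EuclideanSpace ℝ (Fin n)) :
    (character ξ).HasTemperateGrowth := by
  have h := hasTemperateGrowth_cexp_I.comp
    (Function.hasTemperateGrowth_inner_left (H := EuclideanSpace ℝ (Fin n)) ξ)
  have he : character ξ = (fun r : ℝ => Complex.exp (-Complex.I * (r : ℂ))) ∘
      (fun t : EuclideanSpace ℝ (Fin n) => (inner ℝ t ξ : ℝ)) := by
    funext t
    simp [character]
  rw [he]
  exact h

/-- The Schwartz function `t ↦ conj (φ (t - x)) * exp (-i t·ξ)`, the complex conjugate of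
the time-frequency shift `M_ξ T_x φ` of the window `φ`. -/
def conjShift {n : ℕ} (φ : 𝓢(EuclideanSpace ℝ (Fin n), ℂ)) (x ξ : EuclideanSpace ℝ (Fin n)) :
    𝓢(EuclideanSpace ℝ (Fin n), ℂ) :=
  SchwartzMap.smulLeftCLM ℂ (character ξ)
    (SchwartzMap.postcompCLM (𝕜 := ℝ) (Complex.conjCLE : ℂ →L[ℝ] ℂ)
      (SchwartzMap.compSubConstCLM ℝ x φ))

theorem conjShift_apply {n : ℕ} (φ : 𝓢(EuclideanSpace ℝ (Fin n), ℂ))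
    (x ξ t : EuclideanSpace ℝ (Fin n)) :
    conjShift φ x ξ t =
      conj (φ (t - x)) * Complex.exp (-(Complex.I * ((inner ℝ t ξ : ℝ) : ℂ))) := by
  rw [conjShift, SchwartzMap.smulLeftCLM_apply_apply (hasTemperateGrowth_character ξ)]
  simp [character, mul_comm]

/-- The short-time Fourier transform
`V_φ u (x, ξ) = ⟨u, M_ξ T_x φ⟩ = ∫ u(t) conj (φ (t - x)) exp (-i t·ξ) dt`
of a tempered distribution `u`. -/
def stft {n : ℕ} (φ : 𝓢(EuclideanSpace ℝ (Fin n), ℂ)) (u : 𝓢'(EuclideanSpace ℝ (Fin n), ℂ))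
    (x ξ : EuclideanSpace ℝ (Fin n)) : ℂ :=
  u (conjShift φ x ξ)

/-- The norm of `M^{p,1}_s(ℝⁿ)` with window `φ`, with values in `[0, ∞]`:
`∫ (1 + |ξ|²)^{s/2} ‖V_φ u (·, ξ)‖_{L^p} dξ`. -/
def modNorm {n : ℕ} (p : ℝ≥0∞) (s : ℝ) (φ : 𝓢(EuclideanSpace ℝ (Fin n), ℂ))
    (u : 𝓢'(EuclideanSpace ℝ (Fin n), ℂ)) : ℝ≥0∞ :=
  ∫⁻ ξ : EuclideanSpace ℝ (Fin n),
    ENNReal.ofReal ((1 + ‖ξ‖ ^ 2) ^ (s / 2)) *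
      eLpNorm (fun x : EuclideanSpace ℝ (Fin n) => stft φ u x ξ) p volume

/-- The modulation space `M^{p,1}_s(ℝⁿ)` as a set of tempered distributions. -/
def modulationSpace {n : ℕ} (p : ℝ≥0∞) (s : ℝ) (φ : 𝓢(EuclideanSpace ℝ (Fin n), ℂ)) :
    Set 𝓢'(EuclideanSpace ℝ (Fin n), ℂ) :=
  {u | modNorm p s φ u < ∞}

/-- The tempered distribution `u` is given by the continuous function `f`. (There is at most
one such `f`.) -/
structure IsGivenBy {n : ℕ} (u : 𝓢'(EuclideanSpace ℝ (Fin n), ℂ))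
    (f : EuclideanSpace ℝ (Fin n) → ℂ) : Prop where
  continuous : Continuous f
  integrable : ∀ ψ : 𝓢(EuclideanSpace ℝ (Fin n), ℂ), Integrable (fun t => f t * ψ t)
  apply_eq : ∀ ψ : 𝓢(EuclideanSpace ℝ (Fin n), ℂ), u ψ = ∫ t, f t * ψ t

/-- `w` is the pointwise product of `u` and `v`, which are given by continuous functions. -/
def IsProduct {n : ℕ} (u v w : 𝓢'(EuclideanSpace ℝ (Fin n), ℂ)) : Prop :=
  ∃ f g : EuclideanSpace ℝ (Fin n) → ℂ,
    IsGivenBy u f ∧ IsGivenBy v g ∧ IsGivenBy w (fun t => f t * g t)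

/-- The linear subspace `I` is a closed ideal of `M^{p,1}_s(ℝⁿ)` (for pointwise
multiplication and the norm topology). -/
structure IsClosedIdeal {n : ℕ} (p : ℝ≥0∞) (s : ℝ) (φ : 𝓢(EuclideanSpace ℝ (Fin n), ℂ))
    (I : Submodule ℂ 𝓢'(EuclideanSpace ℝ (Fin n), ℂ)) : Prop where
  subset : (I : Set 𝓢'(EuclideanSpace ℝ (Fin n), ℂ)) ⊆ modulationSpace p s φ
  mul_mem : ∀ u ∈ modulationSpace p s φ, ∀ v ∈ I, ∃ w ∈ I, IsProduct u v w
  closed : ∀ u ∈ modulationSpace p s φ,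
    (∀ ε : ℝ≥0∞, 0 < ε → ∃ v ∈ I, modNorm p s φ (u - v) < ε) → u ∈ I

/-- The closed ideal of `M^{p,1}_s(ℝⁿ)` generated by `u`: the intersection of all closed
ideals that contain `u`. -/
def closedIdealGenerated {n : ℕ} (p : ℝ≥0∞) (s : ℝ)
    (φ : 𝓢(EuclideanSpace ℝ (Fin n), ℂ)) (u : 𝓢'(EuclideanSpace ℝ (Fin n), ℂ)) :
    Submodule ℂ 𝓢'(EuclideanSpace ℝ (Fin n), ℂ) :=
  sInf {I | IsClosedIdeal p s φ I ∧ u ∈ I}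

end

end ModulationSpace

/-! In the frequency variable the norm is a weighted L¹ norm, so the space behaves like Wiener's
algebra of absolutely convergent Fourier integrals, and Wiener's local inversion carries over.

Foundations. The inversion formula `inversion` recovers u from its short-time Fourier transform. It
gives `exists_enorm_stft_le`: the transform for any window is bounded pointwise by the convolution
of |V_φ u| with a polynomially decaying kernel, the constant being a Schwartz seminorm of the
window. With the inequalities of Minkowski and Hölder this shows that elements are bounded
continuous functions (`isGivenBy_synthesis`), that point evaluations are norm-continuous
(`exists_enorm_le_modNorm`), and that products stay in the space (`mul_mem_modulationSpace`).

If f(x₀) = 0, the elements vanishing at x₀ form a closed ideal that contains f but no bump equal to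
1 at x₀, so the generated ideal is proper.

Conversely, let f have no zeros and let I be a closed ideal containing f. Near x₀ one has f =
f(x₀)(1 + g), where g is the Fourier integral of a weighted L¹ density of unweighted L¹ norm below 1
(`exists_small_density`). Smallness comes from localising with bumps that shrink to x₀. Division by
1 + g is then a Neumann series that preserves the space (`exists_div_one_add_mem`). The unweighted
norm suffices because (1 + δ|ξ|)^s is submultiplicative for every δ, all these weights are
equivalent, and the weighted norm tends to the unweighted one as δ → 0. So a bump b at x₀ equals (b
/ (f(x₀)(1 + g))) f and lies in I. Finite sums of such bumps are positive on a given compact set,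
and dividing by them puts every compactly supported smooth function in I. Finally χ(r·)v lies in I
for each v in the space and each bump χ with χ(0) = 1, and it tends to v in norm as r → 0
(`tendsto_modNorm_cutoff`). Hence v ∈ I. -/

namespace ModulationSpace

/-! ### Integral inequalities for Lᵖ norms of nonnegative functions -/

/-- **Minkowski's integral inequality**. -/
theorem eLpNorm_lintegral_le {X Y : Type*} [MeasurableSpace X] [MeasurableSpace Y]
    {μ : Measure X} [SigmaFinite μ] {ν : Measure Y} [SFinite ν] {F : X → Y → ℝ≥0∞}
    (hF : Measurable (Function.uncurry F)) {p : ℝ≥0∞} (hp : 1 ≤ p) (hpt : p ≠ ∞) :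
    eLpNorm (fun x => ∫⁻ y, F x y ∂ν) p μ ≤ ∫⁻ y, eLpNorm (fun x => F x y) p μ ∂ν := by
  have hp0 : p ≠ 0 := (zero_lt_one.trans_le hp).ne'
  simp only [eLpNorm_eq_lintegral_rpow_enorm_toReal hp0 hpt, enorm_eq_self]
  set q := p.toReal with hq
  have hq1 : 1 ≤ q := by
    rw [hq, ← ENNReal.toReal_one]; exact ENNReal.toReal_mono hpt hp
  have hq0 : 0 < q := zero_lt_one.trans_le hq1
  -- For exponent 1 there is no finite conjugate exponent; the claim is then Tonelli's theorem.
  rcases hq1.eq_or_lt with h1 | h1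
  · simp only [← h1, ENNReal.rpow_one, div_one]
    exact (lintegral_lintegral_swap hF.aemeasurable).le
  set r := q.conjExponent with hr
  have hqr : q.HolderConjugate r := Real.HolderConjugate.conjExponent h1
  set R := ∫⁻ y, (∫⁻ x, F x y ^ q ∂μ) ^ (1 / q) ∂ν with hR
  set S : X → ℝ≥0∞ := fun x => ∫⁻ y, F x y ∂ν with hS
  have hSm : Measurable S := hF.lintegral_prod_right
  -- The truncations have a finite q-th power integral, so that a power of it can be cancelled
  -- below. They increase to S, which gives the full inequality by monotone convergence.
  let T : ℕ → X → ℝ≥0∞ := fun k => (spanningSets μ k).indicator (fun x => min (S x) k)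
  have hTm : ∀ k, Measurable (T k) := fun k =>
    (hSm.min measurable_const).indicator (measurableSet_spanningSets μ k)
  have hTS : ∀ k x, T k x ≤ S x := fun k x => by
    by_cases hx : x ∈ spanningSets μ k <;> simp [T, hx]
  have hTfin : ∀ k, ∫⁻ x, T k x ^ q ∂μ ≠ ∞ := fun k => by
    have : ∫⁻ x, T k x ^ q ∂μ ≤ ∫⁻ x, (spanningSets μ k).indicator (fun _ => (k : ℝ≥0∞) ^ q) x ∂μ := by
      refine lintegral_mono fun x => ?_
      by_cases hx : x ∈ spanningSets μ k
      · simp only [T, hx, Set.indicator_of_mem]; gcongr; exact min_le_right _ _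
      · simp [T, hx, hq0]
    refine ne_top_of_le_ne_top ?_ this
    rw [lintegral_indicator_const (measurableSet_spanningSets μ k)]
    exact ENNReal.mul_ne_top (ENNReal.rpow_ne_top_of_nonneg hq0.le (by simp))
      (measure_spanningSets_lt_top μ k).ne
  have key : ∀ k, ∫⁻ x, T k x ^ q ∂μ ≤ R ^ q := fun k => by
    -- Duality: one factor of T^q is replaced by S, the integrals are swapped, and Hölder's
    -- inequality is applied for each y against T^(q-1).
    have h2 : ∫⁻ x, T k x ^ q ∂μ ≤ R * (∫⁻ x, T k x ^ q ∂μ) ^ (1 / r) := by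
      calc ∫⁻ x, T k x ^ q ∂μ ≤ ∫⁻ x, S x * T k x ^ (q - 1) ∂μ := by
            refine lintegral_mono fun x => ?_
            calc T k x ^ q = T k x ^ (1 + (q - 1)) := by congr 1; ring
              _ = T k x * T k x ^ (q - 1) := by
                  rw [ENNReal.rpow_add_of_nonneg _ _ zero_le_one (by linarith), ENNReal.rpow_one]
              _ ≤ _ := by gcongr; exact hTS k x
        _ = ∫⁻ x, ∫⁻ y, F x y * T k x ^ (q - 1) ∂ν ∂μ := by
            refine lintegral_congr fun x => ?_
            rw [lintegral_mul_const _ (hF.of_uncurry_left)]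
        _ = ∫⁻ y, ∫⁻ x, F x y * T k x ^ (q - 1) ∂μ ∂ν := by
            refine lintegral_lintegral_swap (Measurable.aemeasurable ?_)
            exact hF.mul (((hTm k).pow_const _).comp measurable_fst)
        _ ≤ ∫⁻ y, (∫⁻ x, F x y ^ q ∂μ) ^ (1 / q) * (∫⁻ x, T k x ^ q ∂μ) ^ (1 / r) ∂ν := by
            refine lintegral_mono fun y => ?_
            exact ENNReal.lintegral_mul_rpow_le_lintegral_rpow_mul_lintegral_rpow hqr
              (hF.of_uncurry_right).aemeasurable (hTm k).aemeasurable
        _ = _ := by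
            rw [lintegral_mul_const]
            exact ((hF.pow_const q).lintegral_prod_left').pow_const _
    by_cases h0 : ∫⁻ x, T k x ^ q ∂μ = 0
    · simp [h0]
    set J := ∫⁻ x, T k x ^ q ∂μ
    have h3 : J ^ (1 / q) ≤ R := by
      have h4 : J = J ^ (1 / q) * J ^ (1 / r) := by
        rw [← ENNReal.rpow_add _ _ h0 (hTfin k)]
        have := hqr.inv_add_inv_eq_one
        rw [one_div, one_div, this, ENNReal.rpow_one]
      have h5 : J ^ (1 / q) * J ^ (1 / r) ≤ R * J ^ (1 / r) := h4.symm.le.trans h2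
      have h6 : J ^ (1 / r) ≠ 0 := by
        simp only [ne_eq, ENNReal.rpow_eq_zero_iff, h0, hTfin k, false_and, or_self, not_false_eq_true, J]
      have h7 : J ^ (1 / r) ≠ ∞ := ENNReal.rpow_ne_top_of_nonneg (by simp [hqr.symm.nonneg]) (hTfin k)
      exact (ENNReal.mul_le_mul_iff_left h6 h7).1 h5
    calc J = (J ^ (1 / q)) ^ q := by rw [← ENNReal.rpow_mul]; simp [hq0.ne']
      _ ≤ R ^ q := by gcongr
  have hmono : ∀ x, Monotone fun k => T k x := fun x k l hkl => by
    by_cases hx : x ∈ spanningSets μ k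
    · have hx' := monotone_spanningSets μ hkl hx
      simp only [T, hx, hx', Set.indicator_of_mem]
      gcongr
    · simp [T, hx]
  have hlim : ∀ x, Filter.Tendsto (fun k => T k x ^ q) Filter.atTop (nhds (S x ^ q)) := fun x => by
    refine ((ENNReal.continuous_rpow_const (y := q)).tendsto _).comp ?_
    have : Filter.Tendsto (fun k : ℕ => min (S x) (k : ℝ≥0∞)) Filter.atTop (nhds (S x)) := by
      have := (tendsto_const_nhds (x := S x)).min ENNReal.tendsto_nat_nhds_top
      simpa using this
    refine this.congr' ?_
    have hx : x ∈ ⋃ k, spanningSets μ k := by simp [iUnion_spanningSets]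
    obtain ⟨k, hk⟩ := Set.mem_iUnion.1 hx
    filter_upwards [Filter.eventually_ge_atTop k] with l hl
    have hx' := monotone_spanningSets μ hl hk
    simp [T, hx']
  have hfin : ∫⁻ x, S x ^ q ∂μ ≤ R ^ q := by
    refine le_of_tendsto' (lintegral_tendsto_of_tendsto_of_monotone
      (fun k => ((hTm k).pow_const q).aemeasurable) ?_ (Filter.Eventually.of_forall hlim)) key
    exact Filter.Eventually.of_forall fun x k l hkl =>
      ENNReal.rpow_le_rpow (hmono x hkl) hq0.le
  calc (∫⁻ x, S x ^ q ∂μ) ^ (1 / q) ≤ (R ^ q) ^ (1 / q) := by gcongr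
    _ = R := by rw [← ENNReal.rpow_mul]; simp [hq0.ne']

theorem eLpNorm_ennreal_const_mul {X : Type*} [MeasurableSpace X] {μ : Measure X} {f : X → ℝ≥0∞}
    (hf : Measurable f) (c : ℝ≥0∞) {p : ℝ≥0∞} (hp : 1 ≤ p) (hpt : p ≠ ∞) :
    eLpNorm (fun x => c * f x) p μ = c * eLpNorm f p μ := by
  have hp0 : p ≠ 0 := (zero_lt_one.trans_le hp).ne'
  have hq0 : 0 < p.toReal := ENNReal.toReal_pos hp0 hpt
  simp only [eLpNorm_eq_lintegral_rpow_enorm_toReal hp0 hpt, enorm_eq_self]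
  simp only [ENNReal.mul_rpow_of_nonneg _ _ hq0.le]
  rw [lintegral_const_mul _ (hf.pow_const _), ENNReal.mul_rpow_of_nonneg _ _ (by positivity),
    ← ENNReal.rpow_mul]
  simp [hq0.ne']

theorem measurable_eLpNorm_right {X Y : Type*} [MeasurableSpace X] [MeasurableSpace Y]
    {μ : Measure X} [SFinite μ] {ε : Type*} [TopologicalSpace ε] [ContinuousENorm ε]
    [MeasurableSpace ε] [OpensMeasurableSpace ε] {F : X → Y → ε}
    (hF : Measurable (Function.uncurry F)) {p : ℝ≥0∞} (hp : 1 ≤ p) (hpt : p ≠ ∞) :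
    Measurable fun y => eLpNorm (fun x => F x y) p μ := by
  have hp0 : p ≠ 0 := (zero_lt_one.trans_le hp).ne'
  simp only [eLpNorm_eq_lintegral_rpow_enorm_toReal hp0 hpt]
  exact ((hF.enorm.pow_const _).lintegral_prod_left').pow_const _

/-- Hölder's inequality against a bounded integrable kernel. -/
theorem lintegral_mul_le_eLpNorm {X : Type*} [MeasurableSpace X] {μ : Measure X} {h k : X → ℝ≥0∞}
    (hh : Measurable h) (hk : Measurable k) (hk1 : ∀ x, k x ≤ 1) {p : ℝ≥0∞} (hp : 1 ≤ p) :
    ∫⁻ x, h x * k x ∂μ ≤ (1 + ∫⁻ x, k x ∂μ) * eLpNorm h p μ := by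
  -- The integral is an L¹ norm for the measure kμ ≤ μ of total mass a = ∫ k. Comparing L¹ with Lᵖ
  -- there costs a power of a with exponent in [0, 1], hence at most 1 + a.
  have hle : μ.withDensity k ≤ μ := by
    calc μ.withDensity k ≤ μ.withDensity 1 := withDensity_mono (Filter.Eventually.of_forall hk1)
      _ = μ := withDensity_one
  calc ∫⁻ x, h x * k x ∂μ = eLpNorm h 1 (μ.withDensity k) := by
        rw [eLpNorm_one_eq_lintegral_enorm]
        simp only [enorm_eq_self]
        rw [lintegral_withDensity_eq_lintegral_mul _ hk hh]
        simp [mul_comm]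
    _ ≤ eLpNorm h p (μ.withDensity k) *
        (μ.withDensity k) Set.univ ^ (1 / (1 : ℝ≥0∞).toReal - 1 / p.toReal) :=
        eLpNorm_le_eLpNorm_mul_rpow_measure_univ hp hh.aestronglyMeasurable
    _ ≤ eLpNorm h p μ * (1 + ∫⁻ x, k x ∂μ) := by
        gcongr ?_ * ?_
        · exact eLpNorm_mono_measure _ hle
        · rw [withDensity_apply _ MeasurableSet.univ, Measure.restrict_univ]
          set a := ∫⁻ x, k x ∂μ
          have hb0 : 0 ≤ 1 / (1 : ℝ≥0∞).toReal - 1 / p.toReal := by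
            rcases eq_or_ne p ∞ with rfl | hpt
            · simp
            · have : 1 ≤ p.toReal := by
                rw [← ENNReal.toReal_one]; exact ENNReal.toReal_mono hpt hp
              have h2 : 1 / p.toReal ≤ 1 := by
                rw [div_le_one (by linarith)]; exact this
              simpa using h2
          have hb1 : 1 / (1 : ℝ≥0∞).toReal - 1 / p.toReal ≤ 1 := by simp
          calc a ^ (1 / (1 : ℝ≥0∞).toReal - 1 / p.toReal)
              ≤ (1 + a) ^ (1 / (1 : ℝ≥0∞).toReal - 1 / p.toReal) := by gcongr; exact le_add_self
            _ ≤ (1 + a) ^ (1 : ℝ) :=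
                ENNReal.rpow_le_rpow_of_exponent_le le_self_add hb1
            _ = 1 + a := ENNReal.rpow_one _
    _ = _ := mul_comm _ _

/-! ### Polynomial kernels, submultiplicative weights and convolution on phase space -/

section Kernels

variable {n : ℕ}

/-- The kernel `(1 + ‖x‖)⁻ᴺ`. -/
noncomputable def decay (N : ℕ) (x : EuclideanSpace ℝ (Fin n)) : ℝ≥0∞ :=
  ENNReal.ofReal ((1 + ‖x‖) ^ N)⁻¹

/-- The weight `(1 + δ ‖ξ‖)ˢ`. -/
noncomputable def weight (δ s : ℝ) (ξ : EuclideanSpace ℝ (Fin n)) : ℝ≥0∞ :=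
  ENNReal.ofReal ((1 + δ * ‖ξ‖) ^ s)

@[fun_prop]
theorem measurable_decay (N : ℕ) : Measurable (decay N : EuclideanSpace ℝ (Fin n) → ℝ≥0∞) := by
  unfold decay; fun_prop

@[fun_prop]
theorem measurable_weight (δ s : ℝ) :
    Measurable (weight δ s : EuclideanSpace ℝ (Fin n) → ℝ≥0∞) := by
  unfold weight; fun_prop

theorem decay_le_one (N : ℕ) (x : EuclideanSpace ℝ (Fin n)) : decay N x ≤ 1 := by
  rw [decay, ENNReal.ofReal_le_one]
  exact inv_le_one_of_one_le₀ (one_le_pow₀ (by simp))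

theorem decay_neg (N : ℕ) (x : EuclideanSpace ℝ (Fin n)) : decay N (-x) = decay N x := by
  simp [decay]

theorem decay_sub_comm (N : ℕ) (x y : EuclideanSpace ℝ (Fin n)) :
    decay N (x - y) = decay N (y - x) := by
  rw [← decay_neg, neg_sub]

/-- Peetre's inequality: a polynomial kernel, unlike a Gaussian one, survives a translation at the
price of a factor depending only on the shift. -/
theorem decay_sub_le (N : ℕ) (x y : EuclideanSpace ℝ (Fin n)) :
    decay N (x - y) ≤ ENNReal.ofReal ((1 + ‖y‖) ^ N) * decay N x := by
  rw [decay, decay, ← ENNReal.ofReal_mul (by positivity)]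
  refine ENNReal.ofReal_le_ofReal ?_
  rw [← div_eq_mul_inv, inv_eq_one_div, div_le_div_iff₀ (by positivity) (by positivity), one_mul,
    ← mul_pow]
  refine pow_le_pow_left₀ (by positivity) ?_ N
  have h : ‖x‖ ≤ ‖x - y‖ + ‖y‖ := by simpa using norm_add_le (x - y) y
  nlinarith [norm_nonneg y, norm_nonneg (x - y)]

theorem enorm_le_decay_of_norm_mul_le {N : ℕ} {x : EuclideanSpace ℝ (Fin n)} {F : Type*}
    [NormedAddCommGroup F] {a : F} {C : ℝ} (h : (1 + ‖x‖) ^ N * ‖a‖ ≤ C) :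
    ‖a‖ₑ ≤ ENNReal.ofReal C * decay N x := by
  have hC : 0 ≤ C := le_trans (by positivity) h
  rw [decay, ← ENNReal.ofReal_mul hC, ← ofReal_norm, ← div_eq_mul_inv]
  refine ENNReal.ofReal_le_ofReal ?_
  rw [le_div_iff₀ (by positivity), mul_comm]
  exact h

theorem one_le_weight {δ s : ℝ} (hδ : 0 ≤ δ) (hs : 0 ≤ s) (ξ : EuclideanSpace ℝ (Fin n)) :
    1 ≤ weight δ s ξ := by
  rw [weight, ENNReal.one_le_ofReal]
  exact Real.one_le_rpow (by nlinarith [mul_nonneg hδ (norm_nonneg ξ)]) hs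

/-- The constant here is exactly 1, which the bracket weight of the norm does not offer. Powers of a
convolution operator can therefore be estimated without accumulating constants. -/
theorem weight_add_le {δ s : ℝ} (hδ : 0 ≤ δ) (hs : 0 ≤ s) (ξ η : EuclideanSpace ℝ (Fin n)) :
    weight δ s (ξ + η) ≤ weight δ s ξ * weight δ s η := by
  have h1 := mul_nonneg hδ (norm_nonneg ξ)
  have h2 := mul_nonneg hδ (norm_nonneg η)
  have h3 := mul_nonneg hδ (norm_nonneg (ξ + η))
  rw [weight, weight, weight, ← ENNReal.ofReal_mul (by positivity),
    ← Real.mul_rpow (by positivity) (by positivity)]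
  refine ENNReal.ofReal_le_ofReal (Real.rpow_le_rpow (by positivity) ?_ hs)
  have := mul_le_mul_of_nonneg_left (norm_add_le ξ η) hδ
  nlinarith [mul_nonneg h1 h2]

theorem weight_mono {δ δ' s : ℝ} (hδ : 0 ≤ δ) (hs : 0 ≤ s) (h : δ ≤ δ')
    (ξ : EuclideanSpace ℝ (Fin n)) : weight δ s ξ ≤ weight δ' s ξ := by
  rw [weight, weight]
  gcongr

/-- All weights with 0 < δ ≤ 1 are equivalent, so finiteness may be proved for whichever δ is
convenient. -/
theorem weight_one_le {δ s : ℝ} (hδ : 0 < δ) (hδ1 : δ ≤ 1) (hs : 0 ≤ s)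
    (ξ : EuclideanSpace ℝ (Fin n)) :
    weight 1 s ξ ≤ ENNReal.ofReal (δ⁻¹ ^ s) * weight δ s ξ := by
  rw [weight, weight, ← ENNReal.ofReal_mul (by positivity),
    ← Real.mul_rpow (by positivity) (by positivity)]
  gcongr
  rw [mul_add, ← mul_assoc, inv_mul_cancel₀ hδ.ne', mul_one]
  gcongr
  exact (one_le_inv₀ hδ).2 hδ1

theorem bracket_le_weight {s : ℝ} (hs : 0 ≤ s) (ξ : EuclideanSpace ℝ (Fin n)) :
    ENNReal.ofReal ((1 + ‖ξ‖ ^ 2) ^ (s / 2)) ≤ weight 1 s ξ := by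
  rw [weight]
  refine ENNReal.ofReal_le_ofReal ?_
  calc (1 + ‖ξ‖ ^ 2) ^ (s / 2) ≤ ((1 + ‖ξ‖) ^ 2) ^ (s / 2) := by
        gcongr; nlinarith [norm_nonneg ξ]
    _ = _ := by
        rw [← Real.rpow_natCast, ← Real.rpow_mul (by positivity), one_mul]
        congr 1
        push_cast; ring

theorem weight_le_bracket {s : ℝ} (hs : 0 ≤ s) (ξ : EuclideanSpace ℝ (Fin n)) :
    weight 1 s ξ ≤ ENNReal.ofReal (2 ^ (s / 2)) * ENNReal.ofReal ((1 + ‖ξ‖ ^ 2) ^ (s / 2)) := by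
  rw [weight, ← ENNReal.ofReal_mul (by positivity),
    ← Real.mul_rpow (by positivity) (by positivity)]
  refine ENNReal.ofReal_le_ofReal ?_
  calc (1 + 1 * ‖ξ‖) ^ s = ((1 + ‖ξ‖) ^ 2) ^ (s / 2) := by
        rw [← Real.rpow_natCast, ← Real.rpow_mul (by positivity), one_mul]
        congr 1
        push_cast; ring
    _ ≤ _ := by gcongr; nlinarith [sq_nonneg (1 - ‖ξ‖)]

theorem one_le_bracket {s : ℝ} (hs : 0 ≤ s) (ξ : EuclideanSpace ℝ (Fin n)) :
    1 ≤ ENNReal.ofReal ((1 + ‖ξ‖ ^ 2) ^ (s / 2)) := by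
  rw [ENNReal.one_le_ofReal]
  exact Real.one_le_rpow (by nlinarith [sq_nonneg ‖ξ‖]) (by positivity)

theorem lintegral_weight_mul_decay_ne_top {s : ℝ} {N : ℕ} (hN : n + s < N) :
    ∫⁻ ξ : EuclideanSpace ℝ (Fin n), weight 1 s ξ * decay N ξ ≠ ∞ := by
  have h : ((Module.finrank ℝ (EuclideanSpace ℝ (Fin n)) : ℕ) : ℝ) < N - s := by
    simp; linarith
  have := (finite_integral_one_add_norm (E := EuclideanSpace ℝ (Fin n)) (μ := volume) h).ne
  convert this using 3 with ξ
  have h1 : 0 < 1 + ‖ξ‖ := by positivity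
  rw [weight, decay, ← ENNReal.ofReal_mul (by positivity), one_mul, neg_sub,
    Real.rpow_sub h1, Real.rpow_natCast, div_eq_mul_inv]

theorem lintegral_decay_ne_top {N : ℕ} (hN : n < N) :
    ∫⁻ ξ : EuclideanSpace ℝ (Fin n), decay N ξ ≠ ∞ := by
  have h := lintegral_weight_mul_decay_ne_top (n := n) (s := 0) (N := N) (by simpa using hN)
  simpa [weight] using h

/-- Weighted `L¹` norms are submultiplicative for convolution. -/
theorem lintegral_weight_mul_conv_le {δ s : ℝ} (hδ : 0 ≤ δ) (hs : 0 ≤ s)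
    {A k : EuclideanSpace ℝ (Fin n) → ℝ≥0∞} (hA : Measurable A) (hk : Measurable k) :
    ∫⁻ ζ, weight δ s ζ * ∫⁻ η, A η * k (ζ - η) ≤
      (∫⁻ η, weight δ s η * A η) * ∫⁻ ζ, weight δ s ζ * k ζ := by
  calc ∫⁻ ζ, weight δ s ζ * ∫⁻ η, A η * k (ζ - η)
      ≤ ∫⁻ ζ, ∫⁻ η, (weight δ s η * A η) * (weight δ s (ζ - η) * k (ζ - η)) := by
        refine lintegral_mono fun ζ => ?_
        rw [← lintegral_const_mul _ (by fun_prop)]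
        refine lintegral_mono fun η => ?_
        calc weight δ s ζ * (A η * k (ζ - η))
            ≤ (weight δ s η * weight δ s (ζ - η)) * (A η * k (ζ - η)) := by
              gcongr
              simpa using weight_add_le hδ hs η (ζ - η)
          _ = _ := by ring
    _ = ∫⁻ η, ∫⁻ ζ, (weight δ s η * A η) * (weight δ s (ζ - η) * k (ζ - η)) := by
        refine lintegral_lintegral_swap (Measurable.aemeasurable ?_)
        unfold Function.uncurry
        fun_prop
    _ = ∫⁻ η, (weight δ s η * A η) * ∫⁻ ζ, weight δ s ζ * k ζ := by
        refine lintegral_congr fun η => ?_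
        rw [lintegral_const_mul _ (by fun_prop),
          lintegral_sub_right_eq_self (fun ζ => weight δ s ζ * k ζ) η]
    _ = _ := by rw [lintegral_mul_const _ (by fun_prop)]

/-- Convolution of `F` with the kernel `(1 + ‖x‖)⁻ᴺ k(ξ)` on phase space. -/
noncomputable def smear (N : ℕ) (k : EuclideanSpace ℝ (Fin n) → ℝ≥0∞)
    (F : EuclideanSpace ℝ (Fin n) → EuclideanSpace ℝ (Fin n) → ℝ≥0∞)
    (z ζ : EuclideanSpace ℝ (Fin n)) : ℝ≥0∞ :=
  ∫⁻ η, ∫⁻ x, F x η * (decay N (z - x) * k (ζ - η))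

variable {k : EuclideanSpace ℝ (Fin n) → ℝ≥0∞} {F : EuclideanSpace ℝ (Fin n) → EuclideanSpace ℝ (Fin n) → ℝ≥0∞}

theorem smear_eq_lintegral_prod (hF : Measurable (Function.uncurry F)) (hk : Measurable k) (N : ℕ)
    (z ζ : EuclideanSpace ℝ (Fin n)) :
    smear N k F z ζ = ∫⁻ w : EuclideanSpace ℝ (Fin n) × EuclideanSpace ℝ (Fin n),
      F w.1 w.2 * (decay N (z - w.1) * k (ζ - w.2)) := by
  have h : Measurable fun w : EuclideanSpace ℝ (Fin n) × EuclideanSpace ℝ (Fin n) =>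
      F w.1 w.2 * (decay N (z - w.1) * k (ζ - w.2)) := by
    have : Measurable fun w : EuclideanSpace ℝ (Fin n) × EuclideanSpace ℝ (Fin n) => F w.1 w.2 := hF
    fun_prop
  rw [Measure.volume_eq_prod, lintegral_prod_symm _ h.aemeasurable]
  rfl

theorem measurable_smear (hF : Measurable (Function.uncurry F)) (hk : Measurable k) (N : ℕ) :
    Measurable (Function.uncurry (smear N k F)) := by
  have hF' : Measurable fun w : EuclideanSpace ℝ (Fin n) × EuclideanSpace ℝ (Fin n) =>
    F w.1 w.2 := hF
  unfold Function.uncurry smear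
  refine Measurable.lintegral_prod_right (Measurable.lintegral_prod_right ?_)
  have : Measurable fun w : ((EuclideanSpace ℝ (Fin n) × EuclideanSpace ℝ (Fin n)) ×
      EuclideanSpace ℝ (Fin n)) × EuclideanSpace ℝ (Fin n) => F w.2 w.1.2 :=
    hF'.comp (measurable_snd.prodMk (measurable_snd.comp measurable_fst))
  unfold Function.uncurry
  fun_prop

/-- Young's inequality in the position variable: the smear is a superposition of translates of the
slices of F, and Minkowski's inequality moves the Lᵖ norm inside both integrals. The frequency
variable keeps its convolution. -/
theorem eLpNorm_smear_le (hF : Measurable (Function.uncurry F)) (hk : Measurable k) (N : ℕ)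
    {p : ℝ≥0∞} (hp : 1 ≤ p) (hpt : p ≠ ∞)
    (ζ : EuclideanSpace ℝ (Fin n)) :
    eLpNorm (fun z => smear N k F z ζ) p volume ≤
      (∫⁻ x : EuclideanSpace ℝ (Fin n), decay N x) *
        ∫⁻ η, eLpNorm (fun x => F x η) p volume * k (ζ - η) := by
  have hF' : Measurable fun w : EuclideanSpace ℝ (Fin n) × EuclideanSpace ℝ (Fin n) =>
    F w.1 w.2 := hF
  have hsec : ∀ η, Measurable fun x => F x η := fun η => hF.of_uncurry_right
  have hA := measurable_eLpNorm_right (μ := (volume : Measure (EuclideanSpace ℝ (Fin n)))) hF hp hpt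
  -- The substitution x = z - y puts the variable z into F only, so that translation invariance of
  -- the Lᵖ norm applies.
  have e : ∀ z η, ∫⁻ x, F x η * (decay N (z - x) * k (ζ - η)) =
      ∫⁻ y, F (z - y) η * (decay N y * k (ζ - η)) := fun z η => by
    rw [← lintegral_sub_left_eq_self (fun x => F x η * (decay N (z - x) * k (ζ - η))) z]
    simp
  have m1 : Measurable fun w : (EuclideanSpace ℝ (Fin n) × EuclideanSpace ℝ (Fin n)) ×
      EuclideanSpace ℝ (Fin n) => F (w.1.1 - w.2) w.1.2 * (decay N w.2 * k (ζ - w.1.2)) := by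
    have : Measurable fun w : (EuclideanSpace ℝ (Fin n) × EuclideanSpace ℝ (Fin n)) ×
      EuclideanSpace ℝ (Fin n) => F (w.1.1 - w.2) w.1.2 :=
      hF'.comp (by fun_prop : Measurable fun w : (EuclideanSpace ℝ (Fin n) ×
        EuclideanSpace ℝ (Fin n)) × EuclideanSpace ℝ (Fin n) => (w.1.1 - w.2, w.1.2))
    fun_prop
  simp only [smear, e]
  refine (eLpNorm_lintegral_le ?_ hp hpt).trans ?_
  · exact m1.lintegral_prod_right'
  rw [← lintegral_const_mul _ (by fun_prop)]
  refine lintegral_mono fun η => ?_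
  refine (eLpNorm_lintegral_le (F := fun z y => F (z - y) η * (decay N y * k (ζ - η)))
    ?_ hp hpt).trans ?_
  · exact m1.comp (by fun_prop : Measurable fun w : EuclideanSpace ℝ (Fin n) ×
        EuclideanSpace ℝ (Fin n) => ((w.1, η), w.2))
  · have : ∀ y, eLpNorm (fun z => F (z - y) η * (decay N y * k (ζ - η))) p volume =
        decay N y * (eLpNorm (fun x => F x η) p volume * k (ζ - η)) := fun y => by
      have h1 := eLpNorm_ennreal_const_mul (μ := (volume : Measure (EuclideanSpace ℝ (Fin n))))
        (f := fun z => F (z - y) η) ((hsec η).comp (measurable_sub_const y))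
        (decay N y * k (ζ - η)) hp hpt
      have h2 : eLpNorm (fun z => F (z - y) η) p volume = eLpNorm (fun x => F x η) p volume := by
        simp only [eLpNorm_eq_lintegral_rpow_enorm_toReal (zero_lt_one.trans_le hp).ne' hpt]
        rw [lintegral_sub_right_eq_self (fun z => ‖F z η‖ₑ ^ p.toReal) y]
      rw [h2] at h1
      calc _ = eLpNorm (fun z => decay N y * k (ζ - η) * F (z - y) η) p volume := by
            congr 1; funext z; exact mul_comm _ _
        _ = _ := by rw [h1]; ring
    simp only [this]
    rw [lintegral_mul_const _ (by fun_prop)]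

/-- The counterpart of `eLpNorm_smear_le` with the supremum over position on the left: Hölder's
inequality against the bounded integrable kernel replaces Young's. It is the source of all passages
from Lᵖ to L^∞ in position. -/
theorem smear_le (hF : Measurable (Function.uncurry F)) (hk : Measurable k) (N : ℕ) {p : ℝ≥0∞} (hp : 1 ≤ p)
    (hpt : p ≠ ∞) (z ζ : EuclideanSpace ℝ (Fin n)) :
    smear N k F z ζ ≤ (1 + ∫⁻ x : EuclideanSpace ℝ (Fin n), decay N x) *
        ∫⁻ η, eLpNorm (fun x => F x η) p volume * k (ζ - η) := by
  have hsec : ∀ η, Measurable fun x => F x η := fun η => hF.of_uncurry_right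
  have hA := measurable_eLpNorm_right (μ := (volume : Measure (EuclideanSpace ℝ (Fin n)))) hF hp hpt
  rw [← lintegral_const_mul _ (by fun_prop)]
  refine lintegral_mono fun η => ?_
  have := lintegral_mul_le_eLpNorm (μ := (volume : Measure (EuclideanSpace ℝ (Fin n)))) (hsec η)
    (k := fun x => decay N (z - x)) (by fun_prop) (fun x => decay_le_one _ _) hp
  rw [lintegral_sub_left_eq_self (fun x => decay N x) z] at this
  calc ∫⁻ x, F x η * (decay N (z - x) * k (ζ - η))
      = (∫⁻ x, F x η * decay N (z - x)) * k (ζ - η) := by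
        have := hsec η
        rw [← lintegral_mul_const _ (by fun_prop)]
        simp only [mul_assoc]
    _ ≤ _ := by
        rw [← mul_assoc]
        gcongr

end Kernels

/-! ### Quantitative bounds for Schwartz functions under time-frequency shifts -/

section SchwartzBounds

open scoped FourierTransform

variable {n : ℕ}

/-- The supremum of the Schwartz seminorms of index at most `(M, M)`. -/
noncomputable def schwartzBound (M : ℕ) : Seminorm ℝ 𝓢(EuclideanSpace ℝ (Fin n), ℂ) :=
  (Finset.Iic (M, M)).sup (schwartzSeminormFamily ℝ (EuclideanSpace ℝ (Fin n)) ℂ)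

theorem schwartzSeminormFamily_le_schwartzBound {M : ℕ} {i : ℕ × ℕ} (h1 : i.1 ≤ M) (h2 : i.2 ≤ M) :
    schwartzSeminormFamily ℝ (EuclideanSpace ℝ (Fin n)) ℂ i ≤ schwartzBound M :=
  Finset.le_sup (f := schwartzSeminormFamily ℝ (EuclideanSpace ℝ (Fin n)) ℂ)
    (Finset.mem_Iic.2 ⟨h1, h2⟩)

theorem continuous_schwartzBound (M : ℕ) :
    Continuous (schwartzBound M : Seminorm ℝ 𝓢(EuclideanSpace ℝ (Fin n), ℂ)) :=
  Seminorm.continuous_finsetSup fun i _ =>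
    (schwartz_withSeminorms ℝ (EuclideanSpace ℝ (Fin n)) ℂ).continuous_seminorm i

theorem pow_mul_norm_iteratedFDeriv_le {M k l : ℕ} (hk : k ≤ M) (hl : l ≤ M)
    (θ : 𝓢(EuclideanSpace ℝ (Fin n), ℂ)) (t : EuclideanSpace ℝ (Fin n)) :
    (1 + ‖t‖) ^ k * ‖iteratedFDeriv ℝ l θ t‖ ≤ 2 ^ M * schwartzBound M θ :=
  SchwartzMap.one_add_le_sup_seminorm_apply (𝕜 := ℝ) (m := (M, M)) hk hl θ t

theorem pow_mul_norm_le (M : ℕ) (θ : 𝓢(EuclideanSpace ℝ (Fin n), ℂ))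
    (t : EuclideanSpace ℝ (Fin n)) :
    (1 + ‖t‖) ^ M * ‖θ t‖ ≤ 2 ^ M * schwartzBound M θ := by
  simpa using pow_mul_norm_iteratedFDeriv_le le_rfl (Nat.zero_le M) θ t

theorem schwartzBound_le {M : ℕ} {θ : 𝓢(EuclideanSpace ℝ (Fin n), ℂ)} {C : ℝ} (hC : 0 ≤ C)
    (h : ∀ l ≤ M, ∀ t, (1 + ‖t‖) ^ M * ‖iteratedFDeriv ℝ l θ t‖ ≤ C) :
    schwartzBound M θ ≤ C := by
  refine Seminorm.finset_sup_apply_le hC fun i hi => ?_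
  have hi' := Finset.mem_Iic.1 hi
  refine SchwartzMap.seminorm_le_bound ℝ i.1 i.2 θ hC fun t => ?_
  refine le_trans ?_ (h i.2 hi'.2 t)
  gcongr
  calc ‖t‖ ^ i.1 ≤ (1 + ‖t‖) ^ i.1 := by gcongr; linarith
    _ ≤ (1 + ‖t‖) ^ M := pow_le_pow_right₀ (by simp) hi'.1

theorem exists_le_schwartzBound {q : Seminorm ℝ 𝓢(EuclideanSpace ℝ (Fin n), ℂ)}
    (hq : Continuous q) : ∃ (K : ℕ) (C : ℝ), 0 ≤ C ∧ ∀ θ, q θ ≤ C * schwartzBound K θ := by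
  obtain ⟨s, C, -, hC⟩ := Seminorm.bound_of_continuous
    (schwartz_withSeminorms ℝ (EuclideanSpace ℝ (Fin n)) ℂ) q hq
  refine ⟨s.sup (fun i => max i.1 i.2), C, C.2, fun θ => (hC θ).trans ?_⟩
  rw [_root_.smul_apply, NNReal.smul_def, smul_eq_mul]
  gcongr
  refine (Finset.sup_le fun i hi => ?_ : s.sup _ ≤ schwartzBound _) θ
  have := Finset.le_sup (f := fun i : ℕ × ℕ => max i.1 i.2) hi
  exact schwartzSeminormFamily_le_schwartzBound ((le_max_left _ _).trans this)
    ((le_max_right _ _).trans this)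

/-- The bounds form an increasing family defining the Schwartz topology, so continuity of an
operator means a bound with some loss of order. The Fourier transform and conjugation enter the
estimates only in this form. -/
theorem exists_schwartzBound_map_le
    (T : 𝓢(EuclideanSpace ℝ (Fin n), ℂ) →L[ℝ] 𝓢(EuclideanSpace ℝ (Fin n), ℂ)) (M : ℕ) :
    ∃ (K : ℕ) (C : ℝ), 0 ≤ C ∧ ∀ θ, schwartzBound M (T θ) ≤ C * schwartzBound K θ :=
  exists_le_schwartzBound (q := (schwartzBound M).comp T.toLinearMap)
    ((continuous_schwartzBound M).comp T.continuous)

theorem one_add_norm_le_mul (x y : EuclideanSpace ℝ (Fin n)) :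
    1 + ‖x + y‖ ≤ (1 + ‖x‖) * (1 + ‖y‖) := by
  have := norm_add_le x y
  nlinarith [norm_nonneg x, norm_nonneg y, mul_nonneg (norm_nonneg x) (norm_nonneg y)]

theorem one_add_norm_pow_le_mul (N : ℕ) (x y : EuclideanSpace ℝ (Fin n)) :
    (1 + ‖x + y‖) ^ N ≤ (1 + ‖x‖) ^ N * (1 + ‖y‖) ^ N := by
  rw [← mul_pow]
  exact pow_le_pow_left₀ (by positivity) (one_add_norm_le_mul x y) N

theorem schwartzBound_translate_le (M : ℕ) (x : EuclideanSpace ℝ (Fin n))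
    (θ : 𝓢(EuclideanSpace ℝ (Fin n), ℂ)) :
    schwartzBound M (SchwartzMap.compSubConstCLM ℝ x θ) ≤
      2 ^ M * (1 + ‖x‖) ^ M * schwartzBound M θ := by
  refine schwartzBound_le (by positivity) fun l hl t => ?_
  have e : ⇑(SchwartzMap.compSubConstCLM ℝ x θ) = fun t => θ (t - x) := by ext; simp
  rw [e, iteratedFDeriv_comp_sub]
  calc (1 + ‖t‖) ^ M * ‖iteratedFDeriv ℝ l θ (t - x)‖
      ≤ ((1 + ‖t - x‖) ^ M * (1 + ‖x‖) ^ M) * ‖iteratedFDeriv ℝ l θ (t - x)‖ := by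
        gcongr
        simpa using one_add_norm_pow_le_mul M (t - x) x
    _ = (1 + ‖x‖) ^ M * ((1 + ‖t - x‖) ^ M * ‖iteratedFDeriv ℝ l θ (t - x)‖) := by ring
    _ ≤ (1 + ‖x‖) ^ M * (2 ^ M * schwartzBound M θ) := by
        gcongr _ * ?_
        exact pow_mul_norm_iteratedFDeriv_le le_rfl hl θ _
    _ = _ := by ring

/-- Mean value inequality on the segment from t to t - x, costing one derivative. Comparing the
weight at t with that at a point of the segment costs the factor (1 + ‖x‖)^M. -/
theorem schwartzBound_translate_sub_le (M : ℕ) (x : EuclideanSpace ℝ (Fin n))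
    (θ : 𝓢(EuclideanSpace ℝ (Fin n), ℂ)) :
    schwartzBound M (SchwartzMap.compSubConstCLM ℝ x θ - θ) ≤
      2 ^ (M + 1) * (1 + ‖x‖) ^ M * schwartzBound (M + 1) θ * ‖x‖ := by
  refine schwartzBound_le (by positivity) fun l hl t => ?_
  have e : ⇑(SchwartzMap.compSubConstCLM ℝ x θ - θ) = (fun t => θ (t - x)) - ⇑θ := by ext; simp
  have h1 : ContDiff ℝ l (θ : EuclideanSpace ℝ (Fin n) → ℂ) := θ.smooth l
  have h2 : ContDiff ℝ l fun t => θ (t - x) := h1.comp (by fun_prop)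
  rw [e, iteratedFDeriv_sub_apply h2.contDiffAt h1.contDiffAt, iteratedFDeriv_comp_sub]
  have hd : ∀ y ∈ segment ℝ t (t - x),
      DifferentiableAt ℝ (iteratedFDeriv ℝ l (θ : EuclideanSpace ℝ (Fin n) → ℂ)) y := fun y _ =>
    ((θ.smooth (l + 1)).differentiable_iteratedFDeriv (by exact_mod_cast Nat.lt_succ_self l)) y
  have hb : ∀ y ∈ segment ℝ t (t - x),
      ‖fderiv ℝ (iteratedFDeriv ℝ l (θ : EuclideanSpace ℝ (Fin n) → ℂ)) y‖ ≤
        2 ^ (M + 1) * (1 + ‖x‖) ^ M * schwartzBound (M + 1) θ / (1 + ‖t‖) ^ M := fun y hy => by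
    rw [norm_fderiv_iteratedFDeriv, le_div_iff₀ (by positivity)]
    obtain ⟨a, b, ha, hb, hab, rfl⟩ := hy
    set y := a • t + b • (t - x) with hy
    have hy' : t = y + b • x := by
      rw [hy, smul_sub, ← add_sub_assoc, ← add_smul, hab]; simp
    have hbx : ‖b • x‖ ≤ ‖x‖ := by
      rw [norm_smul, Real.norm_of_nonneg hb]
      exact mul_le_of_le_one_left (norm_nonneg _) (by linarith)
    calc ‖iteratedFDeriv ℝ (l + 1) θ y‖ * (1 + ‖t‖) ^ M
        ≤ ‖iteratedFDeriv ℝ (l + 1) θ y‖ * ((1 + ‖y‖) ^ M * (1 + ‖x‖) ^ M) := by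
          gcongr
          calc (1 + ‖t‖) ^ M ≤ (1 + ‖y‖) ^ M * (1 + ‖b • x‖) ^ M := by
                conv_lhs => rw [hy']
                exact one_add_norm_pow_le_mul M y (b • x)
            _ ≤ _ := by gcongr
      _ = ((1 + ‖y‖) ^ M * ‖iteratedFDeriv ℝ (l + 1) θ y‖) * (1 + ‖x‖) ^ M := by ring
      _ ≤ (2 ^ (M + 1) * schwartzBound (M + 1) θ) * (1 + ‖x‖) ^ M := by
          gcongr ?_ * _
          exact pow_mul_norm_iteratedFDeriv_le (Nat.le_succ M) (by omega) θ y
      _ = _ := by ring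
  have := (convex_segment (𝕜 := ℝ) t (t - x)).norm_image_sub_le_of_norm_fderiv_le hd hb
    (left_mem_segment ℝ _ _) (right_mem_segment ℝ _ _)
  rw [sub_sub_cancel_left, norm_neg] at this
  calc _ ≤ (1 + ‖t‖) ^ M * (2 ^ (M + 1) * (1 + ‖x‖) ^ M * schwartzBound (M + 1) θ /
        (1 + ‖t‖) ^ M * ‖x‖) := by gcongr
    _ = _ := by field_simp

theorem tendsto_schwartz_of_schwartzBound {Y : Type*} {l : Filter Y}
    {Ψ : Y → 𝓢(EuclideanSpace ℝ (Fin n), ℂ)} {ψ : 𝓢(EuclideanSpace ℝ (Fin n), ℂ)}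
    (h : ∀ M, Filter.Tendsto (fun y => schwartzBound M (Ψ y - ψ)) l (nhds 0)) :
    Filter.Tendsto Ψ l (nhds ψ) := by
  rw [(schwartz_withSeminorms ℝ (EuclideanSpace ℝ (Fin n)) ℂ).tendsto_nhds]
  intro i ε hε
  filter_upwards [(h (max i.1 i.2)).eventually_lt_const hε] with y hy
  exact lt_of_le_of_lt (schwartzSeminormFamily_le_schwartzBound (le_max_left _ _)
    (le_max_right _ _) _) hy

/-- Translation acts jointly continuously on Schwartz functions. -/
theorem continuous_translate :
    Continuous fun q : EuclideanSpace ℝ (Fin n) × 𝓢(EuclideanSpace ℝ (Fin n), ℂ) =>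
      SchwartzMap.compSubConstCLM ℝ q.1 q.2 := by
  refine continuous_iff_continuousAt.2 fun ⟨x, θ⟩ => tendsto_schwartz_of_schwartzBound fun M => ?_
  set τ := SchwartzMap.compSubConstCLM ℝ x θ
  have hle : ∀ q : EuclideanSpace ℝ (Fin n) × 𝓢(EuclideanSpace ℝ (Fin n), ℂ),
      schwartzBound M (SchwartzMap.compSubConstCLM ℝ q.1 q.2 - τ) ≤
        2 ^ M * (1 + ‖q.1‖) ^ M * schwartzBound M (q.2 - θ) +
        2 ^ (M + 1) * (1 + ‖q.1 - x‖) ^ M * schwartzBound (M + 1) τ * ‖q.1 - x‖ := fun q => by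
    -- The change of function and the change of translation are separated: the former is bounded
    -- uniformly near x, and the latter is a small translation of the fixed function τ.
    have e : SchwartzMap.compSubConstCLM ℝ q.1 q.2 - τ =
        SchwartzMap.compSubConstCLM ℝ q.1 (q.2 - θ) +
          (SchwartzMap.compSubConstCLM ℝ (q.1 - x) τ - τ) := by
      ext t
      simp [τ]
    rw [e]
    exact (map_add_le_add _ _ _).trans (add_le_add (schwartzBound_translate_le _ _ _)
      (schwartzBound_translate_sub_le _ _ _))
  have hc : Continuous fun q : EuclideanSpace ℝ (Fin n) × 𝓢(EuclideanSpace ℝ (Fin n), ℂ) =>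
      2 ^ M * (1 + ‖q.1‖) ^ M * schwartzBound M (q.2 - θ) +
        2 ^ (M + 1) * (1 + ‖q.1 - x‖) ^ M * schwartzBound (M + 1) τ * ‖q.1 - x‖ := by
    have : Continuous fun q : EuclideanSpace ℝ (Fin n) × 𝓢(EuclideanSpace ℝ (Fin n), ℂ) =>
      schwartzBound M (q.2 - θ) :=
        (continuous_schwartzBound M).comp (continuous_snd.sub continuous_const)
    fun_prop
  have h0 := hc.tendsto (x, θ)
  simp only [sub_self, map_zero, norm_zero, mul_zero, add_zero] at h0
  exact squeeze_zero (fun q => apply_nonneg _ _) hle h0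

/-- The Fourier transform conjugates modulation into translation; the shift is by ξ / 2π because the
characters are not normalised by 2π. Regularity of `conjShift` in both parameters thus reduces to
translations. -/
theorem character_smul_eq_fourierInv (ξ : EuclideanSpace ℝ (Fin n))
    (θ : 𝓢(EuclideanSpace ℝ (Fin n), ℂ)) :
    SchwartzMap.smulLeftCLM ℂ (character ξ) θ =
      𝓕⁻ (SchwartzMap.compSubConstCLM ℝ (-((2 * Real.pi)⁻¹ • ξ)) (𝓕 θ)) := by
  rw [← FourierTransform.fourierInv_fourier_eq (F := 𝓢(EuclideanSpace ℝ (Fin n), ℂ)) (SchwartzMap.smulLeftCLM ℂ (character ξ) θ)]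
  congr 1
  ext w
  rw [SchwartzMap.compSubConstCLM_apply, SchwartzMap.fourier_coe, SchwartzMap.fourier_coe,
    Real.fourier_eq', Real.fourier_eq']
  refine integral_congr_ae (Filter.Eventually.of_forall fun v => ?_)
  simp only [SchwartzMap.smulLeftCLM_apply_apply (hasTemperateGrowth_character ξ), character,
    smul_eq_mul]
  rw [← mul_assoc, ← Complex.exp_add]
  congr 2
  rw [sub_neg_eq_add, inner_add_right, inner_smul_right]
  have : (Real.pi : ℂ) ≠ 0 := by exact_mod_cast Real.pi_ne_zero
  push_cast
  field_simp
  ring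

theorem conjShift_eq_fourierInv (φ : 𝓢(EuclideanSpace ℝ (Fin n), ℂ))
    (x ξ : EuclideanSpace ℝ (Fin n)) :
    conjShift φ x ξ = 𝓕⁻ (SchwartzMap.compSubConstCLM ℝ (-((2 * Real.pi)⁻¹ • ξ))
      (𝓕 (SchwartzMap.postcompCLM (𝕜 := ℝ) (Complex.conjCLE : ℂ →L[ℝ] ℂ)
        (SchwartzMap.compSubConstCLM ℝ x φ)))) :=
  character_smul_eq_fourierInv _ _

theorem continuous_conjShift (φ : 𝓢(EuclideanSpace ℝ (Fin n), ℂ)) :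
    Continuous fun w : EuclideanSpace ℝ (Fin n) × EuclideanSpace ℝ (Fin n) =>
      conjShift φ w.1 w.2 := by
  simp only [conjShift_eq_fourierInv]
  refine (FourierTransform.fourierInvCLM ℝ 𝓢(EuclideanSpace ℝ (Fin n), ℂ)).continuous.comp (continuous_translate.comp (Continuous.prodMk (by fun_prop)
    ((FourierTransform.fourierCLM ℝ 𝓢(EuclideanSpace ℝ (Fin n), ℂ)).continuous.comp ((ContinuousLinearMap.continuous _).comp
      (continuous_translate.comp (Continuous.prodMk continuous_fst continuous_const))))))

theorem exists_schwartzBound_conjShift_le (φ : 𝓢(EuclideanSpace ℝ (Fin n), ℂ)) (M : ℕ) :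
    ∃ (K : ℕ) (C : ℝ), 0 ≤ C ∧ ∀ x ξ, schwartzBound M (conjShift φ x ξ) ≤
      C * ((1 + ‖x‖) ^ K * (1 + ‖ξ‖) ^ K) := by
  obtain ⟨K₁, C₁, hC₁, h₁⟩ := exists_schwartzBound_map_le
    (FourierTransform.fourierInvCLM ℝ 𝓢(EuclideanSpace ℝ (Fin n), ℂ)) M
  obtain ⟨K₂, C₂, hC₂, h₂⟩ := exists_schwartzBound_map_le
    (FourierTransform.fourierCLM ℝ 𝓢(EuclideanSpace ℝ (Fin n), ℂ)) K₁
  obtain ⟨K₃, C₃, hC₃, h₃⟩ := exists_schwartzBound_map_le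
    (SchwartzMap.postcompCLM (𝕜 := ℝ) (E := EuclideanSpace ℝ (Fin n)) (Complex.conjCLE : ℂ →L[ℝ] ℂ)) K₂
  refine ⟨max K₁ K₃, C₁ * (2 ^ K₁ * (C₂ * (C₃ * (2 ^ K₃ * schwartzBound K₃ φ)))), by positivity,
    fun x ξ => ?_⟩
  rw [conjShift_eq_fourierInv]
  have hx : (1 + ‖x‖) ^ K₃ ≤ (1 + ‖x‖) ^ max K₁ K₃ :=
    pow_le_pow_right₀ (by simp) (le_max_right _ _)
  have hξ : (1 + ‖-((2 * Real.pi)⁻¹ • ξ)‖) ^ K₁ ≤ (1 + ‖ξ‖) ^ max K₁ K₃ := by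
    calc (1 + ‖-((2 * Real.pi)⁻¹ • ξ)‖) ^ K₁ ≤ (1 + ‖ξ‖) ^ K₁ := by
          gcongr
          rw [norm_neg, norm_smul]
          refine mul_le_of_le_one_left (norm_nonneg _) ?_
          rw [norm_inv, Real.norm_of_nonneg (by positivity)]
          exact inv_le_one_of_one_le₀ (by nlinarith [Real.pi_gt_three])
      _ ≤ _ := pow_le_pow_right₀ (by simp) (le_max_left _ _)
  refine (h₁ _).trans ?_
  calc _ ≤ C₁ * (2 ^ K₁ * (1 + ‖-((2 * Real.pi)⁻¹ • ξ)‖) ^ K₁ * (C₂ * (C₃ *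
        (2 ^ K₃ * (1 + ‖x‖) ^ K₃ * schwartzBound K₃ φ)))) := by
        refine mul_le_mul_of_nonneg_left ((schwartzBound_translate_le _ _ _).trans ?_) hC₁
        refine mul_le_mul_of_nonneg_left ((h₂ _).trans ?_) (by positivity)
        refine mul_le_mul_of_nonneg_left ((h₃ _).trans ?_) (by positivity)
        exact mul_le_mul_of_nonneg_left (schwartzBound_translate_le _ _ _) (by positivity)
    _ ≤ C₁ * (2 ^ K₁ * (1 + ‖ξ‖) ^ max K₁ K₃ * (C₂ * (C₃ *
        (2 ^ K₃ * (1 + ‖x‖) ^ max K₁ K₃ * schwartzBound K₃ φ)))) := by gcongr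
    _ = _ := by ring

/-- The product of two Schwartz functions. -/
noncomputable def schwartzMul (f g : 𝓢(EuclideanSpace ℝ (Fin n), ℂ)) :
    𝓢(EuclideanSpace ℝ (Fin n), ℂ) :=
  SchwartzMap.pairing (ContinuousLinearMap.mul ℂ ℂ) f g

@[simp]
theorem schwartzMul_apply (f g : 𝓢(EuclideanSpace ℝ (Fin n), ℂ)) (t : EuclideanSpace ℝ (Fin n)) :
    schwartzMul f g t = f t * g t := rfl

/-- A point t cannot be close to both x and 0: 1 + ‖x‖ ≤ (1 + ‖t - x‖)(1 + ‖t‖). The decay of f and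
g therefore pays for the factor in x, and Leibniz's rule contributes 2^l. -/
theorem schwartzBound_mul_translate_le (M N : ℕ) (f g : 𝓢(EuclideanSpace ℝ (Fin n), ℂ))
    (x : EuclideanSpace ℝ (Fin n)) :
    (1 + ‖x‖) ^ N * schwartzBound M (schwartzMul (SchwartzMap.compSubConstCLM ℝ x f) g) ≤
      2 ^ M * (2 ^ (M + N) * schwartzBound (M + N) f) *
        (2 ^ (M + N) * schwartzBound (M + N) g) := by
  have hx : 0 < (1 + ‖x‖) ^ N := by positivity
  rw [← le_div_iff₀' hx]
  refine schwartzBound_le (by positivity) fun l hl t => ?_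
  rw [le_div_iff₀' hx]
  have e : ⇑(schwartzMul (SchwartzMap.compSubConstCLM ℝ x f) g) =
      fun t => (fun t => f (t - x)) t * g t := by ext; simp
  have h1 : ContDiff ℝ l (f : EuclideanSpace ℝ (Fin n) → ℂ) := f.smooth l
  have h2 : ContDiff ℝ l fun t => f (t - x) := h1.comp (by fun_prop)
  rw [e]
  have hL := norm_iteratedFDeriv_mul_le h2 (g.smooth l) t (n := l) le_rfl
  have hw : (1 + ‖x‖) ^ N ≤ (1 + ‖t - x‖) ^ N * (1 + ‖t‖) ^ N := by
    have := one_add_norm_pow_le_mul N (x - t) t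
    rwa [sub_add_cancel, norm_sub_rev] at this
  calc _ ≤ ((1 + ‖t - x‖) ^ N * (1 + ‖t‖) ^ N) * ((1 + ‖t‖) ^ M *
        ∑ i ∈ Finset.range (l + 1), (l.choose i : ℝ) *
          ‖iteratedFDeriv ℝ i (fun t => f (t - x)) t‖ * ‖iteratedFDeriv ℝ (l - i) g t‖) := by
        gcongr
    _ = ∑ i ∈ Finset.range (l + 1), (l.choose i : ℝ) *
          ((1 + ‖t - x‖) ^ N * ‖iteratedFDeriv ℝ i f (t - x)‖) *
          ((1 + ‖t‖) ^ (M + N) * ‖iteratedFDeriv ℝ (l - i) g t‖) := by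
        rw [Finset.mul_sum, Finset.mul_sum]
        refine Finset.sum_congr rfl fun i _ => ?_
        rw [iteratedFDeriv_comp_sub]
        ring
    _ ≤ ∑ i ∈ Finset.range (l + 1), (l.choose i : ℝ) *
          (2 ^ (M + N) * schwartzBound (M + N) f) * (2 ^ (M + N) * schwartzBound (M + N) g) := by
        refine Finset.sum_le_sum fun i hi => ?_
        have := Finset.mem_range.1 hi
        gcongr _ * ?_ * ?_
        · exact pow_mul_norm_iteratedFDeriv_le (by omega) (by omega) f _
        · exact pow_mul_norm_iteratedFDeriv_le (by omega) (by omega) g _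
    _ = 2 ^ l * (2 ^ (M + N) * schwartzBound (M + N) f) *
          (2 ^ (M + N) * schwartzBound (M + N) g) := by
        rw [← Finset.sum_mul, ← Finset.sum_mul, ← Nat.cast_sum, Nat.sum_range_choose]
        push_cast; ring
    _ ≤ _ := by gcongr; norm_num

/-- The integral is the Fourier transform of (T_x φ)ψ at ω / 2π. Decay in ω comes from continuity of
the Fourier transform, and decay in x from `schwartzBound_mul_translate_le`. -/
theorem exists_cross_decay (φ : 𝓢(EuclideanSpace ℝ (Fin n), ℂ)) (N : ℕ) :
    ∃ (K : ℕ) (C : ℝ), 0 ≤ C ∧ ∀ (ψ : 𝓢(EuclideanSpace ℝ (Fin n), ℂ)) x ω,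
      (1 + ‖x‖) ^ N * ((1 + ‖ω‖) ^ N * ‖∫ t, φ (t - x) * ψ t * character ω t‖) ≤
        C * schwartzBound K ψ := by
  obtain ⟨K, C, hC, h⟩ := exists_schwartzBound_map_le
    (FourierTransform.fourierCLM ℝ 𝓢(EuclideanSpace ℝ (Fin n), ℂ)) N
  refine ⟨K + N, (2 * Real.pi) ^ N * (2 ^ N * (C * (2 ^ K * (2 ^ (K + N) *
    schwartzBound (K + N) φ) * 2 ^ (K + N)))), by positivity, fun ψ x ω => ?_⟩
  set g := schwartzMul (SchwartzMap.compSubConstCLM ℝ x φ) ψ with hg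
  have e : ∫ t, φ (t - x) * ψ t * character ω t = (𝓕 g) ((2 * Real.pi)⁻¹ • ω) := by
    rw [SchwartzMap.fourier_coe, Real.fourier_eq']
    refine integral_congr_ae (Filter.Eventually.of_forall fun t => ?_)
    simp only [hg, schwartzMul_apply, SchwartzMap.compSubConstCLM_apply, character, smul_eq_mul]
    rw [mul_comm]
    congr 2
    rw [inner_smul_right]
    have : (Real.pi : ℂ) ≠ 0 := by exact_mod_cast Real.pi_ne_zero
    push_cast
    field_simp
  have hω : (1 + ‖ω‖) ^ N ≤ (2 * Real.pi) ^ N * (1 + ‖(2 * Real.pi)⁻¹ • ω‖) ^ N := by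
    rw [← mul_pow]
    refine pow_le_pow_left₀ (by positivity) ?_ N
    rw [norm_smul, norm_inv, Real.norm_of_nonneg (by positivity), mul_add, ← mul_assoc,
      mul_inv_cancel₀ (by positivity)]
    nlinarith [Real.pi_gt_three]
  rw [e]
  calc _ ≤ (1 + ‖x‖) ^ N * ((2 * Real.pi) ^ N * (1 + ‖(2 * Real.pi)⁻¹ • ω‖) ^ N *
        ‖(𝓕 g) ((2 * Real.pi)⁻¹ • ω)‖) := by gcongr
    _ = (2 * Real.pi) ^ N * ((1 + ‖x‖) ^ N * ((1 + ‖(2 * Real.pi)⁻¹ • ω‖) ^ N *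
        ‖(𝓕 g) ((2 * Real.pi)⁻¹ • ω)‖)) := by ring
    _ ≤ (2 * Real.pi) ^ N * ((1 + ‖x‖) ^ N * (2 ^ N * (C * schwartzBound K g))) := by
        gcongr _ * (_ * ?_)
        refine (pow_mul_norm_le N (𝓕 g) _).trans ?_
        gcongr
        exact h g
    _ = (2 * Real.pi) ^ N * (2 ^ N * (C * ((1 + ‖x‖) ^ N * schwartzBound K g))) := by ring
    _ ≤ (2 * Real.pi) ^ N * (2 ^ N * (C * (2 ^ K * (2 ^ (K + N) * schwartzBound (K + N) φ) *
        (2 ^ (K + N) * schwartzBound (K + N) ψ)))) := by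
        gcongr _ * (_ * (_ * ?_))
        exact schwartzBound_mul_translate_le K N φ ψ x
    _ = _ := by ring

end SchwartzBounds

/-! ### Tempered distributions and integrals of Schwartz-valued maps -/

section VectorIntegral

open scoped BoundedContinuousFunction

variable {E : Type*} [NormedAddCommGroup E] [NormedSpace ℝ E]

/-- The bounded continuous function `t ↦ ‖t‖ᵏ • Dˡ θ(t)` attached to a Schwartz function `θ`. -/
noncomputable def derivBCF (k l : ℕ) : 𝓢(E, ℂ) →ₗ[ℂ] (E →ᵇ (E [×l]→L[ℝ] ℂ)) where
  toFun θ := BoundedContinuousFunction.ofNormedAddCommGroup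
    (fun t => ‖t‖ ^ k • iteratedFDeriv ℝ l θ t)
    (by
      have := (θ.smooth l).continuous_iteratedFDeriv (m := l) le_rfl
      fun_prop)
    (SchwartzMap.seminorm ℝ k l θ)
    (fun t => by
      rw [norm_smul, norm_pow, norm_norm]
      exact θ.le_seminorm ℝ k l t)
  map_add' f g := by
    ext1 t
    have e : ⇑(f + g) = ⇑f + ⇑g := rfl
    simp only [BoundedContinuousFunction.coe_ofNormedAddCommGroup,
      BoundedContinuousFunction.add_apply]
    rw [e, iteratedFDeriv_add_apply (f.smooth l).contDiffAt (g.smooth l).contDiffAt, smul_add]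
  map_smul' c f := by
    ext1 t
    have e : ⇑(c • f) = c • ⇑f := rfl
    simp only [BoundedContinuousFunction.coe_ofNormedAddCommGroup,
      BoundedContinuousFunction.smul_apply, RingHom.id_apply]
    rw [e, iteratedFDeriv_const_smul_apply (f.smooth l).contDiffAt, smul_comm]

@[simp]
theorem derivBCF_apply (k l : ℕ) (θ : 𝓢(E, ℂ)) (t : E) :
    derivBCF k l θ t = ‖t‖ ^ k • iteratedFDeriv ℝ l θ t := rfl

/-- Each Schwartz seminorm becomes the norm of a Banach space, so integrals of Schwartz-valued maps
can be read as Bochner integrals there. -/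
theorem norm_derivBCF (k l : ℕ) (θ : 𝓢(E, ℂ)) :
    ‖derivBCF k l θ‖ = SchwartzMap.seminorm ℝ k l θ := by
  refine le_antisymm ?_ ?_
  · refine (BoundedContinuousFunction.norm_le (apply_nonneg _ _)).2 fun t => ?_
    rw [derivBCF_apply, norm_smul, norm_pow, norm_norm]
    exact θ.le_seminorm ℝ k l t
  · refine SchwartzMap.seminorm_le_bound ℝ k l θ (norm_nonneg (derivBCF k l θ)) fun t => ?_
    have := (derivBCF k l θ).norm_coe_le_norm t
    rwa [derivBCF_apply, norm_smul, norm_pow, norm_norm] at this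

theorem continuous_derivBCF (k l : ℕ) : Continuous fun θ : 𝓢(E, ℂ) => derivBCF k l θ := by
  refine continuous_iff_continuousAt.2 fun θ => ?_
  refine tendsto_iff_dist_tendsto_zero.2 ?_
  have h : ∀ y, dist (derivBCF k l y) (derivBCF k l θ) =
      SchwartzMap.seminorm ℝ k l (y - θ) := fun y => by
    have h := dist_eq_norm (derivBCF k l y) (derivBCF k l θ)
    exact h.trans ((congrArg norm (map_sub (derivBCF k l) y θ).symm).trans (norm_derivBCF k l _))
  simp only [h]
  have hc : Continuous fun y => SchwartzMap.seminorm ℝ k l (y - θ) :=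
    ((schwartz_withSeminorms ℝ E ℂ).continuous_seminorm (k, l)).comp
      (continuous_id.sub continuous_const)
  simpa using hc.tendsto θ

variable {Y : Type*} [TopologicalSpace Y] {Ψ : Y → 𝓢(E, ℂ)} {ψ : 𝓢(E, ℂ)}

theorem continuous_iteratedFDeriv_eval (hΨ : Continuous Ψ) (l : ℕ) (t : E) :
    Continuous fun y => iteratedFDeriv ℝ l (Ψ y) t := by
  have h := (BoundedContinuousFunction.evalCLM ℝ (β := E [×l]→L[ℝ] ℂ) t).continuous.comp
    ((continuous_derivBCF 0 l).comp hΨ)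
  refine h.congr fun y => ?_
  simp

variable [MeasurableSpace Y] [OpensMeasurableSpace Y] [SecondCountableTopology Y] {μ : Measure Y}

/-- Induction on l by differentiation under the integral sign; the seminorm of order l + 1 dominates
the integrand uniformly in t. -/
theorem iteratedFDeriv_eq_integral (hΨ : Continuous Ψ)
    (hint : ∀ k l, Integrable (fun y => SchwartzMap.seminorm ℝ k l (Ψ y)) μ)
    (hψ : ∀ t, ψ t = ∫ y, Ψ y t ∂μ) (l : ℕ) (t : E) :
    iteratedFDeriv ℝ l ψ t = ∫ y, iteratedFDeriv ℝ l (Ψ y) t ∂μ := by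
  have hb : ∀ l t y, ‖iteratedFDeriv ℝ l (Ψ y) t‖ ≤ SchwartzMap.seminorm ℝ 0 l (Ψ y) :=
    fun l t y => (Ψ y).norm_iteratedFDeriv_le_seminorm ℝ l t
  have hI : ∀ l t, Integrable (fun y => iteratedFDeriv ℝ l (Ψ y) t) μ := fun l t =>
    (hint 0 l).mono' (continuous_iteratedFDeriv_eval hΨ l t).aestronglyMeasurable
      (Filter.Eventually.of_forall (hb l t))
  induction l generalizing t with
  | zero =>
    ext m
    rw [ContinuousMultilinearMap.integral_apply (hI 0 t)]
    simpa using hψ t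
  | succ l ih =>
    let e : (E [×(l + 1)]→L[ℝ] ℂ) ≃ₗᵢ[ℝ] (E →L[ℝ] (E [×l]→L[ℝ] ℂ)) :=
      continuousMultilinearCurryLeftEquiv ℝ (fun _ : Fin (l + 1) => E) ℂ
    have hs : ∀ (f : E → ℂ) t,
        fderiv ℝ (iteratedFDeriv ℝ l f) t = e (iteratedFDeriv ℝ (l + 1) f t) := fun f t => by
      rw [iteratedFDeriv_succ_eq_comp_left]
      exact (e.apply_symm_apply _).symm
    have hd := hasFDerivAt_integral_of_dominated_of_fderiv_le (μ := μ) (𝕜 := ℝ)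
      (F := fun t y => iteratedFDeriv ℝ l (Ψ y) t)
      (F' := fun t y => e (iteratedFDeriv ℝ (l + 1) (Ψ y) t)) (x₀ := t) (s := Set.univ)
      (bound := fun y => SchwartzMap.seminorm ℝ 0 (l + 1) (Ψ y)) Filter.univ_mem
      (Filter.Eventually.of_forall fun t =>
        (continuous_iteratedFDeriv_eval hΨ l t).aestronglyMeasurable)
      (hI l t)
      (e.continuous.comp (continuous_iteratedFDeriv_eval hΨ (l + 1) t)).aestronglyMeasurable
      (Filter.Eventually.of_forall fun y t _ => by
        rw [LinearIsometryEquiv.norm_map]; exact hb (l + 1) t y)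
      (hint 0 (l + 1))
      (Filter.Eventually.of_forall fun y t _ => by
        rw [← hs]
        exact (((Ψ y).smooth (l + 1)).differentiable_iteratedFDeriv
          (by exact_mod_cast Nat.lt_succ_self l) t).hasFDerivAt)
    have hf : (fun t => ∫ y, iteratedFDeriv ℝ l (Ψ y) t ∂μ) = iteratedFDeriv ℝ l ψ :=
      funext fun t => (ih t).symm
    rw [hf] at hd
    have h2 := hd.fderiv
    rw [hs] at h2
    apply e.injective
    rw [h2]
    let L : (E [×(l + 1)]→L[ℝ] ℂ) →L[ℝ] (E →L[ℝ] (E [×l]→L[ℝ] ℂ)) :=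
      e.toContinuousLinearEquiv.toContinuousLinearMap
    exact ContinuousLinearMap.integral_comp_comm (𝕜 := ℝ) (E := E [×(l + 1)]→L[ℝ] ℂ)
      (Fₗ := E →L[ℝ] (E [×l]→L[ℝ] ℂ)) L (hI (l + 1) t)

/-- The bound makes u descend to the range of J, and Hahn–Banach extends it from there. -/
theorem exists_continuousLinear_factor {X B : Type*} [AddCommGroup X] [Module ℂ X]
    [NormedAddCommGroup B] [NormedSpace ℂ B] (J : X →ₗ[ℂ] B) (u : X →ₗ[ℂ] ℂ) (C : ℝ)
    (h : ∀ x, ‖u x‖ ≤ C * ‖J x‖) : ∃ L : B →L[ℂ] ℂ, ∀ x, L (J x) = u x := by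
  have hk : LinearMap.ker J ≤ LinearMap.ker u := fun x hx => by
    have := h x
    rw [LinearMap.mem_ker.1 hx, norm_zero, mul_zero] at this
    exact norm_le_zero_iff.1 this
  let f : LinearMap.range J →ₗ[ℂ] ℂ :=
    (LinearMap.ker J).liftQ u hk ∘ₗ J.quotKerEquivRange.symm.toLinearMap
  have hf : ∀ x, f ⟨J x, LinearMap.mem_range_self J x⟩ = u x := fun x => by
    have : J.quotKerEquivRange.symm ⟨J x, LinearMap.mem_range_self J x⟩ =
        Submodule.Quotient.mk x := by
      rw [LinearEquiv.symm_apply_eq]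
      rfl
    simp [f, this]
  have hfb : ∀ y, ‖f y‖ ≤ C * ‖y‖ := by
    rintro ⟨_, x, rfl⟩
    rw [hf]
    exact h x
  obtain ⟨L, hL, -⟩ := exists_extension_norm_eq (LinearMap.range J) (f.mkContinuous C hfb)
  refine ⟨L, fun x => ?_⟩
  have := hL ⟨J x, LinearMap.mem_range_self J x⟩
  rw [this]
  exact hf x

/-- A tempered distribution commutes with integrals of Schwartz functions. -/
theorem integrable_apply_and_apply_eq_integral (u : 𝓢(E, ℂ) →L[ℂ] ℂ)
    (hΨ : Continuous Ψ) (hint : ∀ k l, Integrable (fun y => SchwartzMap.seminorm ℝ k l (Ψ y)) μ)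
    (hψ : ∀ t, ψ t = ∫ y, Ψ y t ∂μ) :
    Integrable (fun y => u (Ψ y)) μ ∧ u ψ = ∫ y, u (Ψ y) ∂μ := by
  -- Only finitely many seminorms control u. The corresponding maps `derivBCF` combine to J with
  -- values in a Banach space, u factors as L ∘ J, and L commutes with Bochner integrals.
  obtain ⟨s, C, -, hu⟩ := Seminorm.bound_of_continuous (schwartz_withSeminorms ℝ E ℂ)
    ((normSeminorm ℝ ℂ).comp ((u : 𝓢(E, ℂ) →ₗ[ℂ] ℂ).restrictScalars ℝ))
    (continuous_norm.comp u.continuous)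
  let B : s → Type _ := fun i => E →ᵇ (E [×i.1.2]→L[ℝ] ℂ)
  let _ : ∀ i, NormedAddCommGroup (B i) := fun i => BoundedContinuousFunction.instNormedAddCommGroup
  let _ : ∀ i, NormedSpace ℂ (B i) := fun i => BoundedContinuousFunction.instNormedSpace
  let J : 𝓢(E, ℂ) →ₗ[ℂ] ((i : s) → B i) := LinearMap.pi fun i => derivBCF i.1.1 i.1.2
  have hJc : Continuous fun y => J (Ψ y) :=
    continuous_pi fun i => (continuous_derivBCF i.1.1 i.1.2).comp hΨ
  -- Strong measurability must come from the source Y, since spaces of bounded continuous functions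
  -- need not be separable.
  have : SecondCountableTopologyEither Y ((i : s) → B i) := secondCountableTopologyEither_of_left _ _
  have hJn : ∀ θ i, ‖J θ i‖ = SchwartzMap.seminorm ℝ i.1.1 i.1.2 θ := fun θ i =>
    norm_derivBCF i.1.1 i.1.2 θ
  have hJ' : ∀ θ, s.sup (schwartzSeminormFamily ℝ E ℂ) θ ≤ ‖J θ‖ := fun θ => by
    refine Seminorm.finset_sup_apply_le (norm_nonneg _) fun i hi => ?_
    exact (hJn θ ⟨i, hi⟩).symm.le.trans (norm_le_pi_norm (J θ) ⟨i, hi⟩)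
  obtain ⟨L, hL⟩ := exists_continuousLinear_factor J (u : 𝓢(E, ℂ) →ₗ[ℂ] ℂ) C fun θ =>
    (hu θ).trans (by
      rw [_root_.smul_apply, NNReal.smul_def, smul_eq_mul]
      exact mul_le_mul_of_nonneg_left (hJ' θ) C.2)
  have hLu : ∀ θ, L (J θ) = u θ := hL
  have hJi : Integrable (fun y => J (Ψ y)) μ := by
    refine (integrable_finsetSum (Finset.univ : Finset s) fun i _ =>
      hint i.1.1 i.1.2).mono' hJc.aestronglyMeasurable (Filter.Eventually.of_forall fun y => ?_)
    refine (pi_norm_le_iff_of_nonneg (Finset.sum_nonneg fun i _ => apply_nonneg _ _)).2 fun i => ?_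
    rw [hJn]
    exact Finset.single_le_sum (f := fun i : s => SchwartzMap.seminorm ℝ i.1.1 i.1.2 (Ψ y))
      (fun i _ => apply_nonneg _ _) (Finset.mem_univ i)
  have hJψ : J ψ = ∫ y, J (Ψ y) ∂μ := by
    funext i
    let P : ((i : s) → B i) →L[ℂ] B i := ContinuousLinearMap.proj i
    have h1 : ∫ y, P (J (Ψ y)) ∂μ = P (∫ y, J (Ψ y) ∂μ) := P.integral_comp_comm hJi
    have h2 : Integrable (fun y => P (J (Ψ y))) μ := P.integrable_comp hJi
    change J ψ i = P (∫ y, J (Ψ y) ∂μ)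
    rw [← h1]
    refine BoundedContinuousFunction.ext fun t => ?_
    have h3 := (BoundedContinuousFunction.evalCLM ℂ (β := E [×i.1.2]→L[ℝ] ℂ)
      t).integral_comp_comm h2
    refine Eq.trans ?_ h3
    change ‖t‖ ^ i.1.1 • iteratedFDeriv ℝ i.1.2 ψ t =
      ∫ y, ‖t‖ ^ i.1.1 • iteratedFDeriv ℝ i.1.2 (Ψ y) t ∂μ
    rw [integral_smul, iteratedFDeriv_eq_integral hΨ hint hψ]
  constructor
  · have := L.integrable_comp hJi
    simpa only [hLu] using this
  · rw [← hLu, hJψ, ← L.integral_comp_comm hJi]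
    simp only [hLu]

end VectorIntegral

/-! ### The inversion formula for the short-time Fourier transform -/

section Inversion

open scoped FourierTransform

variable {n : ℕ}

theorem norm_character (ξ t : EuclideanSpace ℝ (Fin n)) : ‖character ξ t‖ = 1 := by
  rw [character, ← mul_neg, mul_comm, ← Complex.ofReal_neg, Complex.norm_exp_ofReal_mul_I]

theorem character_mul (ξ η t : EuclideanSpace ℝ (Fin n)) :
    character ξ t * character η t = character (ξ + η) t := by
  rw [character, character, character, ← Complex.exp_add, inner_add_right]
  push_cast; ring_nf

theorem character_add_right (ξ t t' : EuclideanSpace ℝ (Fin n)) :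
    character ξ (t + t') = character ξ t * character ξ t' := by
  rw [character, character, character, ← Complex.exp_add, inner_add_left]
  push_cast; ring_nf

theorem conj_character (ξ t : EuclideanSpace ℝ (Fin n)) :
    conj (character ξ t) = character (-ξ) t := by
  rw [character, character, ← Complex.exp_conj]
  simp

@[fun_prop]
theorem continuous_character :
    Continuous fun w : EuclideanSpace ℝ (Fin n) × EuclideanSpace ℝ (Fin n) =>
      character w.1 w.2 := by
  unfold character; fun_prop

theorem conjShift_apply' (φ : 𝓢(EuclideanSpace ℝ (Fin n), ℂ))
    (x ξ t : EuclideanSpace ℝ (Fin n)) :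
    conjShift φ x ξ t = conj (φ (t - x)) * character ξ t := conjShift_apply φ x ξ t

/-- The complex conjugate of a Schwartz function. -/
noncomputable def schwartzConj (f : 𝓢(EuclideanSpace ℝ (Fin n), ℂ)) :
    𝓢(EuclideanSpace ℝ (Fin n), ℂ) :=
  SchwartzMap.postcompCLM (𝕜 := ℝ) (Complex.conjCLE : ℂ →L[ℝ] ℂ) f

@[simp]
theorem schwartzConj_apply (f : 𝓢(EuclideanSpace ℝ (Fin n), ℂ)) (t : EuclideanSpace ℝ (Fin n)) :
    schwartzConj f t = conj (f t) := by
  simp [schwartzConj]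

/-- The coefficient `∫ φ(t - x) ψ(t) exp (i t·ξ) dt`. -/
noncomputable def cross (φ ψ : 𝓢(EuclideanSpace ℝ (Fin n), ℂ)) (x ξ : EuclideanSpace ℝ (Fin n)) :
    ℂ := ∫ t, φ (t - x) * ψ t * character (-ξ) t

/-- The coefficient is the conjugate of the pairing of conj ψ with `conjShift`, so it inherits the
continuity of the latter. -/
theorem continuous_cross (φ ψ : 𝓢(EuclideanSpace ℝ (Fin n), ℂ)) :
    Continuous fun w : EuclideanSpace ℝ (Fin n) × EuclideanSpace ℝ (Fin n) =>
      cross φ ψ w.1 w.2 := by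
  have h := (SchwartzMap.toTemperedDistributionCLM (EuclideanSpace ℝ (Fin n)) ℂ volume
    (schwartzConj ψ)).continuous.comp (continuous_conjShift φ)
  refine (Complex.continuous_conj.comp h).congr fun w => ?_
  refine (congrArg conj (SchwartzMap.toTemperedDistributionCLM_apply_apply volume
    (schwartzConj ψ) (conjShift φ w.1 w.2))).trans ?_
  rw [← integral_conj, cross]
  refine integral_congr_ae (Filter.Eventually.of_forall fun t => ?_)
  simp only [conjShift_apply', schwartzConj_apply, smul_eq_mul, map_mul, Complex.conj_conj,
    conj_character]
  ring

theorem exists_norm_cross_le (φ : 𝓢(EuclideanSpace ℝ (Fin n), ℂ)) (N : ℕ) :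
    ∃ (K : ℕ) (C : ℝ), 0 ≤ C ∧ ∀ (ψ : 𝓢(EuclideanSpace ℝ (Fin n), ℂ)) x ξ,
      (1 + ‖x‖) ^ N * ((1 + ‖ξ‖) ^ N * ‖cross φ ψ x ξ‖) ≤ C * schwartzBound K ψ := by
  obtain ⟨K, C, hC, h⟩ := exists_cross_decay φ N
  exact ⟨K, C, hC, fun ψ x ξ => by simpa [cross] using h ψ x (-ξ)⟩

theorem integrable_inv_one_add_norm_pow {N : ℕ} (hN : n < N) :
    Integrable fun x : EuclideanSpace ℝ (Fin n) => ((1 + ‖x‖) ^ N)⁻¹ := by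
  have h : ((Module.finrank ℝ (EuclideanSpace ℝ (Fin n)) : ℕ) : ℝ) < N := by
    simpa using hN
  refine (integrable_one_add_norm (μ := volume) h).congr (Filter.Eventually.of_forall fun x => ?_)
  simp only [Real.rpow_neg (by positivity : 0 ≤ 1 + ‖x‖), Real.rpow_natCast]

/-- Fourier inversion for the Schwartz function (T_x φ)ψ; the factor (2π)ⁿ is the Jacobian of the
rescaling of frequency by 2π. -/
theorem integral_cross_mul_character (φ ψ : 𝓢(EuclideanSpace ℝ (Fin n), ℂ))
    (x t : EuclideanSpace ℝ (Fin n)) :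
    ∫ ξ, cross φ ψ x ξ * character ξ t = (2 * Real.pi) ^ n * (φ (t - x) * ψ t) := by
  set g := schwartzMul (SchwartzMap.compSubConstCLM ℝ x φ) ψ with hg
  have hpi : (Real.pi : ℂ) ≠ 0 := by exact_mod_cast Real.pi_ne_zero
  have e1 : ∀ ξ, cross φ ψ x ξ * character ξ t = (fun η => Complex.exp
      ((↑(-2 * Real.pi * inner ℝ η t) * Complex.I)) • (𝓕⁻ g) η) ((2 * Real.pi)⁻¹ • ξ) := fun ξ => by
    simp only
    rw [SchwartzMap.fourierInv_coe, Real.fourierInv_eq', cross, mul_comm]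
    rw [smul_eq_mul]
    congr 1
    · rw [character, inner_smul_left, real_inner_comm]
      congr 1
      simp
      field_simp
    · refine integral_congr_ae (Filter.Eventually.of_forall fun v => ?_)
      simp only [hg, schwartzMul_apply, SchwartzMap.compSubConstCLM_apply, character, smul_eq_mul]
      rw [mul_comm]
      congr 2
      rw [inner_smul_right, inner_neg_right]
      push_cast
      field_simp
  refine (integral_congr_ae (Filter.Eventually.of_forall e1)).trans
    ((Measure.integral_comp_inv_smul volume (fun η => Complex.exp
      ((↑(-2 * Real.pi * inner ℝ η t) * Complex.I)) • (𝓕⁻ g) η) (2 * Real.pi)).trans ?_)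
  have e2 : ∫ η, Complex.exp ((↑(-2 * Real.pi * inner ℝ η t) * Complex.I)) • (𝓕⁻ g) η = g t := by
    rw [← Real.fourier_eq', ← SchwartzMap.fourier_coe, FourierTransform.fourier_fourierInv_eq]
  rw [e2, hg, schwartzMul_apply, SchwartzMap.compSubConstCLM_apply]
  rw [abs_of_nonneg (by positivity)]
  simp

/-- The constant `(2π)ⁿ ‖φ‖²` of the inversion formula for the short-time Fourier transform. -/
noncomputable def inversionConst (φ : 𝓢(EuclideanSpace ℝ (Fin n), ℂ)) : ℂ :=
  (2 * Real.pi) ^ n * ∫ t, φ t * conj (φ t)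

theorem inversionConst_ne_zero {φ : 𝓢(EuclideanSpace ℝ (Fin n), ℂ)} (hφ : φ ≠ 0) :
    inversionConst φ ≠ 0 := by
  refine mul_ne_zero (pow_ne_zero _ (mul_ne_zero two_ne_zero
    (by exact_mod_cast Real.pi_ne_zero))) ?_
  have e : ∫ t, φ t * conj (φ t) = ((∫ t, ‖φ t‖ ^ 2 : ℝ) : ℂ) := by
    rw [← integral_complex_ofReal]
    simp only [Complex.mul_conj, Complex.normSq_eq_norm_sq]
  rw [e]
  obtain ⟨t, ht⟩ : ∃ t, φ t ≠ 0 := by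
    by_contra! h
    exact hφ (SchwartzMap.ext h)
  have hi : Integrable fun t => ‖φ t‖ ^ 2 := by
    have := (φ.memLp 2 volume).integrable_norm_pow two_ne_zero
    simpa using this
  have hc : Continuous fun t => ‖φ t‖ ^ 2 := by fun_prop
  have hpos : 0 < ∫ t, ‖φ t‖ ^ 2 :=
    integral_pos_of_integrable_nonneg_nonzero (x := t) hc hi (fun t => by positivity)
      (pow_ne_zero _ (norm_ne_zero_iff.2 ht))
  exact_mod_cast hpos.ne'

theorem integrable_prod_of_norm_le {F : Type*} [NormedAddCommGroup F] {N : ℕ} (hN : n < N) {C : ℝ}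
    {f : EuclideanSpace ℝ (Fin n) × EuclideanSpace ℝ (Fin n) → F}
    (hf : AEStronglyMeasurable f volume)
    (h : ∀ w, (1 + ‖w.1‖) ^ N * ((1 + ‖w.2‖) ^ N * ‖f w‖) ≤ C) : Integrable f := by
  have := ((integrable_inv_one_add_norm_pow hN).mul_prod (integrable_inv_one_add_norm_pow hN)).const_mul C
  refine this.mono' hf (Filter.Eventually.of_forall fun w => ?_)
  rw [← mul_inv, ← div_eq_mul_inv, le_div_iff₀ (by positivity)]
  calc _ = _ := by ring
    _ ≤ _ := h w

/-- Integrating in ξ first gives (2π)ⁿ |φ(t - x)|² ψ(t) by Fourier inversion, and integrating in x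
then gives the squared L² norm of the window. -/
theorem integral_cross_mul_conjShift (φ ψ : 𝓢(EuclideanSpace ℝ (Fin n), ℂ))
    (t : EuclideanSpace ℝ (Fin n)) :
    ∫ w : EuclideanSpace ℝ (Fin n) × EuclideanSpace ℝ (Fin n),
      cross φ ψ w.1 w.2 * conjShift φ w.1 w.2 t = inversionConst φ * ψ t := by
  obtain ⟨K, C, hC, h⟩ := exists_norm_cross_le φ (n + 1)
  have hb : ∀ s, ‖φ s‖ ≤ schwartzBound 0 φ := fun s => by simpa using pow_mul_norm_le 0 φ s
  have hc := continuous_cross φ ψ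
  have hint : Integrable fun w : EuclideanSpace ℝ (Fin n) × EuclideanSpace ℝ (Fin n) =>
      cross φ ψ w.1 w.2 * (conj (φ (t - w.1)) * character w.2 t) := by
    refine integrable_prod_of_norm_le (Nat.lt_succ_self n)
      (C := C * schwartzBound K ψ * schwartzBound 0 φ) ?_ fun w => ?_
    · refine Continuous.aestronglyMeasurable (hc.mul (Continuous.mul ?_ ?_))
      · exact Complex.continuous_conj.comp (φ.continuous.comp (by fun_prop))
      · exact continuous_character.comp (by fun_prop :
          Continuous fun w : EuclideanSpace ℝ (Fin n) × EuclideanSpace ℝ (Fin n) => (w.2, t))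
    · rw [norm_mul, norm_mul, norm_character, mul_one, RCLike.norm_conj]
      calc (1 + ‖w.1‖) ^ (n + 1) * ((1 + ‖w.2‖) ^ (n + 1) *
            (‖cross φ ψ w.1 w.2‖ * ‖φ (t - w.1)‖)) =
          ((1 + ‖w.1‖) ^ (n + 1) * ((1 + ‖w.2‖) ^ (n + 1) * ‖cross φ ψ w.1 w.2‖)) *
            ‖φ (t - w.1)‖ := by ring
        _ ≤ _ := mul_le_mul (h ψ _ _) (hb _) (norm_nonneg _) (by positivity)
  simp only [conjShift_apply']
  rw [Measure.volume_eq_prod] at hint ⊢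
  rw [integral_prod _ hint]
  have e : ∀ x, ∫ ξ, cross φ ψ x ξ * (conj (φ (t - x)) * character ξ t) =
      (2 * Real.pi) ^ n * ψ t * (φ (t - x) * conj (φ (t - x))) := fun x => by
    calc _ = ∫ ξ, conj (φ (t - x)) * (cross φ ψ x ξ * character ξ t) := by
          congr 1; funext ξ; ring
      _ = _ := by
          rw [integral_const_mul, integral_cross_mul_character]; ring
  simp only [e]
  rw [integral_const_mul, integral_sub_left_eq_self (fun s => φ s * conj (φ s)) volume t,
    inversionConst]
  ring

/-- Inversion formula for the short-time Fourier transform of a tempered distribution. -/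
theorem inversion (φ : 𝓢(EuclideanSpace ℝ (Fin n), ℂ)) (u : 𝓢'(EuclideanSpace ℝ (Fin n), ℂ))
    (ψ : 𝓢(EuclideanSpace ℝ (Fin n), ℂ)) :
    inversionConst φ * u ψ = ∫ w : EuclideanSpace ℝ (Fin n) × EuclideanSpace ℝ (Fin n),
      cross φ ψ w.1 w.2 * stft φ u w.1 w.2 := by
  have hΨ : Continuous fun w : EuclideanSpace ℝ (Fin n) × EuclideanSpace ℝ (Fin n) =>
      cross φ ψ w.1 w.2 • conjShift φ w.1 w.2 :=
    (continuous_cross φ ψ).smul (continuous_conjShift φ)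
  have := integrable_apply_and_apply_eq_integral (μ := volume) (ψ := inversionConst φ • ψ) u hΨ ?_ ?_
  · have hs : ∀ (c : ℂ) θ, u (c • θ) = c * u θ := fun c θ => map_smul u c θ
    exact (hs _ _).symm.trans (this.2.trans (integral_congr_ae
      (Filter.Eventually.of_forall fun w => hs _ _)))
  · intro k l
    obtain ⟨K, C, hC, h⟩ := exists_schwartzBound_conjShift_le φ (max k l)
    -- The shifted windows grow like order K in each variable; the coefficients decay to order K
    -- more than the n + 1 needed for integrability.
    obtain ⟨K', C', hC', h'⟩ := exists_norm_cross_le φ (n + 1 + K)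
    refine integrable_prod_of_norm_le (Nat.lt_succ_self n) (C := C' * schwartzBound K' ψ * C)
      (((schwartz_withSeminorms ℝ _ ℂ).continuous_seminorm (k, l)).comp
        hΨ).aestronglyMeasurable fun w => ?_
    have e : SchwartzMap.seminorm ℝ k l (cross φ ψ w.1 w.2 • conjShift φ w.1 w.2) ≤
        ‖cross φ ψ w.1 w.2‖ * schwartzBound (max k l) (conjShift φ w.1 w.2) := by
      have h1 := map_smul_eq_mul (SchwartzMap.seminorm ℂ k l) (cross φ ψ w.1 w.2)
        (conjShift φ w.1 w.2)
      refine h1.le.trans (mul_le_mul_of_nonneg_left ?_ (norm_nonneg _))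
      exact schwartzSeminormFamily_le_schwartzBound (i := (k, l)) (le_max_left _ _)
        (le_max_right _ _) _
    rw [Real.norm_of_nonneg (apply_nonneg _ _)]
    refine (mul_le_mul_of_nonneg_left (mul_le_mul_of_nonneg_left e (by positivity))
      (by positivity)).trans ?_
    calc _ ≤ (1 + ‖w.1‖) ^ (n + 1) * ((1 + ‖w.2‖) ^ (n + 1) * (‖cross φ ψ w.1 w.2‖ *
          (C * ((1 + ‖w.1‖) ^ K * (1 + ‖w.2‖) ^ K)))) := by gcongr _ * (_ * (_ * ?_)); exact h _ _
      _ = (1 + ‖w.1‖) ^ (n + 1 + K) * ((1 + ‖w.2‖) ^ (n + 1 + K) * ‖cross φ ψ w.1 w.2‖) * C := by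
          ring
      _ ≤ _ := mul_le_mul_of_nonneg_right (h' _ _ _) hC
  · intro t
    simpa using (integral_cross_mul_conjShift φ ψ t).symm

end Inversion

/-! ### Change of window -/

section WindowChange

variable {n : ℕ} {p : ℝ≥0∞} {s : ℝ} {φ : 𝓢(EuclideanSpace ℝ (Fin n), ℂ)}

theorem continuous_stft (φ : 𝓢(EuclideanSpace ℝ (Fin n), ℂ))
    (u : 𝓢'(EuclideanSpace ℝ (Fin n), ℂ)) :
    Continuous fun w : EuclideanSpace ℝ (Fin n) × EuclideanSpace ℝ (Fin n) =>
      stft φ u w.1 w.2 := u.continuous.comp (continuous_conjShift φ)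

theorem measurable_enorm_stft (φ : 𝓢(EuclideanSpace ℝ (Fin n), ℂ))
    (u : 𝓢'(EuclideanSpace ℝ (Fin n), ℂ)) :
    Measurable (Function.uncurry fun x ξ => ‖stft φ u x ξ‖ₑ) :=
  (continuous_stft φ u).enorm.measurable

/-- The `Lᵖ` norm of the frequency slice `V_φ u (·, ξ)`. -/
noncomputable def slice (p : ℝ≥0∞) (φ : 𝓢(EuclideanSpace ℝ (Fin n), ℂ))
    (u : 𝓢'(EuclideanSpace ℝ (Fin n), ℂ)) (ξ : EuclideanSpace ℝ (Fin n)) : ℝ≥0∞ :=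
  eLpNorm (fun x => ‖stft φ u x ξ‖ₑ) p volume

theorem slice_eq (u : 𝓢'(EuclideanSpace ℝ (Fin n), ℂ)) (ξ : EuclideanSpace ℝ (Fin n)) :
    slice p φ u ξ = eLpNorm (fun x => stft φ u x ξ) p volume :=
  eLpNorm_congr_enorm_ae (Filter.Eventually.of_forall fun _ => enorm_enorm _)

theorem modNorm_eq (u : 𝓢'(EuclideanSpace ℝ (Fin n), ℂ)) : modNorm p s φ u =
    ∫⁻ ξ, ENNReal.ofReal ((1 + ‖ξ‖ ^ 2) ^ (s / 2)) * slice p φ u ξ := by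
  simp only [modNorm, slice_eq]

theorem measurable_slice (hp : 1 ≤ p) (hpt : p ≠ ∞) (u : 𝓢'(EuclideanSpace ℝ (Fin n), ℂ)) :
    Measurable (slice p φ u) :=
  measurable_eLpNorm_right (measurable_enorm_stft φ u) hp hpt

theorem lintegral_slice_le (hs : 0 ≤ s) (u : 𝓢'(EuclideanSpace ℝ (Fin n), ℂ)) :
    ∫⁻ ξ, slice p φ u ξ ≤ modNorm p s φ u := by
  rw [modNorm_eq]
  refine lintegral_mono fun ξ => ?_
  calc slice p φ u ξ = 1 * slice p φ u ξ := (one_mul _).symm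
    _ ≤ _ := by gcongr; exact one_le_bracket hs ξ

theorem lintegral_weight_mul_slice_ne_top (hp : 1 ≤ p) (hpt : p ≠ ∞) (hs : 0 ≤ s)
    {u : 𝓢'(EuclideanSpace ℝ (Fin n), ℂ)} (hu : u ∈ modulationSpace p s φ) :
    ∫⁻ ξ, weight 1 s ξ * slice p φ u ξ ≠ ∞ := by
  have hm := measurable_slice (φ := φ) hp hpt u
  have hu' : modNorm p s φ u < ∞ := hu
  refine ne_top_of_le_ne_top (ENNReal.mul_ne_top ENNReal.ofReal_ne_top hu'.ne :
    ENNReal.ofReal (2 ^ (s / 2)) * modNorm p s φ u ≠ ∞) ?_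
  rw [modNorm_eq, ← lintegral_const_mul _ (by fun_prop)]
  refine lintegral_mono fun ξ => ?_
  rw [← mul_assoc]
  gcongr
  exact weight_le_bracket hs ξ

theorem mem_modulationSpace_of_lintegral_weight (hs : 0 ≤ s)
    {u : 𝓢'(EuclideanSpace ℝ (Fin n), ℂ)} (hu : ∫⁻ ξ, weight 1 s ξ * slice p φ u ξ ≠ ∞) :
    u ∈ modulationSpace p s φ := by
  change modNorm p s φ u < ∞
  rw [modNorm_eq]
  refine lt_of_le_of_lt (lintegral_mono fun ξ => ?_) hu.lt_top
  gcongr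
  exact bracket_le_weight hs ξ

/-- Covariance under time-frequency shifts: replacing t by t + z moves all shifts to one side up to
a phase of modulus one. Because only differences remain, the change of window is a convolution. -/
theorem norm_cross_conjShift (φ θ : 𝓢(EuclideanSpace ℝ (Fin n), ℂ))
    (x ξ z ζ : EuclideanSpace ℝ (Fin n)) :
    ‖cross φ (conjShift θ z ζ) x ξ‖ = ‖cross φ (schwartzConj θ) (x - z) (ξ - ζ)‖ := by
  have h : cross φ (conjShift θ z ζ) x ξ =
      character (ζ - ξ) z * cross φ (schwartzConj θ) (x - z) (ξ - ζ) := by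
    rw [cross, cross, ← integral_const_mul,
      ← integral_add_right_eq_self (fun t => φ (t - x) * conjShift θ z ζ t * character (-ξ) t) z]
    refine integral_congr_ae (Filter.Eventually.of_forall fun t => ?_)
    simp only [conjShift_apply', schwartzConj_apply]
    rw [show t + z - x = t - (x - z) by abel, show t + z - z = t by abel,
      show -(ξ - ζ) = ζ + -ξ by abel, show ζ - ξ = ζ + -ξ by abel, ← character_mul ζ (-ξ) t,
      ← character_mul ζ (-ξ) z, character_add_right, character_add_right]
    ring
  rw [h, norm_mul, norm_character, one_mul]

theorem enorm_le_decay_mul_decay {N : ℕ} {x y : EuclideanSpace ℝ (Fin n)} {a : ℂ} {C : ℝ}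
    (h : (1 + ‖x‖) ^ N * ((1 + ‖y‖) ^ N * ‖a‖) ≤ C) :
    ‖a‖ₑ ≤ ENNReal.ofReal C * (decay N x * decay N y) := by
  have hC : 0 ≤ C := le_trans (by positivity) h
  rw [decay, decay, ← ENNReal.ofReal_mul (by positivity), ← ENNReal.ofReal_mul hC, ← ofReal_norm,
    ← mul_inv, ← div_eq_mul_inv]
  refine ENNReal.ofReal_le_ofReal ?_
  rw [le_div_iff₀ (by positivity)]
  calc _ = _ := by ring
    _ ≤ C := h

/-- The short-time Fourier transform for an arbitrary window `θ` is controlled by the one for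
the fixed window `φ`. -/
theorem exists_enorm_stft_le (hφ : φ ≠ 0) (N : ℕ) :
    ∃ (K : ℕ) (C : ℝ), 0 ≤ C ∧ ∀ (u : 𝓢'(EuclideanSpace ℝ (Fin n), ℂ)) (θ) (z ζ),
      ‖stft θ u z ζ‖ₑ ≤ ENNReal.ofReal (C * schwartzBound K θ) *
        smear N (decay N) (fun x ξ => ‖stft φ u x ξ‖ₑ) z ζ := by
  obtain ⟨K₁, C₁, hC₁, h₁⟩ := exists_norm_cross_le φ N
  obtain ⟨K₂, C₂, hC₂, h₂⟩ := exists_schwartzBound_map_le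
    (SchwartzMap.postcompCLM (𝕜 := ℝ) (E := EuclideanSpace ℝ (Fin n))
      (Complex.conjCLE : ℂ →L[ℝ] ℂ)) K₁
  have hc := inversionConst_ne_zero hφ
  refine ⟨K₂, ‖inversionConst φ‖⁻¹ * (C₁ * C₂), by positivity, fun u θ z ζ => ?_⟩
  have hV := measurable_enorm_stft φ u
  have hV' : Measurable fun w : EuclideanSpace ℝ (Fin n) × EuclideanSpace ℝ (Fin n) =>
    ‖stft φ u w.1 w.2‖ₑ := hV
  have hle : ‖inversionConst φ‖ₑ * ‖stft θ u z ζ‖ₑ ≤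
      ENNReal.ofReal (C₁ * (C₂ * schwartzBound K₂ θ)) *
        smear N (decay N) (fun x ξ => ‖stft φ u x ξ‖ₑ) z ζ := by
    -- The inversion formula is tested on the shifted window of θ itself.
    rw [stft, ← enorm_mul, inversion, smear_eq_lintegral_prod hV (measurable_decay N),
      ← lintegral_const_mul _ (by fun_prop)]
    refine (enorm_integral_le_lintegral_enorm _).trans (lintegral_mono fun w => ?_)
    rw [enorm_mul]
    have h3 : ‖cross φ (conjShift θ z ζ) w.1 w.2‖ₑ ≤
        ENNReal.ofReal (C₁ * (C₂ * schwartzBound K₂ θ)) *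
          (decay N (z - w.1) * decay N (ζ - w.2)) := by
      have h4 := (h₁ (schwartzConj θ) (w.1 - z) (w.2 - ζ)).trans
        (mul_le_mul_of_nonneg_left (h₂ θ) hC₁)
      rw [← norm_cross_conjShift] at h4
      rw [decay_sub_comm N z, decay_sub_comm N ζ]
      exact enorm_le_decay_mul_decay h4
    calc _ ≤ (ENNReal.ofReal (C₁ * (C₂ * schwartzBound K₂ θ)) *
          (decay N (z - w.1) * decay N (ζ - w.2))) * ‖stft φ u w.1 w.2‖ₑ := by gcongr
      _ = _ := by ring
  have hc' : ‖inversionConst φ‖ₑ ≠ 0 := by simpa using hc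
  have e : ENNReal.ofReal (‖inversionConst φ‖⁻¹ * (C₁ * C₂) * schwartzBound K₂ θ) =
      ‖inversionConst φ‖ₑ⁻¹ * ENNReal.ofReal (C₁ * (C₂ * schwartzBound K₂ θ)) := by
    rw [mul_assoc, mul_assoc, ENNReal.ofReal_mul (by positivity),
      ENNReal.ofReal_inv_of_pos (norm_pos_iff.2 hc), ofReal_norm]
  rw [e, mul_assoc, ← ENNReal.div_eq_inv_mul, ENNReal.le_div_iff_mul_le (Or.inl hc')
    (Or.inl enorm_ne_top), mul_comm]
  exact hle

/-! ### Synthesis: elements of the space as continuous functions -/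

theorem lintegral_mul_decay_le {F : EuclideanSpace ℝ (Fin n) → EuclideanSpace ℝ (Fin n) → ℝ≥0∞}
    (hF : Measurable (Function.uncurry F)) (N : ℕ) (hp : 1 ≤ p) (hpt : p ≠ ∞)
    (z : EuclideanSpace ℝ (Fin n)) :
    ∫⁻ w : EuclideanSpace ℝ (Fin n) × EuclideanSpace ℝ (Fin n), F w.1 w.2 * decay N (z - w.1) ≤
      (1 + ∫⁻ x : EuclideanSpace ℝ (Fin n), decay N x) *
        ∫⁻ η, eLpNorm (fun x => F x η) p volume := by
  -- The constant frequency kernel turns the convolution in ξ into a plain integral, and ζ = 0 is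
  -- then immaterial.
  have h := smear_le hF (k := fun _ => 1) measurable_const N hp hpt z 0
  rw [smear_eq_lintegral_prod hF measurable_const] at h
  simp only [mul_one] at h
  exact h

/-- The function `t ↦ ∬ V_φ u(x, ξ) φ(t - x) exp (i t·ξ) dx dξ`. -/
noncomputable def synthesis (φ : 𝓢(EuclideanSpace ℝ (Fin n), ℂ))
    (u : 𝓢'(EuclideanSpace ℝ (Fin n), ℂ)) (t : EuclideanSpace ℝ (Fin n)) : ℂ :=
  ∫ w : EuclideanSpace ℝ (Fin n) × EuclideanSpace ℝ (Fin n),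
    stft φ u w.1 w.2 * (φ (t - w.1) * character (-w.2) t)

theorem continuous_synthesis_integrand (φ : 𝓢(EuclideanSpace ℝ (Fin n), ℂ))
    (u : 𝓢'(EuclideanSpace ℝ (Fin n), ℂ)) :
    Continuous fun q : (EuclideanSpace ℝ (Fin n) × EuclideanSpace ℝ (Fin n)) ×
      EuclideanSpace ℝ (Fin n) =>
      stft φ u q.1.1 q.1.2 * (φ (q.2 - q.1.1) * character (-q.1.2) q.2) := by
  have h1 : Continuous fun q : (EuclideanSpace ℝ (Fin n) × EuclideanSpace ℝ (Fin n)) ×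
      EuclideanSpace ℝ (Fin n) => φ (q.2 - q.1.1) :=
    φ.continuous.comp (continuous_snd.sub (continuous_fst.comp continuous_fst))
  have h3 : Continuous fun q : (EuclideanSpace ℝ (Fin n) × EuclideanSpace ℝ (Fin n)) ×
      EuclideanSpace ℝ (Fin n) => character (-q.1.2) q.2 := by
    unfold character; fun_prop
  exact ((continuous_stft φ u).comp continuous_fst).mul (h1.mul h3)

theorem enorm_window_le (φ : 𝓢(EuclideanSpace ℝ (Fin n), ℂ)) (N : ℕ)
    (t : EuclideanSpace ℝ (Fin n)) :
    ‖φ t‖ₑ ≤ ENNReal.ofReal (2 ^ N * schwartzBound N φ) * decay N t :=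
  enorm_le_decay_of_norm_mul_le (pow_mul_norm_le N φ t)

/-- Hölder's inequality against the decay of φ handles position, and the L¹ norm in frequency does
the rest. The bound is uniform in t, whence boundedness, continuity and Fubini for the synthesis. -/
theorem exists_lintegral_synthesis_le (φ : 𝓢(EuclideanSpace ℝ (Fin n), ℂ)) (hp : 1 ≤ p)
    (hpt : p ≠ ∞) : ∃ C : ℝ≥0∞, C ≠ ∞ ∧ ∀ (u : 𝓢'(EuclideanSpace ℝ (Fin n), ℂ)) t,
      ∫⁻ w : EuclideanSpace ℝ (Fin n) × EuclideanSpace ℝ (Fin n),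
        ‖stft φ u w.1 w.2 * (φ (t - w.1) * character (-w.2) t)‖ₑ ≤ C * ∫⁻ ξ, slice p φ u ξ := by
  refine ⟨ENNReal.ofReal (2 ^ (n + 1) * schwartzBound (n + 1) φ) *
    (1 + ∫⁻ x : EuclideanSpace ℝ (Fin n), decay (n + 1) x), ?_, fun u t => ?_⟩
  · have := lintegral_decay_ne_top (Nat.lt_succ_self n)
    exact ENNReal.mul_ne_top ENNReal.ofReal_ne_top (by simpa using this)
  · have hV := measurable_enorm_stft φ u
    have hV' : Measurable fun w : EuclideanSpace ℝ (Fin n) × EuclideanSpace ℝ (Fin n) =>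
      ‖stft φ u w.1 w.2‖ₑ := hV
    have h := lintegral_mul_decay_le hV (n + 1) hp hpt t
    rw [mul_assoc]
    refine le_trans ?_ (mul_le_mul_right h _)
    rw [← lintegral_const_mul _ (by fun_prop)]
    refine lintegral_mono fun w => ?_
    rw [enorm_mul, enorm_mul, ← ofReal_norm (character _ _), norm_character, ENNReal.ofReal_one,
      mul_one]
    calc _ ≤ ‖stft φ u w.1 w.2‖ₑ * (ENNReal.ofReal (2 ^ (n + 1) * schwartzBound (n + 1) φ) *
          decay (n + 1) (t - w.1)) := by gcongr; exact enorm_window_le φ (n + 1) _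
      _ = _ := by ring

theorem lintegral_slice_ne_top (hs : 0 ≤ s) {u : 𝓢'(EuclideanSpace ℝ (Fin n), ℂ)}
    (hu : u ∈ modulationSpace p s φ) : ∫⁻ ξ, slice p φ u ξ ≠ ∞ :=
  ne_top_of_le_ne_top (ne_of_lt hu) (lintegral_slice_le hs u)

theorem continuous_synthesis (hp : 1 ≤ p) (hpt : p ≠ ∞) {u : 𝓢'(EuclideanSpace ℝ (Fin n), ℂ)}
    (hu : ∫⁻ ξ, slice p φ u ξ ≠ ∞) : Continuous (synthesis φ u) := by
  have hV := measurable_enorm_stft φ u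
  have hc := continuous_synthesis_integrand φ u
  refine continuous_iff_continuousAt.2 fun t₀ => ?_
  set B := 2 ^ (n + 1) * schwartzBound (n + 1) φ with hB
  -- For t within distance 1 of t₀ one has 1 + ‖t₀ - x‖ ≤ 2(1 + ‖t - x‖); this is the origin of
  -- 2^(n+1) in the majorant.
  refine continuousAt_of_dominated
    (bound := fun w => ‖stft φ u w.1 w.2‖ * (B * 2 ^ (n + 1) * ((1 + ‖t₀ - w.1‖) ^ (n + 1))⁻¹))
    (Filter.Eventually.of_forall fun t => ?_) ?_ ?_ (Filter.Eventually.of_forall fun w => ?_)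
  · exact (hc.comp (by fun_prop : Continuous fun w : EuclideanSpace ℝ (Fin n) ×
      EuclideanSpace ℝ (Fin n) => (w, t))).aestronglyMeasurable
  · filter_upwards [Metric.ball_mem_nhds t₀ one_pos] with t ht
    refine Filter.Eventually.of_forall fun w => ?_
    rw [norm_mul, norm_mul, norm_character, mul_one]
    gcongr
    rw [← div_eq_mul_inv, le_div_iff₀ (by positivity), mul_comm]
    have h1 : (1 + ‖t₀ - w.1‖) ^ (n + 1) ≤ (1 + ‖t - w.1‖) ^ (n + 1) * 2 ^ (n + 1) := by
      have := one_add_norm_pow_le_mul (n + 1) (t - w.1) (t₀ - t)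
      rw [show t - w.1 + (t₀ - t) = t₀ - w.1 by abel] at this
      refine this.trans ?_
      gcongr
      have : ‖t₀ - t‖ < 1 := by rw [← dist_eq_norm, dist_comm]; exact ht
      linarith
    calc _ ≤ ((1 + ‖t - w.1‖) ^ (n + 1) * 2 ^ (n + 1)) * ‖φ (t - w.1)‖ := by gcongr
      _ = ((1 + ‖t - w.1‖) ^ (n + 1) * ‖φ (t - w.1)‖) * 2 ^ (n + 1) := by ring
      _ ≤ _ := by
        gcongr ?_ * _
        exact pow_mul_norm_le (n + 1) φ _
  · refine ⟨?_, ?_⟩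
    · refine ((continuous_stft φ u).norm.mul (continuous_const.mul (Continuous.inv₀ (by fun_prop)
        fun w => by positivity))).aestronglyMeasurable
    · have h := lintegral_mul_decay_le hV (n + 1) hp hpt t₀
      have hB0 : 0 ≤ B * 2 ^ (n + 1) := by positivity
      have hfin : ENNReal.ofReal (B * 2 ^ (n + 1)) *
          ((1 + ∫⁻ x : EuclideanSpace ℝ (Fin n), decay (n + 1) x) * ∫⁻ ξ, slice p φ u ξ) < ∞ := by
        have := lintegral_decay_ne_top (Nat.lt_succ_self n)
        exact (ENNReal.mul_ne_top ENNReal.ofReal_ne_top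
          (ENNReal.mul_ne_top (by simpa using this) hu)).lt_top
      refine lt_of_le_of_lt ?_ (lt_of_le_of_lt (mul_le_mul_right h _) hfin)
      rw [← lintegral_const_mul _ (by
        have hV' : Measurable fun w : EuclideanSpace ℝ (Fin n) × EuclideanSpace ℝ (Fin n) =>
          ‖stft φ u w.1 w.2‖ₑ := hV
        fun_prop)]
      refine (lintegral_congr fun w => ?_).le
      rw [enorm_mul, enorm_norm, Real.enorm_of_nonneg (by positivity),
        ENNReal.ofReal_mul hB0, decay]
      ring
  · exact (hc.comp (by fun_prop : Continuous fun t : EuclideanSpace ℝ (Fin n) => (w, t))).continuousAt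

theorem integrable_synthesis (hp : 1 ≤ p) (hpt : p ≠ ∞) {u : 𝓢'(EuclideanSpace ℝ (Fin n), ℂ)}
    (hu : ∫⁻ ξ, slice p φ u ξ ≠ ∞) {g : EuclideanSpace ℝ (Fin n) → ℂ} (hg : Integrable g) :
    Integrable fun q : (EuclideanSpace ℝ (Fin n) × EuclideanSpace ℝ (Fin n)) ×
      EuclideanSpace ℝ (Fin n) =>
      stft φ u q.1.1 q.1.2 * (φ (q.2 - q.1.1) * character (-q.1.2) q.2) * g q.2 := by
  obtain ⟨C, hC, h⟩ := exists_lintegral_synthesis_le φ hp hpt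
  have hm : AEStronglyMeasurable (fun q : (EuclideanSpace ℝ (Fin n) × EuclideanSpace ℝ (Fin n)) ×
      EuclideanSpace ℝ (Fin n) =>
      stft φ u q.1.1 q.1.2 * (φ (q.2 - q.1.1) * character (-q.1.2) q.2) * g q.2)
      (volume.prod volume) :=
    (continuous_synthesis_integrand φ u).aestronglyMeasurable.mul hg.1.comp_snd
  refine ⟨hm, ?_⟩
  rw [HasFiniteIntegral, Measure.volume_eq_prod, lintegral_prod_symm _ hm.enorm]
  calc _ = ∫⁻ t, (∫⁻ w : EuclideanSpace ℝ (Fin n) × EuclideanSpace ℝ (Fin n),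
        ‖stft φ u w.1 w.2 * (φ (t - w.1) * character (-w.2) t)‖ₑ) * ‖g t‖ₑ := by
        refine lintegral_congr fun t => ?_
        simp only [enorm_mul _ (g t)]
        rw [lintegral_mul_const]
        exact ((continuous_synthesis_integrand φ u).comp (by fun_prop : Continuous fun w :
          EuclideanSpace ℝ (Fin n) × EuclideanSpace ℝ (Fin n) => (w, t))).enorm.measurable
    _ ≤ ∫⁻ t, (C * ∫⁻ ξ, slice p φ u ξ) * ‖g t‖ₑ := by gcongr; exact h u _
    _ = (C * ∫⁻ ξ, slice p φ u ξ) * ∫⁻ t, ‖g t‖ₑ := by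
        rw [lintegral_const_mul' _ _ (ENNReal.mul_ne_top hC hu)]
    _ < ∞ := (ENNReal.mul_ne_top (ENNReal.mul_ne_top hC hu) hg.2.ne).lt_top

theorem integral_synthesis_mul (hp : 1 ≤ p) (hpt : p ≠ ∞)
    {u : 𝓢'(EuclideanSpace ℝ (Fin n), ℂ)} (hu : ∫⁻ ξ, slice p φ u ξ ≠ ∞)
    {g : EuclideanSpace ℝ (Fin n) → ℂ} (hg : Integrable g) :
    ∫ t, synthesis φ u t * g t = ∫ w : EuclideanSpace ℝ (Fin n) × EuclideanSpace ℝ (Fin n),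
      stft φ u w.1 w.2 * ∫ t, φ (t - w.1) * character (-w.2) t * g t := by
  have h := integrable_synthesis hp hpt hu hg
  have h2 := integral_integral_swap (μ := (volume : Measure (EuclideanSpace ℝ (Fin n) ×
    EuclideanSpace ℝ (Fin n)))) (ν := (volume : Measure (EuclideanSpace ℝ (Fin n))))
    (f := fun w t => stft φ u w.1 w.2 * (φ (t - w.1) * character (-w.2) t) * g t) h
  simp only [synthesis, ← integral_mul_const]
  rw [← h2]
  refine integral_congr_ae (Filter.Eventually.of_forall fun w => ?_)
  simp only [mul_assoc]
  rw [integral_const_mul]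

theorem exists_enorm_synthesis_le (φ : 𝓢(EuclideanSpace ℝ (Fin n), ℂ)) (hp : 1 ≤ p)
    (hpt : p ≠ ∞) : ∃ C : ℝ≥0∞, C ≠ ∞ ∧ ∀ (u : 𝓢'(EuclideanSpace ℝ (Fin n), ℂ)) t,
      ‖synthesis φ u t‖ₑ ≤ C * ∫⁻ ξ, slice p φ u ξ := by
  obtain ⟨C, hC, h⟩ := exists_lintegral_synthesis_le φ hp hpt
  exact ⟨C, hC, fun u t => (enorm_integral_le_lintegral_enorm _).trans (h u t)⟩

/-- Elements of the modulation space are given by bounded continuous functions. -/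
theorem isGivenBy_synthesis (hφ : φ ≠ 0) (hp : 1 ≤ p) (hpt : p ≠ ∞)
    {u : 𝓢'(EuclideanSpace ℝ (Fin n), ℂ)} (hu : ∫⁻ ξ, slice p φ u ξ ≠ ∞) :
    IsGivenBy u fun t => (inversionConst φ)⁻¹ * synthesis φ u t := by
  have hc := inversionConst_ne_zero hφ
  refine ⟨continuous_const.mul (continuous_synthesis hp hpt hu), fun ψ => ?_, fun ψ => ?_⟩
  · have := (integrable_synthesis hp hpt hu ψ.integrable).integral_prod_right
    refine (this.const_mul (inversionConst φ)⁻¹).congr (Filter.Eventually.of_forall fun t => ?_)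
    simp only [synthesis]
    rw [integral_mul_const, mul_assoc]
  -- After Fubini, pairing the synthesis with ψ reproduces the right side of the inversion formula.
  · have h := inversion φ u ψ
    have h2 := integral_synthesis_mul hp hpt hu ψ.integrable
    simp only [mul_assoc]
    rw [integral_const_mul, h2, eq_inv_mul_iff_mul_eq₀ hc, h]
    refine integral_congr_ae (Filter.Eventually.of_forall fun w => ?_)
    simp only [cross]
    rw [mul_comm]
    congr 1
    refine integral_congr_ae (Filter.Eventually.of_forall fun t => ?_)
    simp only
    ring

end WindowChange

/-! ### The modulation space as an algebra of continuous functions -/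

section Functions



variable {n : ℕ} {p : ℝ≥0∞} {s : ℝ} {φ : 𝓢(EuclideanSpace ℝ (Fin n), ℂ)}
  {u v w : 𝓢'(EuclideanSpace ℝ (Fin n), ℂ)} {f g : EuclideanSpace ℝ (Fin n) → ℂ}

theorem IsGivenBy.unique (hf : IsGivenBy u f) (hg : IsGivenBy u g) : f = g := by
  refine (hf.continuous.ae_eq_iff_eq volume hg.continuous).1 ?_
  refine ae_eq_of_integral_contDiff_smul_eq hf.continuous.locallyIntegrable
    hg.continuous.locallyIntegrable fun h hh hs => ?_
  have hs' : HasCompactSupport fun t => (h t : ℂ) := hs.comp_left Complex.ofReal_zero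
  have hh' : ContDiff ℝ ((⊤ : ℕ∞) : WithTop ℕ∞) fun t => (h t : ℂ) := Complex.ofRealCLM.contDiff.comp hh
  have e : ∀ t, hs'.toSchwartzMap hh' t = (h t : ℂ) := fun t => rfl
  have := (hf.apply_eq (hs'.toSchwartzMap hh')).symm.trans (hg.apply_eq _)
  simp only [e] at this
  simpa [mul_comm] using this

theorem IsGivenBy.add (hf : IsGivenBy u f) (hg : IsGivenBy v g) :
    IsGivenBy (u + v) fun t => f t + g t := by
  refine ⟨hf.continuous.add hg.continuous, fun ψ => ?_, fun ψ => ?_⟩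
  · simpa only [add_mul] using! (hf.integrable ψ).add (hg.integrable ψ)
  · simp only [add_mul]
    rw [integral_add (hf.integrable ψ) (hg.integrable ψ), ← hf.apply_eq, ← hg.apply_eq]
    rfl

theorem IsGivenBy.const_smul (hf : IsGivenBy u f) (c : ℂ) :
    IsGivenBy (c • u) fun t => c * f t := by
  refine ⟨continuous_const.mul hf.continuous, fun ψ => ?_, fun ψ => ?_⟩
  · simpa only [mul_assoc] using (hf.integrable ψ).const_mul c
  · simp only [mul_assoc]
    rw [integral_const_mul, ← hf.apply_eq]
    rfl

theorem IsGivenBy.sub (hf : IsGivenBy u f) (hg : IsGivenBy v g) :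
    IsGivenBy (u - v) fun t => f t - g t := by
  refine ⟨hf.continuous.sub hg.continuous, fun ψ => ?_, fun ψ => ?_⟩
  · simpa only [sub_mul] using! (hf.integrable ψ).sub (hg.integrable ψ)
  · simp only [sub_mul]
    rw [integral_sub (hf.integrable ψ) (hg.integrable ψ), ← hf.apply_eq, ← hg.apply_eq]
    rfl

theorem IsGivenBy.stft_eq (hf : IsGivenBy u f) (φ : 𝓢(EuclideanSpace ℝ (Fin n), ℂ))
    (x ξ : EuclideanSpace ℝ (Fin n)) : stft φ u x ξ = ∫ t, f t * conjShift φ x ξ t :=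
  hf.apply_eq _

theorem exists_isGivenBy_of_bounded (hf : Continuous f) {B : ℝ} (hB : ∀ t, ‖f t‖ ≤ B) :
    ∃ w, IsGivenBy w f := by
  have hm : MemLp f ∞ volume := memLp_top_of_bound hf.aestronglyMeasurable B
    (Filter.Eventually.of_forall hB)
  have : Fact ((1 : ℝ≥0∞) ≤ ∞) := ⟨le_top⟩
  refine ⟨Lp.toTemperedDistribution (hm.toLp f), hf, fun ψ => ?_, fun ψ => ?_⟩
  · exact ψ.integrable.bdd_mul hf.aestronglyMeasurable (Filter.Eventually.of_forall hB)
  · refine (Lp.toTemperedDistribution_apply _ ψ).trans (integral_congr_ae ?_)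
    filter_upwards [hm.coeFn_toLp] with t ht
    rw [ht, smul_eq_mul, mul_comm]

theorem exists_isGivenBy_schwartz (ψ : 𝓢(EuclideanSpace ℝ (Fin n), ℂ)) :
    ∃ w, IsGivenBy w ψ :=
  exists_isGivenBy_of_bounded ψ.continuous fun t => ψ.norm_le_seminorm ℝ t

theorem exists_isGivenBy_of_mem (hφ : φ ≠ 0) (hp : 1 ≤ p) (hpt : p ≠ ∞) (hs : 0 ≤ s)
    (hu : u ∈ modulationSpace p s φ) : ∃ f, IsGivenBy u f :=
  ⟨_, isGivenBy_synthesis hφ hp hpt (lintegral_slice_ne_top hs hu)⟩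

theorem IsGivenBy.eq_synthesis (hφ : φ ≠ 0) (hp : 1 ≤ p) (hpt : p ≠ ∞) (hs : 0 ≤ s)
    (hu : u ∈ modulationSpace p s φ) (hf : IsGivenBy u f) :
    f = fun t => (inversionConst φ)⁻¹ * synthesis φ u t :=
  hf.unique (isGivenBy_synthesis hφ hp hpt (lintegral_slice_ne_top hs hu))

/-- Norm convergence implies uniform convergence; this makes the condition of vanishing at a point
closed. -/
theorem exists_enorm_le_modNorm (hφ : φ ≠ 0) (hp : 1 ≤ p) (hpt : p ≠ ∞) (hs : 0 ≤ s) :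
    ∃ C : ℝ≥0∞, C ≠ ∞ ∧ ∀ (u : 𝓢'(EuclideanSpace ℝ (Fin n), ℂ)) f,
      u ∈ modulationSpace p s φ → IsGivenBy u f → ∀ t, ‖f t‖ₑ ≤ C * modNorm p s φ u := by
  obtain ⟨C, hC, h⟩ := exists_enorm_synthesis_le (n := n) φ hp hpt
  refine ⟨‖(inversionConst φ)⁻¹‖ₑ * C, ENNReal.mul_ne_top enorm_ne_top hC, fun u f hu hf t => ?_⟩
  rw [hf.eq_synthesis hφ hp hpt hs hu, enorm_mul, mul_assoc]
  gcongr
  exact (h u t).trans (by gcongr; exact lintegral_slice_le hs u)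

theorem IsGivenBy.exists_norm_le (hφ : φ ≠ 0) (hp : 1 ≤ p) (hpt : p ≠ ∞) (hs : 0 ≤ s)
    (hu : u ∈ modulationSpace p s φ) (hf : IsGivenBy u f) : ∃ B, ∀ t, ‖f t‖ ≤ B := by
  obtain ⟨C, hC, h⟩ := exists_enorm_le_modNorm (n := n) hφ hp hpt hs
  refine ⟨(C * modNorm p s φ u).toReal, fun t => ?_⟩
  have := ENNReal.toReal_mono (ENNReal.mul_ne_top hC (ne_of_lt hu)) (h u f hu hf t)
  simpa using this

theorem modNorm_add_le (hp : 1 ≤ p) (hpt : p ≠ ∞) (u v : 𝓢'(EuclideanSpace ℝ (Fin n), ℂ)) :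
    modNorm p s φ (u + v) ≤ modNorm p s φ u + modNorm p s φ v := by
  have hmu := measurable_slice (φ := φ) hp hpt u
  rw [modNorm_eq, modNorm_eq, modNorm_eq, ← lintegral_add_left (by fun_prop)]
  refine lintegral_mono fun ξ => ?_
  rw [← mul_add]
  gcongr
  simp only [slice_eq]
  have hc : ∀ u : 𝓢'(EuclideanSpace ℝ (Fin n), ℂ),
      AEStronglyMeasurable (fun x => stft φ u x ξ) volume := fun u =>
    ((continuous_stft φ u).comp (continuous_id.prodMk continuous_const)).aestronglyMeasurable
  exact eLpNorm_add_le (hc u) (hc v) hp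

theorem modNorm_smul (c : ℂ) (u : 𝓢'(EuclideanSpace ℝ (Fin n), ℂ)) :
    modNorm p s φ (c • u) = ‖c‖ₑ * modNorm p s φ u := by
  have h : ∀ ξ, slice p φ (c • u) ξ = ‖c‖ₑ * slice p φ u ξ := fun ξ => by
    rw [slice_eq, slice_eq]
    exact eLpNorm_const_smul c (fun x => stft φ u x ξ) p volume
  rw [modNorm_eq, modNorm_eq, ← lintegral_const_mul' _ _ enorm_ne_top]
  simp only [h]
  congr 1; funext ξ; ring

/-- The modulation space as a linear subspace. -/
noncomputable def modSubmodule (hp : 1 ≤ p) (hpt : p ≠ ∞) (s : ℝ)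
    (φ : 𝓢(EuclideanSpace ℝ (Fin n), ℂ)) : Submodule ℂ 𝓢'(EuclideanSpace ℝ (Fin n), ℂ) where
  carrier := modulationSpace p s φ
  add_mem' {u v} hu hv := lt_of_le_of_lt (modNorm_add_le hp hpt u v) (ENNReal.add_lt_top.2 ⟨hu, hv⟩)
  zero_mem' := by
    have h : stft φ 0 = 0 := rfl
    change modNorm p s φ 0 < ∞
    simp [modNorm, h]
  smul_mem' c u hu := by
    change modNorm p s φ (c • u) < ∞
    rw [modNorm_smul]
    exact (ENNReal.mul_ne_top enorm_ne_top (ne_of_lt hu)).lt_top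

theorem stft_eq_of_schwartz {ψ : 𝓢(EuclideanSpace ℝ (Fin n), ℂ)} (hw : IsGivenBy w ψ)
    (x ξ : EuclideanSpace ℝ (Fin n)) : stft φ w x ξ = conj (cross φ (schwartzConj ψ) x ξ) := by
  rw [hw.stft_eq, cross, ← integral_conj]
  refine integral_congr_ae (Filter.Eventually.of_forall fun t => ?_)
  simp only [conjShift_apply', schwartzConj_apply, map_mul, Complex.conj_conj, conj_character,
    neg_neg]
  ring

/-- The transform of a Schwartz function decays to any order in both variables; order N > n + s
beats the weight in ξ, and p ≥ 1 with a kernel at most 1 gives the Lᵖ bound in x. -/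
theorem mem_modulationSpace_of_schwartz (hp : 1 ≤ p) (hpt : p ≠ ∞) (hs : 0 ≤ s)
    {ψ : 𝓢(EuclideanSpace ℝ (Fin n), ℂ)} (hw : IsGivenBy w ψ) : w ∈ modulationSpace p s φ := by
  obtain ⟨N, hN⟩ : ∃ N : ℕ, (n : ℝ) + s < N := exists_nat_gt _
  have hN' : n < N := by
    have : (n : ℝ) < N := by linarith
    exact_mod_cast this
  obtain ⟨K, C, hC, h⟩ := exists_norm_cross_le φ N
  set D := ENNReal.ofReal (C * schwartzBound K (schwartzConj ψ))
  have h1 : ∀ x ξ, ‖stft φ w x ξ‖ₑ ≤ D * decay N ξ * decay N x := fun x ξ => by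
    rw [stft_eq_of_schwartz hw, RCLike.enorm_conj]
    refine (enorm_le_decay_mul_decay (h _ x ξ)).trans (le_of_eq ?_)
    ring
  have hd : eLpNorm (decay N : EuclideanSpace ℝ (Fin n) → ℝ≥0∞) p volume ≠ ∞ := by
    have hp0 : p ≠ 0 := (zero_lt_one.trans_le hp).ne'
    rw [eLpNorm_eq_lintegral_rpow_enorm_toReal hp0 hpt]
    refine ENNReal.rpow_ne_top_of_nonneg (by positivity) (ne_top_of_le_ne_top
      (lintegral_decay_ne_top hN') (lintegral_mono fun x => ?_))
    rw [enorm_eq_self]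
    calc decay N x ^ p.toReal ≤ decay N x ^ (1 : ℝ) := by
          refine ENNReal.rpow_le_rpow_of_exponent_ge (decay_le_one N x) ?_
          rw [← ENNReal.toReal_one]; exact ENNReal.toReal_mono hpt hp
      _ = _ := ENNReal.rpow_one _
  have h2 : ∀ ξ, slice p φ w ξ ≤ D * decay N ξ *
      eLpNorm (decay N : EuclideanSpace ℝ (Fin n) → ℝ≥0∞) p volume := fun ξ => by
    rw [← eLpNorm_ennreal_const_mul (measurable_decay N) _ hp hpt]
    exact eLpNorm_mono_enorm fun x => by simpa using h1 x ξ
  refine mem_modulationSpace_of_lintegral_weight hs ?_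
  refine ne_top_of_le_ne_top ?_ (lintegral_mono fun ξ => mul_le_mul_right (h2 ξ) _)
  have h3 : ∀ ξ : EuclideanSpace ℝ (Fin n), weight 1 s ξ * (D * decay N ξ *
      eLpNorm (decay N : EuclideanSpace ℝ (Fin n) → ℝ≥0∞) p volume) =
      (D * eLpNorm (decay N : EuclideanSpace ℝ (Fin n) → ℝ≥0∞) p volume) *
        (weight 1 s ξ * decay N ξ) := fun ξ => by ring
  simp only [h3]
  rw [lintegral_const_mul _ (by fun_prop)]
  exact ENNReal.mul_ne_top (ENNReal.mul_ne_top ENNReal.ofReal_ne_top hd)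
    (lintegral_weight_mul_decay_ne_top hN)

/-- Multiplication by `t ↦ ∫ m(τ) exp (i τ·(t - x₀)) dτ` convolves the short-time Fourier
transform with `m` in frequency. -/
theorem enorm_stft_le_of_fourier_mul {m : EuclideanSpace ℝ (Fin n) → ℂ} (hm : Integrable m)
    (x₀ : EuclideanSpace ℝ (Fin n)) (hf : IsGivenBy u f)
    (hw : IsGivenBy w fun t => (∫ τ, m τ * character (-τ) (t - x₀)) * f t)
    (z ζ : EuclideanSpace ℝ (Fin n)) :
    ‖stft φ w z ζ‖ₑ ≤ ∫⁻ τ, ‖m τ‖ₑ * ‖stft φ u z (ζ - τ)‖ₑ := by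
  have hi : Integrable fun q : EuclideanSpace ℝ (Fin n) × EuclideanSpace ℝ (Fin n) =>
      character (-q.1) (q.2 - x₀) * (m q.1 * (f q.2 * conjShift φ z ζ q.2)) := by
    refine (hm.mul_prod (hf.integrable (conjShift φ z ζ))).bdd_mul (c := 1)
      (Continuous.aestronglyMeasurable ?_)
      (Filter.Eventually.of_forall fun q => (norm_character _ _).le)
    unfold character; fun_prop
  have h : stft φ w z ζ = ∫ τ, m τ * character (-τ) (-x₀) * stft φ u z (ζ - τ) := by
    have h1 := integral_integral_swap (μ := (volume : Measure (EuclideanSpace ℝ (Fin n))))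
      (ν := (volume : Measure (EuclideanSpace ℝ (Fin n))))
      (f := fun τ t => character (-τ) (t - x₀) * (m τ * (f t * conjShift φ z ζ t))) hi
    calc stft φ w z ζ = ∫ t, ∫ τ, character (-τ) (t - x₀) * (m τ * (f t * conjShift φ z ζ t)) := by
          rw [hw.stft_eq]
          refine integral_congr_ae (Filter.Eventually.of_forall fun t => ?_)
          simp only
          rw [mul_assoc, ← integral_mul_const]
          refine integral_congr_ae (Filter.Eventually.of_forall fun τ => ?_)
          simp only; ring
      _ = ∫ τ, ∫ t, character (-τ) (t - x₀) * (m τ * (f t * conjShift φ z ζ t)) := h1.symm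
      _ = _ := by
          refine integral_congr_ae (Filter.Eventually.of_forall fun τ => ?_)
          simp only
          rw [hf.stft_eq, ← integral_const_mul]
          refine integral_congr_ae (Filter.Eventually.of_forall fun t => ?_)
          simp only [conjShift_apply']
          rw [sub_eq_add_neg t x₀, character_add_right, sub_eq_add_neg ζ τ, ← character_mul ζ (-τ) t]
          ring
  rw [h]
  refine (enorm_integral_le_lintegral_enorm _).trans (lintegral_mono fun τ => ?_)
  rw [enorm_mul, enorm_mul, ← ofReal_norm (character _ _), norm_character, ENNReal.ofReal_one,
    mul_one]

theorem slice_le_of_fourier_mul (hp : 1 ≤ p) (hpt : p ≠ ∞)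
    {m : EuclideanSpace ℝ (Fin n) → ℂ} (hm : Integrable m) (hmm : Measurable m)
    (x₀ : EuclideanSpace ℝ (Fin n)) (hf : IsGivenBy u f)
    (hw : IsGivenBy w fun t => (∫ τ, m τ * character (-τ) (t - x₀)) * f t)
    (ζ : EuclideanSpace ℝ (Fin n)) :
    slice p φ w ζ ≤ ∫⁻ τ, ‖m τ‖ₑ * slice p φ u (ζ - τ) := by
  have hV := measurable_enorm_stft φ u
  have h1 : slice p φ w ζ ≤
      eLpNorm (fun z => ∫⁻ τ, ‖m τ‖ₑ * ‖stft φ u z (ζ - τ)‖ₑ) p volume :=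
    eLpNorm_mono_enorm fun z => by
      simpa using enorm_stft_le_of_fourier_mul (φ := φ) hm x₀ hf hw z ζ
  refine h1.trans ((eLpNorm_lintegral_le (F := fun z τ => ‖m τ‖ₑ * ‖stft φ u z (ζ - τ)‖ₑ) ?_
    hp hpt).trans (lintegral_mono fun τ => ?_))
  · have : Measurable fun q : EuclideanSpace ℝ (Fin n) × EuclideanSpace ℝ (Fin n) =>
        ‖stft φ u q.1 (ζ - q.2)‖ₑ :=
      ((continuous_stft φ u).comp (continuous_fst.prodMk
        (continuous_const.sub continuous_snd))).enorm.measurable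
    exact (hmm.comp measurable_snd).enorm.mul this
  · rw [eLpNorm_ennreal_const_mul (hV.of_uncurry_right) _ hp hpt]
    rfl

theorem schwartzBound_window_mul_le (φ : 𝓢(EuclideanSpace ℝ (Fin n), ℂ)) (K N : ℕ) :
    ∃ C : ℝ, 0 ≤ C ∧ ∀ y, (1 + ‖y‖) ^ N * schwartzBound K (schwartzMul
      (SchwartzMap.compSubConstCLM ℝ y (schwartzConj φ)) φ) ≤ C :=
  ⟨_, by positivity, fun y => schwartzBound_mul_translate_le K N _ _ y⟩

/-- The modulation space is closed under pointwise multiplication. -/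
theorem mul_mem_modulationSpace (hφ : φ ≠ 0) (hp : 1 ≤ p) (hpt : p ≠ ∞) (hs : 0 ≤ s)
    (hu : u ∈ modulationSpace p s φ) (hv : v ∈ modulationSpace p s φ) (hf : IsGivenBy u f)
    (hg : IsGivenBy v g) (hw : IsGivenBy w fun t => f t * g t) : w ∈ modulationSpace p s φ := by
  obtain ⟨N, hN⟩ : ∃ N : ℕ, (n : ℝ) + s < N := exists_nat_gt _
  have hN' : n < N := by
    have : (n : ℝ) < N := by linarith
    exact_mod_cast this
  have hc := inversionConst_ne_zero hφ
  obtain ⟨K, C, hC, h⟩ := exists_enorm_stft_le hφ N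
  obtain ⟨C', hC', h'⟩ := schwartzBound_window_mul_le φ K N
  -- These are the windows that appear when the synthesis formula for u meets the window φ of the
  -- product; all their seminorms decay in y.
  set θ : EuclideanSpace ℝ (Fin n) → 𝓢(EuclideanSpace ℝ (Fin n), ℂ) := fun y =>
    schwartzMul (SchwartzMap.compSubConstCLM ℝ y (schwartzConj φ)) φ with hθ
  set k : EuclideanSpace ℝ (Fin n) → ℝ≥0∞ := fun ζ => ∫⁻ η, slice p φ v η * decay N (ζ - η) with hk
  have hmv := measurable_slice (φ := φ) hp hpt v
  have hmu := measurable_slice (φ := φ) hp hpt u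
  have hkm : Measurable k := by
    refine Measurable.lintegral_prod_right ?_
    unfold Function.uncurry
    fun_prop
  set D : ℝ≥0∞ := ∫⁻ x : EuclideanSpace ℝ (Fin n), decay N x with hD
  have hDt : D ≠ ∞ := lintegral_decay_ne_top hN'
  -- Only a supremum over position is retained for v, so the product is estimated as Lᵖ · L^∞ in
  -- position and as a convolution in frequency.
  have hθb : ∀ x z ω, ‖stft (θ (x - z)) v z ω‖ₑ ≤
      ENNReal.ofReal (C * C') * (1 + D) * (decay N (z - x) * k ω) := fun x z ω => by
    have h1 : ENNReal.ofReal (C * schwartzBound K (θ (x - z))) ≤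
        ENNReal.ofReal (C * C') * decay N (z - x) := by
      rw [decay_sub_comm, decay, ← ENNReal.ofReal_mul (by positivity), ← div_eq_mul_inv]
      refine ENNReal.ofReal_le_ofReal ?_
      rw [le_div_iff₀ (by positivity)]
      calc _ = C * ((1 + ‖x - z‖) ^ N * schwartzBound K (θ (x - z))) := by ring
        _ ≤ _ := mul_le_mul_of_nonneg_left (h' _) hC
    refine (h v (θ (x - z)) z ω).trans ((mul_le_mul' h1
      (smear_le (measurable_enorm_stft φ v) (measurable_decay N) N hp hpt z ω)).trans (le_of_eq ?_))
    simp only [hk, slice]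
    ring
  -- Under the synthesis integral φ(t - x) combines with conj φ(t - z) into the conjugate of θ(x -
  -- z) shifted by z, and the two characters combine into frequency ζ - η.
  have hstft : ∀ z ζ, inversionConst φ * stft φ w z ζ =
      ∫ q : EuclideanSpace ℝ (Fin n) × EuclideanSpace ℝ (Fin n),
        stft φ u q.1 q.2 * stft (θ (q.1 - z)) v z (ζ - q.2) := fun z ζ => by
    have h1 := integral_synthesis_mul hp hpt (lintegral_slice_ne_top hs hu)
      (hg.integrable (conjShift φ z ζ))
    rw [hw.stft_eq, ← integral_const_mul]
    calc _ = ∫ t, synthesis φ u t * (g t * conjShift φ z ζ t) := by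
          refine integral_congr_ae (Filter.Eventually.of_forall fun t => ?_)
          simp only [hf.eq_synthesis hφ hp hpt hs hu]
          field_simp
      _ = _ := h1
      _ = _ := by
          refine integral_congr_ae (Filter.Eventually.of_forall fun q => ?_)
          simp only
          rw [hg.stft_eq]
          congr 1
          refine integral_congr_ae (Filter.Eventually.of_forall fun t => ?_)
          simp only [hθ, conjShift_apply', schwartzMul_apply, SchwartzMap.compSubConstCLM_apply,
            schwartzConj_apply, map_mul, Complex.conj_conj]
          rw [show t - z - (q.1 - z) = t - q.1 by abel, sub_eq_add_neg ζ, ← character_mul]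
          ring
  have hle : ∀ z ζ, ‖stft φ w z ζ‖ₑ ≤ ‖inversionConst φ‖ₑ⁻¹ *
      (ENNReal.ofReal (C * C') * (1 + D)) * smear N k (fun x ξ => ‖stft φ u x ξ‖ₑ) z ζ :=
    fun z ζ => by
    have hV' : Measurable fun w : EuclideanSpace ℝ (Fin n) × EuclideanSpace ℝ (Fin n) =>
      ‖stft φ u w.1 w.2‖ₑ := measurable_enorm_stft φ u
    have hc' : ‖inversionConst φ‖ₑ ≠ 0 := by simpa using hc
    rw [mul_assoc, ← ENNReal.div_eq_inv_mul, ENNReal.le_div_iff_mul_le (Or.inl hc')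
      (Or.inl enorm_ne_top), mul_comm, ← enorm_mul, hstft,
      smear_eq_lintegral_prod (measurable_enorm_stft φ u) hkm, ← lintegral_const_mul _ (by fun_prop)]
    refine (enorm_integral_le_lintegral_enorm _).trans (lintegral_mono fun q => ?_)
    rw [enorm_mul]
    calc _ ≤ ‖stft φ u q.1 q.2‖ₑ * (ENNReal.ofReal (C * C') * (1 + D) *
          (decay N (z - q.1) * k (ζ - q.2))) := by gcongr; exact hθb _ _ _
      _ = _ := by ring
  set M : ℝ≥0∞ := ‖inversionConst φ‖ₑ⁻¹ * (ENNReal.ofReal (C * C') * (1 + D)) with hM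
  have hMt : M ≠ ∞ := ENNReal.mul_ne_top (by simpa using hc)
    (ENNReal.mul_ne_top ENNReal.ofReal_ne_top (by simpa using hDt))
  have hsm := measurable_smear (measurable_enorm_stft φ u) hkm N
  have hslice : ∀ ζ, slice p φ w ζ ≤ M * (D * ∫⁻ η, slice p φ u η * k (ζ - η)) := fun ζ => by
    calc slice p φ w ζ ≤ eLpNorm (fun z => M * smear N k (fun x ξ => ‖stft φ u x ξ‖ₑ) z ζ) p volume :=
          eLpNorm_mono_enorm fun z => by simpa using hle z ζ
      _ = M * eLpNorm (fun z => smear N k (fun x ξ => ‖stft φ u x ξ‖ₑ) z ζ) p volume :=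
          eLpNorm_ennreal_const_mul hsm.of_uncurry_right _ hp hpt
      _ ≤ _ := by
          gcongr
          exact eLpNorm_smear_le (measurable_enorm_stft φ u) hkm N hp hpt ζ
  refine mem_modulationSpace_of_lintegral_weight hs (ne_top_of_le_ne_top ?_
    (lintegral_mono fun ζ => mul_le_mul_right (hslice ζ) _))
  have e : ∀ ζ : EuclideanSpace ℝ (Fin n), weight 1 s ζ * (M * (D * ∫⁻ η, slice p φ u η * k (ζ - η))) =
      (M * D) * (weight 1 s ζ * ∫⁻ η, slice p φ u η * k (ζ - η)) := fun ζ => by ring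
  simp only [e]
  rw [lintegral_const_mul' _ _ (ENNReal.mul_ne_top hMt hDt)]
  -- The slices of the product are dominated by slice u ∗ slice v ∗ decay, and weighted L¹ is closed
  -- under convolution.
  refine ENNReal.mul_ne_top (ENNReal.mul_ne_top hMt hDt) (ne_top_of_le_ne_top ?_
    (lintegral_weight_mul_conv_le zero_le_one hs hmu hkm))
  refine ENNReal.mul_ne_top (lintegral_weight_mul_slice_ne_top hp hpt hs hu)
    (ne_top_of_le_ne_top ?_ (lintegral_weight_mul_conv_le zero_le_one hs hmv (measurable_decay N)))
  exact ENNReal.mul_ne_top (lintegral_weight_mul_slice_ne_top hp hpt hs hv)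
    (lintegral_weight_mul_decay_ne_top hN)

theorem exists_isProduct (hφ : φ ≠ 0) (hp : 1 ≤ p) (hpt : p ≠ ∞) (hs : 0 ≤ s)
    (hu : u ∈ modulationSpace p s φ) (hv : v ∈ modulationSpace p s φ) (hf : IsGivenBy u f)
    (hg : IsGivenBy v g) :
    ∃ w ∈ modulationSpace p s φ, IsGivenBy w fun t => f t * g t := by
  obtain ⟨B, hB⟩ := hf.exists_norm_le hφ hp hpt hs hu
  obtain ⟨B', hB'⟩ := hg.exists_norm_le hφ hp hpt hs hv
  obtain ⟨w, hw⟩ := exists_isGivenBy_of_bounded (f := fun t => f t * g t) (B := B * B')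
    (hf.continuous.mul hg.continuous) fun t => by
      rw [norm_mul]
      exact mul_le_mul (hB t) (hB' t) (norm_nonneg _) ((norm_nonneg _).trans (hB t))
  exact ⟨w, mul_mem_modulationSpace hφ hp hpt hs hu hv hf hg hw, hw⟩

end Functions

/-! ### Closed ideals and the necessity of having no zeros -/

section Ideals

variable {n : ℕ} {p : ℝ≥0∞} {s : ℝ} {φ : 𝓢(EuclideanSpace ℝ (Fin n), ℂ)}
  {u v w : 𝓢'(EuclideanSpace ℝ (Fin n), ℂ)} {f g : EuclideanSpace ℝ (Fin n) → ℂ}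

theorem exists_mem_isGivenBy_of_hasCompactSupport (hp : 1 ≤ p) (hpt : p ≠ ∞) (hs : 0 ≤ s)
    (φ : 𝓢(EuclideanSpace ℝ (Fin n), ℂ)) (hf : HasCompactSupport f)
    (hf' : ContDiff ℝ ((⊤ : ℕ∞) : WithTop ℕ∞) f) :
    ∃ w ∈ modulationSpace p s φ, IsGivenBy w f := by
  obtain ⟨w, hw⟩ := exists_isGivenBy_schwartz (hf.toSchwartzMap hf')
  exact ⟨w, mem_modulationSpace_of_schwartz hp hpt hs hw, hw⟩

/-- The whole space is one of the ideals being intersected, so the generated ideal stays inside it.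
-/
theorem isClosedIdeal_modSubmodule (hφ : φ ≠ 0) (hp : 1 ≤ p) (hpt : p ≠ ∞) (hs : 0 ≤ s) :
    IsClosedIdeal p s φ (modSubmodule hp hpt s φ) where
  subset := subset_rfl
  mul_mem u hu v hv := by
    obtain ⟨f, hf⟩ := exists_isGivenBy_of_mem hφ hp hpt hs hu
    obtain ⟨g, hg⟩ := exists_isGivenBy_of_mem hφ hp hpt hs hv
    obtain ⟨w, hw, hw'⟩ := exists_isProduct hφ hp hpt hs hu hv hf hg
    exact ⟨w, hw, f, g, hf, hg, hw'⟩
  closed u hu _ := hu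

/-- The elements of the modulation space that vanish at `x₀`. -/
noncomputable def vanishingIdeal (hp : 1 ≤ p) (hpt : p ≠ ∞) (s : ℝ)
    (φ : 𝓢(EuclideanSpace ℝ (Fin n), ℂ)) (x₀ : EuclideanSpace ℝ (Fin n)) :
    Submodule ℂ 𝓢'(EuclideanSpace ℝ (Fin n), ℂ) where
  carrier := {u | u ∈ modSubmodule hp hpt s φ ∧ ∃ f, IsGivenBy u f ∧ f x₀ = 0}
  add_mem' := by
    rintro u v ⟨hu, f, hf, hf0⟩ ⟨hv, g, hg, hg0⟩
    exact ⟨Submodule.add_mem _ hu hv, _, hf.add hg, by simp [hf0, hg0]⟩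
  zero_mem' := ⟨Submodule.zero_mem _, fun _ => 0, ⟨continuous_const, fun ψ => by simp,
    fun ψ => by simp⟩, rfl⟩
  smul_mem' := by
    rintro c u ⟨hu, f, hf, hf0⟩
    exact ⟨Submodule.smul_mem _ c hu, _, hf.const_smul c, by simp [hf0]⟩

theorem isClosedIdeal_vanishingIdeal (hφ : φ ≠ 0) (hp : 1 ≤ p) (hpt : p ≠ ∞) (hs : 0 ≤ s)
    (x₀ : EuclideanSpace ℝ (Fin n)) : IsClosedIdeal p s φ (vanishingIdeal hp hpt s φ x₀) where
  subset _ hu := hu.1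
  mul_mem := by
    rintro u hu v ⟨hv, g, hg, hg0⟩
    obtain ⟨f, hf⟩ := exists_isGivenBy_of_mem hφ hp hpt hs hu
    obtain ⟨w, hw, hw'⟩ := exists_isProduct hφ hp hpt hs hu hv hf hg
    exact ⟨w, ⟨hw, _, hw', by simp [hg0]⟩, f, g, hf, hg, hw'⟩
  closed u hu h := by
    obtain ⟨f, hf⟩ := exists_isGivenBy_of_mem hφ hp hpt hs hu
    refine ⟨hu, f, hf, ?_⟩
    obtain ⟨C, hC, hle⟩ := exists_enorm_le_modNorm (n := n) hφ hp hpt hs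
    by_contra hne
    have hC0 : C ≠ 0 := by
      rintro rfl
      exact hne (by simpa using hle u f hu hf x₀)
    -- An approximant within ‖f x₀‖ / C would differ from f at x₀ by less than ‖f x₀‖, although it
    -- vanishes there.
    obtain ⟨v, ⟨hv, g, hg, hg0⟩, hlt⟩ := h (‖f x₀‖ₑ / C) (ENNReal.div_pos (by simpa using hne) hC)
    have h1 := hle (u - v) _ (hlt.trans_le le_top) (hf.sub hg) x₀
    rw [hg0, sub_zero] at h1
    have h2 := ENNReal.mul_lt_mul_right hC0 hC hlt
    rw [ENNReal.mul_div_cancel hC0 hC] at h2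
    exact absurd h1 (not_le.2 h2)

/-- A zero at x confines the generated ideal to the functions vanishing at x, and a bump centred at
x is not among them. -/
theorem ne_zero_of_closedIdealGenerated_eq (hφ : φ ≠ 0) (hp : 1 ≤ p) (hpt : p ≠ ∞) (hs : 0 ≤ s)
    (hu : u ∈ modulationSpace p s φ) (hf : IsGivenBy u f)
    (h : (closedIdealGenerated p s φ u : Set 𝓢'(EuclideanSpace ℝ (Fin n), ℂ)) =
      modulationSpace p s φ) (x : EuclideanSpace ℝ (Fin n)) : f x ≠ 0 := by
  intro hx
  let b : ContDiffBump x := default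
  obtain ⟨w, hw, hwb⟩ := exists_mem_isGivenBy_of_hasCompactSupport hp hpt hs φ
    (f := fun t => (b t : ℂ)) (b.hasCompactSupport.comp_left Complex.ofReal_zero)
    (Complex.ofRealCLM.contDiff.comp b.contDiff)
  have hw' : w ∈ closedIdealGenerated p s φ u := by
    rw [← SetLike.mem_coe, h]; exact hw
  obtain ⟨-, g, hg, hg0⟩ := Submodule.mem_sInf.1 hw' _
    ⟨isClosedIdeal_vanishingIdeal hφ hp hpt hs x, hu, f, hf, hx⟩
  rw [hg.unique hwb] at hg0
  simp [b.one_of_mem_closedBall (Metric.mem_closedBall_self b.rIn_pos.le)] at hg0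

end Ideals

/-! ### Fourier densities and their dilations -/

section Fourier

open scoped FourierTransform
open Filter Topology

variable {n : ℕ}

/-- The function `m` such that `f t = ∫ m(τ) exp (i τ·t) dτ`. -/
noncomputable def fourierDensity (f : EuclideanSpace ℝ (Fin n) → ℂ)
    (τ : EuclideanSpace ℝ (Fin n)) : ℂ :=
  ((2 * Real.pi : ℂ) ^ n)⁻¹ * ∫ t, f t * character τ t

theorem fourierDensity_eq (f : EuclideanSpace ℝ (Fin n) → ℂ) (τ : EuclideanSpace ℝ (Fin n)) :
    fourierDensity f τ = ((2 * Real.pi : ℂ) ^ n)⁻¹ * 𝓕 f ((2 * Real.pi)⁻¹ • τ) := by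
  rw [fourierDensity, Real.fourier_eq']
  congr 1
  refine integral_congr_ae (Eventually.of_forall fun t => ?_)
  simp only [character, inner_smul_right, smul_eq_mul]
  rw [mul_comm]
  congr 2
  push_cast
  have := Real.pi_ne_zero
  field_simp

theorem integral_fourierDensity {f : EuclideanSpace ℝ (Fin n) → ℂ} (hf : Continuous f)
    (hi : Integrable f) (hm : Integrable (fourierDensity f)) (t : EuclideanSpace ℝ (Fin n)) :
    ∫ τ, fourierDensity f τ * character (-τ) t = f t := by
  have hpi : (0 : ℝ) < 2 * Real.pi := by positivity
  have hpi' : ((2 * Real.pi : ℂ) ^ n) ≠ 0 := by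
    refine pow_ne_zero _ ?_
    exact_mod_cast hpi.ne'
  have hF : Integrable (𝓕 f) := by
    have h1 : Integrable fun τ => (2 * Real.pi : ℂ) ^ n * fourierDensity f ((2 * Real.pi) • τ) :=
      (hm.comp_smul hpi.ne').const_mul _
    refine h1.congr (Eventually.of_forall fun τ => ?_)
    simp only [fourierDensity_eq]
    rw [smul_smul, inv_mul_cancel₀ hpi.ne', one_smul, mul_inv_cancel_left₀ hpi']
  have h := congrFun (hf.fourierInv_fourier_eq hi hF) t
  rw [Real.fourierInv_eq'] at h
  rw [← h]
  have h2 := Measure.integral_comp_inv_smul_of_nonneg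
    (μ := (volume : Measure (EuclideanSpace ℝ (Fin n))))
    (fun v => Complex.exp (↑(2 * Real.pi * inner ℝ v t) * Complex.I) • 𝓕 f v) hpi.le
  rw [finrank_euclideanSpace_fin] at h2
  calc _ = ((2 * Real.pi : ℂ) ^ n)⁻¹ * ∫ τ, Complex.exp (↑(2 * Real.pi *
        inner ℝ ((2 * Real.pi)⁻¹ • τ) t) * Complex.I) • 𝓕 f ((2 * Real.pi)⁻¹ • τ) := by
        rw [← integral_const_mul]
        refine integral_congr_ae (Eventually.of_forall fun τ => ?_)
        simp only [fourierDensity_eq, character, real_inner_smul_left, smul_eq_mul,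
          inner_neg_right]
        rw [mul_assoc, mul_comm (𝓕 f _), mul_inv_cancel_left₀ hpi.ne', real_inner_comm]
        congr 3
        push_cast; ring
    _ = _ := by
        rw [h2, Complex.real_smul]
        push_cast
        rw [inv_mul_cancel_left₀ hpi']

theorem exists_schwartz_eq_fourierDensity (χ : 𝓢(EuclideanSpace ℝ (Fin n), ℂ)) :
    ∃ m : 𝓢(EuclideanSpace ℝ (Fin n), ℂ), ∀ t, χ t = ∫ τ, m τ * character (-τ) t := by
  have hpi : (2 * Real.pi)⁻¹ ≠ 0 := by positivity
  let m : 𝓢(EuclideanSpace ℝ (Fin n), ℂ) := ((2 * Real.pi : ℂ) ^ n)⁻¹ •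
    SchwartzMap.compCLMOfContinuousLinearEquiv ℂ
      (ContinuousLinearEquiv.smulLeft (R₁ := ℝ) (M₁ := EuclideanSpace ℝ (Fin n)) (Units.mk0 _ hpi)) (𝓕 χ)
  have hm : ∀ τ, m τ = fourierDensity χ τ := fun τ => by
    rw [fourierDensity_eq]; rfl
  refine ⟨m, fun t => ?_⟩
  have he : fourierDensity χ = m := funext fun τ => (hm τ).symm
  rw [← integral_fourierDensity χ.continuous χ.integrable (he ▸ m.integrable) t, he]

/-- The dilation `τ ↦ r⁻ⁿ m(τ / r)`, which preserves the integral. -/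
noncomputable def dilate (r : ℝ) (m : EuclideanSpace ℝ (Fin n) → ℂ)
    (τ : EuclideanSpace ℝ (Fin n)) : ℂ := ((r⁻¹ ^ n : ℝ) : ℂ) * m (r⁻¹ • τ)

theorem integral_dilate {r : ℝ} (hr : 0 < r) (m g : EuclideanSpace ℝ (Fin n) → ℂ) :
    ∫ τ, dilate r m τ * g τ = ∫ τ, m τ * g (r • τ) := by
  have h := Measure.integral_comp_inv_smul_of_nonneg
    (μ := (volume : Measure (EuclideanSpace ℝ (Fin n)))) (fun τ => m τ * g (r • τ)) hr.le
  rw [finrank_euclideanSpace_fin] at h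
  have hr' : (r : ℂ) ^ n ≠ 0 := pow_ne_zero _ (by exact_mod_cast hr.ne')
  have h1 : ∫ τ, dilate r m τ * g τ = ((r⁻¹ ^ n : ℝ) : ℂ) * ∫ τ, m (r⁻¹ • τ) * g (r • r⁻¹ • τ) := by
    rw [← integral_const_mul]
    refine integral_congr_ae (Eventually.of_forall fun τ => ?_)
    simp only [dilate, smul_smul, mul_inv_cancel₀ hr.ne', one_smul, mul_assoc]
  rw [h1, h, Complex.real_smul]
  push_cast
  rw [inv_pow, inv_mul_cancel_left₀ hr']

/-- Dilating the density replaces the function by its composition with t ↦ r t. Small r gives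
cutoffs spreading over the whole space, large r gives bumps shrinking to a point; both regimes are
used. -/
theorem integral_dilate_mul_character {r : ℝ} (hr : 0 < r) (m : EuclideanSpace ℝ (Fin n) → ℂ)
    (t : EuclideanSpace ℝ (Fin n)) :
    ∫ τ, dilate r m τ * character (-τ) t = ∫ τ, m τ * character (-τ) (r • t) := by
  rw [integral_dilate hr]
  simp only [character, inner_neg_right, real_inner_smul_left, inner_smul_right]

theorem lintegral_comp_inv_smul {r : ℝ} (hr : 0 < r) (F : EuclideanSpace ℝ (Fin n) → ℝ≥0∞) :
    ENNReal.ofReal (r⁻¹ ^ n) * ∫⁻ τ, F (r⁻¹ • τ) = ∫⁻ τ, F τ := by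
  have hr' : r⁻¹ ≠ 0 := by positivity
  have h := (Homeomorph.smul (Units.mk0 _ hr') : EuclideanSpace ℝ (Fin n) ≃ₜ _).measurableEmbedding.lintegral_map
    (μ := volume) F
  have h2 : Measure.map (Homeomorph.smul (Units.mk0 _ hr') : EuclideanSpace ℝ (Fin n) ≃ₜ _) volume =
      ENNReal.ofReal (r ^ n) • volume := by
    have := Measure.map_addHaar_smul (volume : Measure (EuclideanSpace ℝ (Fin n))) hr'
    rw [finrank_euclideanSpace_fin, inv_pow, inv_inv, abs_of_pos (by positivity)] at this
    exact this
  rw [h2, lintegral_smul_measure] at h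
  have h3 : ∫⁻ τ, F (r⁻¹ • τ) = ENNReal.ofReal (r ^ n) * ∫⁻ τ, F τ := h.symm
  rw [h3, ← mul_assoc, ← ENNReal.ofReal_mul (by positivity), ← mul_pow, inv_mul_cancel₀ hr.ne']
  simp

theorem lintegral_enorm_dilate {r : ℝ} (hr : 0 < r) (m : EuclideanSpace ℝ (Fin n) → ℂ)
    {g : EuclideanSpace ℝ (Fin n) → ℝ≥0∞} :
    ∫⁻ τ, ‖dilate r m τ‖ₑ * g τ = ∫⁻ τ, ‖m τ‖ₑ * g (r • τ) := by
  rw [← lintegral_comp_inv_smul hr fun τ => ‖m τ‖ₑ * g (r • τ), ← lintegral_const_mul' _ _ ENNReal.ofReal_ne_top]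
  refine lintegral_congr fun τ => ?_
  rw [dilate, enorm_mul, smul_smul, mul_inv_cancel₀ hr.ne', one_smul, mul_assoc, ← ofReal_norm,
    Complex.norm_real, Real.norm_of_nonneg (by positivity)]

theorem lintegral_pow_mul_enorm_ne_top (m : 𝓢(EuclideanSpace ℝ (Fin n), ℂ)) (N : ℕ) :
    ∫⁻ τ, ‖m τ‖ₑ * ENNReal.ofReal ((1 + ‖τ‖) ^ N) ≠ ∞ := by
  have hle : ∀ τ, ‖m τ‖ₑ * ENNReal.ofReal ((1 + ‖τ‖) ^ N) ≤
      ENNReal.ofReal (2 ^ (N + (n + 1)) * schwartzBound (N + (n + 1)) m) * decay (n + 1) τ := fun τ => by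
    have h := pow_mul_norm_le (N + (n + 1)) m τ
    rw [← ofReal_norm, decay, ← ENNReal.ofReal_mul (norm_nonneg _), ← ENNReal.ofReal_mul (by positivity)]
    refine ENNReal.ofReal_le_ofReal ?_
    rw [← div_eq_mul_inv, le_div_iff₀ (by positivity), mul_assoc, ← pow_add, mul_comm]
    exact h
  refine ne_top_of_le_ne_top ?_ (lintegral_mono hle)
  rw [lintegral_const_mul _ (measurable_decay _)]
  exact ENNReal.mul_ne_top ENNReal.ofReal_ne_top (lintegral_decay_ne_top (Nat.lt_succ_self n))

/-- Continuity of translation in L¹, read off from its continuity in a Schwartz norm with an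
integrable weight. -/
theorem tendsto_lintegral_enorm_translate_sub (m : 𝓢(EuclideanSpace ℝ (Fin n), ℂ)) :
    Tendsto (fun h : EuclideanSpace ℝ (Fin n) => ∫⁻ τ, ‖m (τ - h) - m τ‖ₑ) (𝓝 0) (𝓝 0) := by
  have hD := lintegral_decay_ne_top (Nat.lt_succ_self n)
  set D := ∫⁻ x : EuclideanSpace ℝ (Fin n), decay (n + 1) x with hDdef
  have hle : ∀ h : EuclideanSpace ℝ (Fin n), ∫⁻ τ, ‖m (τ - h) - m τ‖ₑ ≤
      ENNReal.ofReal (2 ^ (n + 1) * schwartzBound (n + 1)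
        (SchwartzMap.compSubConstCLM ℝ h m - m)) * D := fun h => by
    rw [hDdef, ← lintegral_const_mul _ (measurable_decay _)]
    exact lintegral_mono fun τ => enorm_le_decay_of_norm_mul_le
      (pow_mul_norm_le (n + 1) (SchwartzMap.compSubConstCLM ℝ h m - m) τ)
  refine tendsto_of_tendsto_of_tendsto_of_le_of_le tendsto_const_nhds ?_ (fun _ => zero_le) hle
  have h0 : SchwartzMap.compSubConstCLM ℝ (0 : EuclideanSpace ℝ (Fin n)) m - m = 0 := by
    ext t; simp
  have hcont : Continuous fun h : EuclideanSpace ℝ (Fin n) =>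
      ENNReal.ofReal (2 ^ (n + 1) * schwartzBound (n + 1)
        (SchwartzMap.compSubConstCLM ℝ h m - m)) * D :=
    (ENNReal.continuous_mul_const hD).comp (ENNReal.continuous_ofReal.comp
      (continuous_const.mul ((continuous_schwartzBound _).comp
        ((continuous_translate.comp (continuous_id.prodMk continuous_const)).sub continuous_const))))
  have := hcont.tendsto 0
  simpa [h0] using this

end Fourier

/-! ### Approximation by cutoffs -/

section Density

open Filter Topology

variable {n : ℕ} {p : ℝ≥0∞} {s : ℝ} {φ : 𝓢(EuclideanSpace ℝ (Fin n), ℂ)}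
  {u w : 𝓢'(EuclideanSpace ℝ (Fin n), ℂ)} {f : EuclideanSpace ℝ (Fin n) → ℂ}

theorem integrable_dilate {r : ℝ} (hr : 0 < r) (m : 𝓢(EuclideanSpace ℝ (Fin n), ℂ)) :
    Integrable (dilate r m) :=
  (m.integrable.comp_smul (inv_ne_zero hr.ne')).const_mul _

theorem continuous_dilate (r : ℝ) (m : 𝓢(EuclideanSpace ℝ (Fin n), ℂ)) :
    Continuous (dilate r m) :=
  continuous_const.mul (m.continuous.comp (continuous_const_smul _))

theorem tendsto_eLpNorm_zero_of_dominated {X : Type*} [MeasurableSpace X] {μ : Measure X}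
    (hp : 1 ≤ p) (hpt : p ≠ ∞) {F : ℕ → X → ℝ≥0∞} {G : X → ℝ≥0∞} (hF : ∀ k, Measurable (F k))
    (hle : ∀ k x, F k x ≤ G x) (hG : eLpNorm G p μ ≠ ∞)
    (hlim : ∀ x, Tendsto (fun k => F k x) atTop (𝓝 0)) :
    Tendsto (fun k => eLpNorm (F k) p μ) atTop (𝓝 0) := by
  have hp0 : p ≠ 0 := (zero_lt_one.trans_le hp).ne'
  have hq : 0 < p.toReal := ENNReal.toReal_pos hp0 hpt
  simp only [eLpNorm_eq_lintegral_rpow_enorm_toReal hp0 hpt, enorm_eq_self] at hG ⊢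
  have hG' : ∫⁻ x, G x ^ p.toReal ∂μ ≠ ∞ := fun h => hG (by
    rw [h]; exact ENNReal.top_rpow_of_pos (by positivity))
  have h0 := tendsto_lintegral_of_dominated_convergence (μ := μ) (F := fun k x => F k x ^ p.toReal)
    (f := fun _ => 0) (fun x => G x ^ p.toReal) (fun k => (hF k).pow_const _)
    (fun k => Eventually.of_forall fun x => ENNReal.rpow_le_rpow (hle k x) hq.le) hG'
    (Eventually.of_forall fun x => by
      simpa [hq] using (hlim x).ennrpow_const p.toReal)
  rw [lintegral_zero] at h0
  have := h0.ennrpow_const (1 / p.toReal)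
  rwa [ENNReal.zero_rpow_of_pos (by positivity)] at this

/-- The transform of u itself has no control under frequency shifts, but its smeared majorant does,
thanks to the polynomial kernel. -/
theorem smear_sub_le (N : ℕ) (F : EuclideanSpace ℝ (Fin n) → EuclideanSpace ℝ (Fin n) → ℝ≥0∞)
    (z ζ y : EuclideanSpace ℝ (Fin n)) :
    smear N (decay N) F z (ζ - y) ≤ ENNReal.ofReal ((1 + ‖y‖) ^ N) * smear N (decay N) F z ζ := by
  rw [smear, smear, ← lintegral_const_mul' _ _ ENNReal.ofReal_ne_top]
  refine lintegral_mono fun η => ?_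
  rw [← lintegral_const_mul' _ _ ENNReal.ofReal_ne_top]
  refine lintegral_mono fun x => ?_
  calc F x η * (decay N (z - x) * decay N (ζ - y - η))
      ≤ F x η * (decay N (z - x) * (ENNReal.ofReal ((1 + ‖y‖) ^ N) * decay N (ζ - η))) := by
        rw [sub_right_comm]
        gcongr _ * (_ * ?_)
        exact decay_sub_le N _ _
    _ = _ := by ring

/-- The short-time Fourier transform of the truncations of `u` is dominated uniformly. -/
theorem exists_enorm_stft_cutoff_le (hφ : φ ≠ 0) (N : ℕ) (χ : 𝓢(EuclideanSpace ℝ (Fin n), ℂ)) :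
    ∃ C : ℝ≥0∞, C ≠ ∞ ∧ ∀ (u w : 𝓢'(EuclideanSpace ℝ (Fin n), ℂ)) (f) (r : ℝ), 0 < r → r ≤ 1 →
      IsGivenBy u f → IsGivenBy w (fun t => χ (r • t) * f t) → ∀ z ζ,
      ‖stft φ (u - w) z ζ‖ₑ ≤ C * smear N (decay N) (fun x ξ => ‖stft φ u x ξ‖ₑ) z ζ := by
  obtain ⟨K, C, hC, hle⟩ := exists_enorm_stft_le hφ N
  obtain ⟨m, hm⟩ := exists_schwartz_eq_fourierDensity χ
  set C₀ := ENNReal.ofReal (C * schwartzBound K φ)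
  set I := ∫⁻ τ, ‖m τ‖ₑ * ENNReal.ofReal ((1 + ‖τ‖) ^ N) with hI
  have hIt : I ≠ ∞ := lintegral_pow_mul_enorm_ne_top m N
  refine ⟨C₀ + C₀ * I, ENNReal.add_ne_top.2 ⟨ENNReal.ofReal_ne_top,
    ENNReal.mul_ne_top ENNReal.ofReal_ne_top hIt⟩, fun u w f r hr hr1 hf hw z ζ => ?_⟩
  set S := smear N (decay N) (fun x ξ => ‖stft φ u x ξ‖ₑ) with hS
  have e : (fun t => χ (r • t) * f t) =
      fun t => (∫ τ, dilate r m τ * character (-τ) (t - 0)) * f t := by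
    funext t
    rw [sub_zero, integral_dilate_mul_character hr, hm]
  -- Multiplication by χ(r·) averages frequency shifts by r τ. As r ≤ 1 each costs at most (1 +
  -- ‖τ‖)^N, which the density m integrates independently of r.
  have h1 : ‖stft φ w z ζ‖ₑ ≤ C₀ * I * S z ζ := by
    calc ‖stft φ w z ζ‖ₑ ≤ ∫⁻ τ, ‖dilate r m τ‖ₑ * ‖stft φ u z (ζ - τ)‖ₑ :=
          enorm_stft_le_of_fourier_mul (integrable_dilate hr m) 0 hf (e ▸ hw) z ζ
      _ = ∫⁻ τ, ‖m τ‖ₑ * ‖stft φ u z (ζ - r • τ)‖ₑ :=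
          lintegral_enorm_dilate hr m (g := fun τ => ‖stft φ u z (ζ - τ)‖ₑ)
      _ ≤ ∫⁻ τ, (‖m τ‖ₑ * ENNReal.ofReal ((1 + ‖τ‖) ^ N)) * (C₀ * S z ζ) := by
          refine lintegral_mono fun τ => ?_
          rw [mul_assoc]
          refine mul_le_mul_right ((hle u φ z _).trans ?_) _
          refine (mul_le_mul_right (smear_sub_le N _ z ζ (r • τ)) _).trans ?_
          rw [mul_left_comm]
          gcongr
          rw [norm_smul, Real.norm_of_nonneg hr.le]
          exact mul_le_of_le_one_left (norm_nonneg _) hr1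
      _ = C₀ * I * S z ζ := by
          rw [lintegral_mul_const _ (by
            have := m.continuous
            fun_prop), ← hI]
          ring
  calc ‖stft φ (u - w) z ζ‖ₑ = ‖stft φ u z ζ - stft φ w z ζ‖ₑ := rfl
    _ ≤ ‖stft φ u z ζ‖ₑ + ‖stft φ w z ζ‖ₑ := enorm_sub_le
    _ ≤ C₀ * S z ζ + C₀ * I * S z ζ := add_le_add (hle u φ z ζ) h1
    _ = _ := by ring

theorem tendsto_stft_cutoff (χ : 𝓢(EuclideanSpace ℝ (Fin n), ℂ)) (hχ : χ 0 = 1)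
    (hf : IsGivenBy u f) {r : ℕ → ℝ} (hr : Tendsto r atTop (𝓝 0))
    {w : ℕ → 𝓢'(EuclideanSpace ℝ (Fin n), ℂ)}
    (hw : ∀ k, IsGivenBy (w k) (fun t => χ (r k • t) * f t)) (z ζ : EuclideanSpace ℝ (Fin n)) :
    Tendsto (fun k => ‖stft φ (u - w k) z ζ‖ₑ) atTop (𝓝 0) := by
  obtain ⟨B, hB⟩ : ∃ B, ∀ t, ‖χ t‖ ≤ B := ⟨_, fun t => χ.norm_le_seminorm ℝ t⟩
  have hi := hf.integrable (conjShift φ z ζ)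
  have h : Tendsto (fun k => ∫ t, χ (r k • t) * (f t * conjShift φ z ζ t)) atTop
      (𝓝 (∫ t, f t * conjShift φ z ζ t)) := by
    refine tendsto_integral_of_dominated_convergence
      (fun t => B * ‖f t * conjShift φ z ζ t‖) (fun k => ?_) (hi.norm.const_mul B)
      (fun k => Eventually.of_forall fun t => ?_) (Eventually.of_forall fun t => ?_)
    · exact ((χ.continuous.comp (continuous_const_smul _)).aestronglyMeasurable).mul
        hi.aestronglyMeasurable
    · rw [norm_mul]
      gcongr
      exact hB _
    · have h1 : Tendsto (fun k => χ (r k • t)) atTop (𝓝 (χ ((0 : ℝ) • t))) :=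
        (χ.continuous.tendsto _).comp (hr.smul_const t)
      rw [zero_smul, hχ] at h1
      simpa using h1.mul_const (f t * conjShift φ z ζ t)
  have h2 : ∀ k, stft φ (u - w k) z ζ = (∫ t, f t * conjShift φ z ζ t) -
      ∫ t, χ (r k • t) * (f t * conjShift φ z ζ t) := fun k => by
    simp only [← mul_assoc]
    rw [← hf.stft_eq, ← (hw k).stft_eq]
    rfl
  have h3 := ((tendsto_const_nhds (x := ∫ t, f t * conjShift φ z ζ t)).sub h).enorm
  simp only [h2]
  simpa using h3

/-- Dominated convergence twice: in position at fixed frequency, with the smeared transform of u as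
majorant in Lᵖ, and then in frequency, with its slice norms as majorant in weighted L¹. -/
theorem tendsto_modNorm_cutoff (hφ : φ ≠ 0) (hp : 1 ≤ p) (hpt : p ≠ ∞) (hs : 0 ≤ s)
    (χ : 𝓢(EuclideanSpace ℝ (Fin n), ℂ)) (hχ : χ 0 = 1)
    (hu : u ∈ modulationSpace p s φ) (hf : IsGivenBy u f) {r : ℕ → ℝ} (hr : Tendsto r atTop (𝓝 0))
    (hr0 : ∀ k, 0 < r k) (hr1 : ∀ k, r k ≤ 1)
    {w : ℕ → 𝓢'(EuclideanSpace ℝ (Fin n), ℂ)}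
    (hw : ∀ k, IsGivenBy (w k) (fun t => χ (r k • t) * f t)) :
    Tendsto (fun k => modNorm p s φ (u - w k)) atTop (𝓝 0) := by
  obtain ⟨N, hN⟩ : ∃ N : ℕ, (n : ℝ) + s < N := exists_nat_gt _
  have hN' : n < N := by
    have : (n : ℝ) < N := by linarith
    exact_mod_cast this
  obtain ⟨C, hC, hle⟩ := exists_enorm_stft_cutoff_le hφ N χ
  have hD := lintegral_decay_ne_top hN'
  have hVm := measurable_enorm_stft φ u
  have hsl := measurable_slice (φ := φ) hp hpt u
  have hsm := measurable_smear hVm (measurable_decay N) N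
  set G : EuclideanSpace ℝ (Fin n) → EuclideanSpace ℝ (Fin n) → ℝ≥0∞ := fun ζ z =>
    C * smear N (decay N) (fun x ξ => ‖stft φ u x ξ‖ₑ) z ζ with hGdef
  set B : EuclideanSpace ℝ (Fin n) → ℝ≥0∞ := fun ζ => C *
    ((∫⁻ x : EuclideanSpace ℝ (Fin n), decay N x) * ∫⁻ η, slice p φ u η * decay N (ζ - η)) with hBdef
  have hGB : ∀ ζ, eLpNorm (G ζ) p volume ≤ B ζ := fun ζ => by
    rw [hGdef, eLpNorm_ennreal_const_mul hsm.of_uncurry_right _ hp hpt]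
    exact mul_le_mul_right (eLpNorm_smear_le hVm (measurable_decay N) N hp hpt ζ) _
  have hBm : Measurable B := by
    refine Measurable.const_mul (Measurable.const_mul ?_ _) _
    refine Measurable.lintegral_prod_right ?_
    unfold Function.uncurry
    fun_prop
  have hWB : ∫⁻ ζ, weight 1 s ζ * B ζ ≠ ∞ := by
    have e : ∀ ζ, weight 1 s ζ * B ζ = (C * ∫⁻ x : EuclideanSpace ℝ (Fin n), decay N x) *
        (weight 1 s ζ * ∫⁻ η, slice p φ u η * decay N (ζ - η)) := fun ζ => by
      simp only [hBdef]; ring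
    simp only [e]
    rw [lintegral_const_mul' _ _ (ENNReal.mul_ne_top hC hD)]
    refine ENNReal.mul_ne_top (ENNReal.mul_ne_top hC hD) (ne_top_of_le_ne_top ?_
      (lintegral_weight_mul_conv_le zero_le_one hs hsl (measurable_decay N)))
    exact ENNReal.mul_ne_top (lintegral_weight_mul_slice_ne_top hp hpt hs hu)
      (lintegral_weight_mul_decay_ne_top hN)
  have hslice : ∀ k ζ, slice p φ (u - w k) ζ ≤ eLpNorm (G ζ) p volume := fun k ζ =>
    eLpNorm_mono_enorm fun z => by
      simpa using hle u (w k) f (r k) (hr0 k) (hr1 k) hf (hw k) z ζ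
  simp only [modNorm_eq]
  rw [← lintegral_zero (α := EuclideanSpace ℝ (Fin n)) (μ := volume)]
  refine tendsto_lintegral_of_dominated_convergence (fun ζ => weight 1 s ζ * B ζ) (fun k => ?_)
    (fun k => Eventually.of_forall fun ζ => ?_) hWB ?_
  · have := measurable_slice (φ := φ) hp hpt (u - w k)
    fun_prop
  · exact mul_le_mul' (bracket_le_weight hs ζ) ((hslice k ζ).trans (hGB ζ))
  -- The Lᵖ majorant is usable only where B is finite; that holds almost everywhere, the weight
  -- being at least 1.
  · filter_upwards [ae_lt_top ((measurable_weight 1 s).mul hBm) hWB] with ζ hζ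
    have hBt : B ζ ≠ ∞ := fun h => by
      refine hζ.ne ?_
      change weight 1 s ζ * B ζ = ∞
      rw [h, ENNReal.mul_top (zero_lt_one.trans_le (one_le_weight zero_le_one hs ζ)).ne']
    have h1 : Tendsto (fun k => slice p φ (u - w k) ζ) atTop (𝓝 0) :=
      tendsto_eLpNorm_zero_of_dominated hp hpt
        (fun k => (measurable_enorm_stft φ (u - w k)).of_uncurry_right)
        (fun k z => hle u (w k) f (r k) (hr0 k) (hr1 k) hf (hw k) z ζ)
        (ne_top_of_le_ne_top hBt (hGB ζ)) fun z => tendsto_stft_cutoff χ hχ hf hr hw z ζ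
    simpa using ENNReal.Tendsto.const_mul h1 (Or.inr ENNReal.ofReal_ne_top)

end Density

/-! ### Local Fourier densities -/

section LocalDensity

open Filter Topology

variable {n : ℕ} {p : ℝ≥0∞} {s : ℝ} {φ : 𝓢(EuclideanSpace ℝ (Fin n), ℂ)}
  {u w : 𝓢'(EuclideanSpace ℝ (Fin n), ℂ)} {f : EuclideanSpace ℝ (Fin n) → ℂ}

theorem character_zero_right (ξ : EuclideanSpace ℝ (Fin n)) : character ξ 0 = 1 := by
  simp [character]

theorem integrable_of_lintegral_weight (hs : 0 ≤ s) {m : EuclideanSpace ℝ (Fin n) → ℂ}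
    (hm : Measurable m) (h : ∫⁻ τ, weight 1 s τ * ‖m τ‖ₑ ≠ ∞) : Integrable m := by
  refine ⟨hm.aestronglyMeasurable, lt_of_le_of_lt (lintegral_mono fun τ => ?_) h.lt_top⟩
  exact le_mul_of_one_le_left zero_le (one_le_weight zero_le_one hs τ)

/-- The Fourier transform of a localised function is a short-time Fourier transform at frozen
position, with the localiser as window. -/
theorem fourierDensity_translate_mul (hf : IsGivenBy u f) (χ : 𝓢(EuclideanSpace ℝ (Fin n), ℂ))
    (x₀ ω : EuclideanSpace ℝ (Fin n)) :
    fourierDensity (fun y => f (y + x₀) * χ y) ω =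
      ((2 * Real.pi : ℂ) ^ n)⁻¹ * (character ω (-x₀) * stft (schwartzConj χ) u x₀ ω) := by
  rw [fourierDensity, hf.stft_eq]
  congr 1
  rw [← integral_const_mul, ← integral_add_right_eq_self
    (fun t => character ω (-x₀) * (f t * conjShift (schwartzConj χ) x₀ ω t)) x₀]
  refine integral_congr_ae (Eventually.of_forall fun y => ?_)
  simp only [conjShift_apply', schwartzConj_apply, Complex.conj_conj, add_sub_cancel_right,
    character_add_right]
  have h : character ω (-x₀) * character ω x₀ = 1 := by
    rw [← character_add_right, neg_add_cancel, character_zero_right]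
  linear_combination (-(f (y + x₀) * χ y * character ω y)) * h

theorem continuous_stft_right (φ : 𝓢(EuclideanSpace ℝ (Fin n), ℂ))
    (u : 𝓢'(EuclideanSpace ℝ (Fin n), ℂ)) (x : EuclideanSpace ℝ (Fin n)) :
    Continuous fun ξ => stft φ u x ξ := by
  have h := (continuous_stft φ u).comp (Continuous.prodMk_right x)
  exact h

/-- Localised elements of the modulation space have a weighted integrable Fourier transform. -/
theorem exists_density_of_mem (hφ : φ ≠ 0) (hp : 1 ≤ p) (hpt : p ≠ ∞) (hs : 0 ≤ s)
    (hu : u ∈ modulationSpace p s φ) (hf : IsGivenBy u f) (χ : 𝓢(EuclideanSpace ℝ (Fin n), ℂ))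
    (x₀ : EuclideanSpace ℝ (Fin n)) :
    ∃ m : EuclideanSpace ℝ (Fin n) → ℂ, Continuous m ∧ ∫⁻ ω, weight 1 s ω * ‖m ω‖ₑ ≠ ∞ ∧
      ∀ y, ∫ ω, m ω * character (-ω) y = f (y + x₀) * χ y := by
  obtain ⟨N, hN⟩ : ∃ N : ℕ, (n : ℝ) + s < N := exists_nat_gt _
  have hN' : n < N := by
    have : (n : ℝ) < N := by linarith
    exact_mod_cast this
  obtain ⟨K, C, hC, hle⟩ := exists_enorm_stft_le hφ N
  have hVm := measurable_enorm_stft φ u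
  have hsl := measurable_slice (φ := φ) hp hpt u
  have hD := lintegral_decay_ne_top hN'
  obtain ⟨m, hm⟩ : ∃ m, m = fourierDensity fun y => f (y + x₀) * χ y := ⟨_, rfl⟩
  have hmeq : m = fun ω => ((2 * Real.pi : ℂ) ^ n)⁻¹ *
      (character ω (-x₀) * stft (schwartzConj χ) u x₀ ω) :=
    hm.trans (funext (fourierDensity_translate_mul hf χ x₀))
  have hmc : Continuous m := by
    rw [hmeq]
    have h1 := continuous_stft_right (schwartzConj χ) u x₀
    have h2 : Continuous fun ω : EuclideanSpace ℝ (Fin n) => character ω (-x₀) := by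
      unfold character; fun_prop
    exact continuous_const.mul (h2.mul h1)
  set D : ℝ≥0∞ := ‖((2 * Real.pi : ℂ) ^ n)⁻¹‖ₑ * (ENNReal.ofReal (C * schwartzBound K (schwartzConj χ)) *
    (1 + ∫⁻ x : EuclideanSpace ℝ (Fin n), decay N x)) with hDdef
  have hDt : D ≠ ∞ := ENNReal.mul_ne_top enorm_ne_top
    (ENNReal.mul_ne_top ENNReal.ofReal_ne_top (by simpa using hD))
  -- At the frozen position x₀ the supremum bound `smear_le` leaves a convolution of slice norms,
  -- which is in weighted L¹.
  have hml : ∀ ω, ‖m ω‖ₑ ≤ D * ∫⁻ η, slice p φ u η * decay N (ω - η) := fun ω => by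
    rw [hmeq, enorm_mul, enorm_mul, ← ofReal_norm (character _ _), norm_character,
      ENNReal.ofReal_one, one_mul, hDdef, mul_assoc, mul_assoc]
    refine mul_le_mul_right ((hle u _ x₀ ω).trans (mul_le_mul_right ?_ _)) _
    exact smear_le hVm (measurable_decay N) N hp hpt x₀ ω
  have hmw : ∫⁻ ω, weight 1 s ω * ‖m ω‖ₑ ≠ ∞ := by
    refine ne_top_of_le_ne_top ?_ (lintegral_mono fun ω => mul_le_mul_right (hml ω) _)
    simp only [mul_left_comm _ D]
    rw [lintegral_const_mul' _ _ hDt]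
    refine ENNReal.mul_ne_top hDt (ne_top_of_le_ne_top ?_
      (lintegral_weight_mul_conv_le zero_le_one hs hsl (measurable_decay N)))
    exact ENNReal.mul_ne_top (lintegral_weight_mul_slice_ne_top hp hpt hs hu)
      (lintegral_weight_mul_decay_ne_top hN)
  refine ⟨m, hmc, hmw, fun y => ?_⟩
  have hmi := integrable_of_lintegral_weight hs hmc.measurable hmw
  rw [hm] at hmi ⊢
  refine integral_fourierDensity (f := fun y => f (y + x₀) * χ y)
    ((hf.continuous.comp (continuous_add_const x₀)).mul χ.continuous) ?_ hmi y
  have := (hf.integrable (SchwartzMap.compSubConstCLM ℝ x₀ χ)).comp_add_right x₀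
  simpa using this

/-- The density `∫ m(ω) (k(τ - ω) - k(τ)) dω` of the product of `y ↦ ∫ m(ω) (exp (i ω·y) - 1) dω`
with the function of density `k`. -/
noncomputable def differenceDensity (m k : EuclideanSpace ℝ (Fin n) → ℂ)
    (τ : EuclideanSpace ℝ (Fin n)) : ℂ := ∫ ω, m ω * (k (τ - ω) - k τ)

variable {m k : EuclideanSpace ℝ (Fin n) → ℂ}

theorem measurable_differenceDensity (hm : Continuous m) (hk : Continuous k) :
    Measurable (differenceDensity m k) := by
  have : Continuous fun q : EuclideanSpace ℝ (Fin n) × EuclideanSpace ℝ (Fin n) =>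
      m q.2 * (k (q.1 - q.2) - k q.1) :=
    (hm.comp continuous_snd).mul ((hk.comp (continuous_fst.sub continuous_snd)).sub
      (hk.comp continuous_fst))
  exact (StronglyMeasurable.integral_prod_right (f := fun τ ω => m ω * (k (τ - ω) - k τ))
    this.stronglyMeasurable).measurable

theorem lintegral_mul_enorm_differenceDensity_le (hm : Continuous m) (hk : Continuous k)
    {W : EuclideanSpace ℝ (Fin n) → ℝ≥0∞} (hW : Measurable W) :
    ∫⁻ τ, W τ * ‖differenceDensity m k τ‖ₑ ≤
      ∫⁻ ω, ‖m ω‖ₑ * ∫⁻ τ, W τ * ‖k (τ - ω) - k τ‖ₑ := by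
  have hc : Continuous fun q : EuclideanSpace ℝ (Fin n) × EuclideanSpace ℝ (Fin n) =>
      ‖k (q.1 - q.2) - k q.1‖ₑ :=
    ((hk.comp (continuous_fst.sub continuous_snd)).sub (hk.comp continuous_fst)).enorm
  have hms : ∀ τ, Measurable fun ω => ‖m ω‖ₑ * ‖k (τ - ω) - k τ‖ₑ := fun τ => by
    fun_prop
  calc ∫⁻ τ, W τ * ‖differenceDensity m k τ‖ₑ
      ≤ ∫⁻ τ, ∫⁻ ω, W τ * (‖m ω‖ₑ * ‖k (τ - ω) - k τ‖ₑ) := by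
        refine lintegral_mono fun τ => ?_
        rw [lintegral_const_mul _ (hms τ)]
        refine mul_le_mul_right ((enorm_integral_le_lintegral_enorm _).trans
          (le_of_eq (lintegral_congr fun ω => enorm_mul _ _))) _
    _ = ∫⁻ ω, ∫⁻ τ, W τ * (‖m ω‖ₑ * ‖k (τ - ω) - k τ‖ₑ) := by
        refine lintegral_lintegral_swap (Measurable.aemeasurable ?_)
        exact (hW.comp measurable_fst).mul ((hm.comp continuous_snd).enorm.measurable.mul hc.measurable)
    _ = _ := by
        refine lintegral_congr fun ω => ?_
        rw [← lintegral_const_mul' _ _ enorm_ne_top]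
        exact lintegral_congr fun τ => mul_left_comm _ _ _

theorem lintegral_weight_mul_differenceDensity_ne_top (hs : 0 ≤ s) (hm : Continuous m)
    (hk : Continuous k) (hmw : ∫⁻ ω, weight 1 s ω * ‖m ω‖ₑ ≠ ∞)
    (hkw : ∫⁻ τ, weight 1 s τ * ‖k τ‖ₑ ≠ ∞) :
    ∫⁻ τ, weight 1 s τ * ‖differenceDensity m k τ‖ₑ ≠ ∞ := by
  set A := ∫⁻ τ, weight 1 s τ * ‖k τ‖ₑ with hA
  refine ne_top_of_le_ne_top (ENNReal.mul_ne_top hmw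
    (ENNReal.mul_ne_top (by simp : (2 : ℝ≥0∞) ≠ ∞) hkw))
    ((lintegral_mul_enorm_differenceDensity_le hm hk (measurable_weight 1 s)).trans ?_)
  have hmm : Measurable fun ω => weight 1 s ω * ‖m ω‖ₑ := by
    have := hm.measurable
    fun_prop
  rw [← lintegral_mul_const _ hmm]
  refine lintegral_mono fun ω => ?_
  have h1 : ∫⁻ τ, weight 1 s τ * ‖k (τ - ω)‖ₑ ≤ weight 1 s ω * A := by
    rw [← lintegral_add_right_eq_self (fun τ => weight 1 s τ * ‖k (τ - ω)‖ₑ) ω, hA,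
      ← lintegral_const_mul' _ _ (by rw [weight]; exact ENNReal.ofReal_ne_top)]
    refine lintegral_mono fun τ => ?_
    rw [add_sub_cancel_right, ← mul_assoc, mul_comm (weight 1 s ω)]
    gcongr
    exact weight_add_le zero_le_one hs τ ω
  have h2 : ∫⁻ τ, weight 1 s τ * ‖k (τ - ω) - k τ‖ₑ ≤ weight 1 s ω * A + A := by
    calc _ ≤ ∫⁻ τ, (weight 1 s τ * ‖k (τ - ω)‖ₑ + weight 1 s τ * ‖k τ‖ₑ) := by
          refine lintegral_mono fun τ => ?_
          rw [← mul_add]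
          gcongr
          exact enorm_sub_le
      _ = _ := by
          rw [lintegral_add_right _ (by
            have := hk.measurable
            fun_prop)]
      _ ≤ _ := by gcongr
  have h3 : A ≤ weight 1 s ω * A :=
    le_mul_of_one_le_left zero_le (one_le_weight zero_le_one hs ω)
  calc _ ≤ ‖m ω‖ₑ * (weight 1 s ω * A + weight 1 s ω * A) := by gcongr; exact h2.trans (by gcongr)
    _ = _ := by ring

/-- Convolution theorem: the density equals m ∗ k - (∫ m) k, and ∫ m is the value at 0 of the
function with density m. -/
theorem integral_differenceDensity_mul_character (hm : Integrable m) (hk : Integrable k)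
    (y : EuclideanSpace ℝ (Fin n)) :
    ∫ τ, differenceDensity m k τ * character (-τ) y =
      ((∫ ω, m ω * character (-ω) y) - ∫ ω, m ω) * ∫ τ, k τ * character (-τ) y := by
  have hch : Continuous fun τ : EuclideanSpace ℝ (Fin n) => character (-τ) y := by
    unfold character; fun_prop
  have hint : ∀ {g : EuclideanSpace ℝ (Fin n) → ℂ}, Integrable g →
      Integrable fun τ => g τ * character (-τ) y := fun hg =>
    hg.mul_bdd (c := 1) hch.aestronglyMeasurable
      (Eventually.of_forall fun τ => (norm_character _ _).le)
  have hshift : ∀ ω, ∫ τ, k (τ - ω) * character (-τ) y =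
      character (-ω) y * ∫ τ, k τ * character (-τ) y := fun ω => by
    rw [← integral_add_right_eq_self _ ω, ← integral_const_mul]
    refine integral_congr_ae (Eventually.of_forall fun τ => ?_)
    simp only [add_sub_cancel_right]
    rw [neg_add, ← character_mul]
    ring
  have hI1 : Integrable fun q : EuclideanSpace ℝ (Fin n) × EuclideanSpace ℝ (Fin n) =>
      m q.1 * k q.2 := hm.mul_prod hk
  have hI2 : Integrable fun q : EuclideanSpace ℝ (Fin n) × EuclideanSpace ℝ (Fin n) =>
      m q.1 * k (q.2 - q.1) := by
    exact (hm.convolution_integrand (ContinuousLinearMap.mul ℝ ℂ) hk).swap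
  have hI : Integrable fun q : EuclideanSpace ℝ (Fin n) × EuclideanSpace ℝ (Fin n) =>
      m q.1 * (k (q.2 - q.1) - k q.2) * character (-q.2) y := by
    refine Integrable.mul_bdd (c := 1) ?_ (hch.comp continuous_snd).aestronglyMeasurable
      (Eventually.of_forall fun τ => (norm_character _ _).le)
    simpa only [mul_sub] using! hI2.sub hI1
  calc ∫ τ, differenceDensity m k τ * character (-τ) y
      = ∫ τ, ∫ ω, m ω * (k (τ - ω) - k τ) * character (-τ) y := by
        refine integral_congr_ae (Eventually.of_forall fun τ => ?_)
        simp only [differenceDensity]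
        rw [integral_mul_const]
    _ = ∫ ω, ∫ τ, m ω * (k (τ - ω) - k τ) * character (-τ) y :=
        (integral_integral_swap (f := fun ω τ => m ω * (k (τ - ω) - k τ) * character (-τ) y) hI).symm
    _ = ∫ ω, (m ω * character (-ω) y - m ω) * ∫ τ, k τ * character (-τ) y := by
        refine integral_congr_ae (Eventually.of_forall fun ω => ?_)
        simp only [mul_assoc]
        rw [integral_const_mul]
        simp only [sub_mul]
        rw [integral_sub (hint (hk.comp_sub_right ω)) (hint hk), hshift]
        ring
    _ = _ := by
        rw [integral_mul_const, integral_sub (hint hm) hm]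

/-- The heart of Wiener's local argument. After rescaling, the L¹ norm is at most ∫ |m(ω)| ‖k(· -
ω/r) - k‖₁ dω, which tends to 0 as r → ∞ by continuity of translation and dominated convergence. -/
theorem tendsto_lintegral_enorm_differenceDensity (hm : Integrable m) (hmc : Continuous m)
    (k : 𝓢(EuclideanSpace ℝ (Fin n), ℂ)) :
    Tendsto (fun r : ℝ => ∫⁻ τ, ‖differenceDensity m (dilate r k) τ‖ₑ) atTop (𝓝 0) := by
  set T : EuclideanSpace ℝ (Fin n) → ℝ≥0∞ := fun h => ∫⁻ τ, ‖k (τ - h) - k τ‖ₑ with hT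
  have hTm : Measurable T := by
    have hc : Continuous fun q : EuclideanSpace ℝ (Fin n) × EuclideanSpace ℝ (Fin n) =>
        ‖k (q.2 - q.1) - k q.2‖ₑ :=
      ((k.continuous.comp (continuous_snd.sub continuous_fst)).sub
        (k.continuous.comp continuous_snd)).enorm
    exact Measurable.lintegral_prod_right (f := fun h τ => ‖k (τ - h) - k τ‖ₑ) hc.measurable
  set A := ∫⁻ τ, ‖k τ‖ₑ with hA
  have hAt : A ≠ ∞ := k.integrable.2.ne
  have hTA : ∀ h, T h ≤ 2 * A := fun h => by
    calc T h ≤ ∫⁻ τ, (‖k (τ - h)‖ₑ + ‖k τ‖ₑ) := lintegral_mono fun τ => enorm_sub_le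
      _ = (∫⁻ τ, ‖k (τ - h)‖ₑ) + A := by
          rw [lintegral_add_right _ k.continuous.enorm.measurable]
      _ = 2 * A := by
          rw [lintegral_sub_right_eq_self (fun τ => ‖k τ‖ₑ) h, two_mul]
  have hle : ∀ r : ℝ, 0 < r → ∫⁻ τ, ‖differenceDensity m (dilate r k) τ‖ₑ ≤
      ∫⁻ ω, ‖m ω‖ₑ * T (r⁻¹ • ω) := fun r hr => by
    have h := lintegral_mul_enorm_differenceDensity_le hmc (continuous_dilate r k)
      (W := fun _ => 1) measurable_const
    simp only [one_mul] at h
    refine h.trans (le_of_eq (lintegral_congr fun ω => ?_))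
    congr 1
    simp only [hT]
    rw [← lintegral_comp_inv_smul hr fun τ => ‖k (τ - r⁻¹ • ω) - k τ‖ₑ, ← lintegral_const_mul' _ _ ENNReal.ofReal_ne_top]
    refine lintegral_congr fun τ => ?_
    rw [dilate, dilate, ← mul_sub, enorm_mul, smul_sub, ← ofReal_norm, Complex.norm_real,
      Real.norm_of_nonneg (by positivity)]
  have hlim : Tendsto (fun r : ℝ => ∫⁻ ω, ‖m ω‖ₑ * T (r⁻¹ • ω)) atTop (𝓝 0) := by
    rw [← lintegral_zero (α := EuclideanSpace ℝ (Fin n)) (μ := volume)]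
    refine tendsto_lintegral_filter_of_dominated_convergence (fun ω => ‖m ω‖ₑ * (2 * A))
      (Eventually.of_forall fun r => ?_) (Eventually.of_forall fun r => Eventually.of_forall fun ω => ?_)
      ?_ (Eventually.of_forall fun ω => ?_)
    · have := hmc.measurable
      fun_prop
    · exact mul_le_mul_right (hTA _) _
    · rw [lintegral_mul_const _ hmc.enorm.measurable]
      exact ENNReal.mul_ne_top hm.2.ne (ENNReal.mul_ne_top (by simp) hAt)
    · have h1 : Tendsto (fun r : ℝ => r⁻¹ • ω) atTop (𝓝 0) := by
        simpa using (tendsto_inv_atTop_zero (𝕜 := ℝ)).smul_const ω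
      have h2 := (tendsto_lintegral_enorm_translate_sub k).comp h1
      simpa using ENNReal.Tendsto.const_mul h2 (Or.inr (enorm_ne_top (x := m ω)))
  refine tendsto_of_tendsto_of_tendsto_of_le_of_le' tendsto_const_nhds hlim
    (Eventually.of_forall fun _ => zero_le) ?_
  filter_upwards [eventually_gt_atTop 0] with r hr using hle r hr

end LocalDensity

/-! ### Division by 1 + g through the Neumann series -/

section Neumann

open Filter Topology

variable {n : ℕ} {p : ℝ≥0∞} {s : ℝ} {φ : 𝓢(EuclideanSpace ℝ (Fin n), ℂ)}
  {u w : 𝓢'(EuclideanSpace ℝ (Fin n), ℂ)} {f : EuclideanSpace ℝ (Fin n) → ℂ}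
  {m : EuclideanSpace ℝ (Fin n) → ℂ}

/-- As δ → 0 the weights decrease to 1 under an integrable majorant. Dominated convergence thus
turns smallness in L¹ into smallness in a submultiplicative weighted norm. -/
theorem exists_lintegral_weight_lt (hs : 0 ≤ s) (hm : Measurable m)
    (hmw : ∫⁻ τ, weight 1 s τ * ‖m τ‖ₑ ≠ ∞) {a : ℝ≥0∞} (ha : ∫⁻ τ, ‖m τ‖ₑ < a) :
    ∃ δ : ℝ, 0 < δ ∧ δ ≤ 1 ∧ ∫⁻ τ, weight δ s τ * ‖m τ‖ₑ < a := by
  have h1 : ∀ k : ℕ, (1 / ((k : ℝ) + 1)) ≤ 1 := fun k => by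
    rw [div_le_one (by positivity)]; linarith [k.cast_nonneg (α := ℝ)]
  have h : Tendsto (fun k : ℕ => ∫⁻ τ, weight (1 / ((k : ℝ) + 1)) s τ * ‖m τ‖ₑ) atTop
      (𝓝 (∫⁻ τ, ‖m τ‖ₑ)) := by
    refine tendsto_lintegral_of_dominated_convergence (fun τ => weight 1 s τ * ‖m τ‖ₑ)
      (fun k => by fun_prop) (fun k => Eventually.of_forall fun τ => ?_) hmw
      (Eventually.of_forall fun τ => ?_)
    · exact mul_le_mul_left (weight_mono (by positivity) hs (h1 k) τ) _
    · have hc : Continuous fun δ : ℝ => (1 + δ * ‖τ‖) ^ s :=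
        (by fun_prop : Continuous fun δ : ℝ => 1 + δ * ‖τ‖).rpow_const fun _ => Or.inr hs
      have h2 : Tendsto (fun k : ℕ => weight (1 / ((k : ℝ) + 1)) s τ) atTop (𝓝 1) := by
        have := (ENNReal.continuous_ofReal.comp hc).tendsto 0 |>.comp
          (tendsto_one_div_add_atTop_nhds_zero_nat (𝕜 := ℝ))
        simpa using! this
      simpa using ENNReal.Tendsto.mul_const h2 (Or.inr (enorm_ne_top (x := m τ)))
  obtain ⟨k, hk⟩ := (h.eventually_lt_const ha).exists
  exact ⟨_, by positivity, h1 k, hk⟩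

/-- Countable subadditivity of the slice norm: Minkowski's integral inequality for the counting
measure. -/
theorem slice_le_tsum (hp : 1 ≤ p) (hpt : p ≠ ∞) {w : 𝓢'(EuclideanSpace ℝ (Fin n), ℂ)}
    {R : ℕ → 𝓢'(EuclideanSpace ℝ (Fin n), ℂ)}
    (h : ∀ z ζ, HasSum (fun k => stft φ (R k) z ζ) (stft φ w z ζ)) (ζ : EuclideanSpace ℝ (Fin n)) :
    slice p φ w ζ ≤ ∑' k, slice p φ (R k) ζ := by
  have h1 : slice p φ w ζ ≤
      eLpNorm (fun z => ∫⁻ k, ‖stft φ (R k) z ζ‖ₑ ∂(Measure.count : Measure ℕ)) p volume :=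
    eLpNorm_mono_enorm fun z => by
      rw [lintegral_count, enorm_enorm, enorm_eq_self, ← (h z ζ).tsum_eq]
      exact enorm_tsum_le_tsum_enorm
  refine h1.trans ((eLpNorm_lintegral_le (F := fun z k => ‖stft φ (R k) z ζ‖ₑ)
    (measurable_from_prod_countable_left fun k =>
      (measurable_enorm_stft φ (R k)).of_uncurry_right) hp hpt).trans (le_of_eq ?_))
  rw [lintegral_count]
  rfl

/-- The series for 1 / (1 + g) is integrated term by term against the shifted window. Since ‖g‖ ≤ ρ
< 1 uniformly, this needs only pointwise data, no norm in the space. -/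
theorem hasSum_stft_of_geometric {f g : EuclideanSpace ℝ (Fin n) → ℂ} {ρ : ℝ} (hρ : ρ < 1)
    (hg : ∀ t, ‖g t‖ ≤ ρ) {R : ℕ → 𝓢'(EuclideanSpace ℝ (Fin n), ℂ)}
    (hR : ∀ k, IsGivenBy (R k) fun t => (-g t) ^ k * f t)
    (hw : IsGivenBy w fun t => f t / (1 + g t)) (z ζ : EuclideanSpace ℝ (Fin n)) :
    HasSum (fun k => stft φ (R k) z ζ) (stft φ w z ζ) := by
  have hρ0 : 0 ≤ ρ := (norm_nonneg _).trans (hg 0)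
  have hs : HasSum (fun k => ρ ^ k) (1 - ρ)⁻¹ := hasSum_geometric_of_lt_one hρ0 hρ
  rw [hw.stft_eq]
  simp only [fun k => (hR k).stft_eq φ z ζ]
  have hi := (hR 0).integrable (conjShift φ z ζ)
  simp only [pow_zero, one_mul] at hi
  refine hasSum_integral_of_dominated_convergence
    (fun k t => ρ ^ k * ‖f t * conjShift φ z ζ t‖)
    (fun k => ((hR k).integrable (conjShift φ z ζ)).aestronglyMeasurable)
    (fun k => Eventually.of_forall fun t => ?_)
    (Eventually.of_forall fun t => hs.summable.mul_right _) ?_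
    (Eventually.of_forall fun t => ?_)
  · rw [mul_assoc, norm_mul, norm_pow, norm_neg]
    gcongr
    exact hg t
  · simp only [tsum_mul_right]
    exact hi.norm.const_mul _
  · have h1 := hasSum_geometric_of_norm_lt_one (ξ := -g t)
      (by rw [norm_neg]; exact (hg t).trans_lt hρ)
    have h2 := h1.mul_right (f t * conjShift φ z ζ t)
    rw [sub_neg_eq_add, ← mul_assoc, ← div_eq_inv_mul] at h2
    simpa only [mul_assoc] using! h2

theorem continuous_integral_mul_character (hm : Integrable m) :
    Continuous fun t => ∫ τ, m τ * character (-τ) t := by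
  refine continuous_of_dominated (bound := fun τ => ‖m τ‖) (fun t => ?_)
    (fun t => Eventually.of_forall fun τ => ?_) hm.norm (Eventually.of_forall fun τ => ?_)
  · refine hm.aestronglyMeasurable.mul (Continuous.aestronglyMeasurable ?_)
    unfold character; fun_prop
  · rw [norm_mul, norm_character, mul_one]
  · unfold character; fun_prop

theorem norm_integral_mul_character_le (hm : Integrable m) (t : EuclideanSpace ℝ (Fin n)) :
    ‖∫ τ, m τ * character (-τ) t‖ ≤ (∫⁻ τ, ‖m τ‖ₑ).toReal := by
  rw [← toReal_enorm]
  refine ENNReal.toReal_mono hm.2.ne ((enorm_integral_le_lintegral_enorm _).trans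
    (lintegral_mono fun τ => ?_))
  rw [enorm_mul, ← ofReal_norm (character _ _), norm_character, ENNReal.ofReal_one, mul_one]

/-- If `g` is the Fourier transform of a function of weighted `L¹` whose `L¹` norm is less
than one, then `f / (1 + g)` belongs to the modulation space for every element `f` of it. -/
theorem exists_div_one_add_mem (hφ : φ ≠ 0) (hp : 1 ≤ p) (hpt : p ≠ ∞) (hs : 0 ≤ s)
    (hm : Measurable m) (hmw : ∫⁻ τ, weight 1 s τ * ‖m τ‖ₑ ≠ ∞) (hm1 : ∫⁻ τ, ‖m τ‖ₑ < 1)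
    (x₀ : EuclideanSpace ℝ (Fin n)) (hu : u ∈ modulationSpace p s φ) (hf : IsGivenBy u f) :
    ∃ w ∈ modulationSpace p s φ,
      IsGivenBy w fun t => f t / (1 + ∫ τ, m τ * character (-τ) (t - x₀)) := by
  have hmi := integrable_of_lintegral_weight hs hm hmw
  set g : EuclideanSpace ℝ (Fin n) → ℂ := fun t => ∫ τ, m τ * character (-τ) (t - x₀) with hg
  have hgc : Continuous g :=
    (continuous_integral_mul_character hmi).comp (continuous_id.sub continuous_const)
  set ρ := (∫⁻ τ, ‖m τ‖ₑ).toReal with hρdef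
  have hgρ : ∀ t, ‖g t‖ ≤ ρ := fun t => norm_integral_mul_character_le hmi _
  have hρ : ρ < 1 := by
    rw [← ENNReal.toReal_one]
    exact (ENNReal.toReal_lt_toReal hm1.ne_top ENNReal.one_ne_top).2 hm1
  have hρ0 : 0 ≤ ρ := ENNReal.toReal_nonneg
  obtain ⟨B, hB⟩ := hf.exists_norm_le hφ hp hpt hs hu
  have hB0 : 0 ≤ B := (norm_nonneg _).trans (hB 0)
  have hR : ∀ k : ℕ, ∃ v, IsGivenBy v fun t => (-g t) ^ k * f t := fun k =>
    exists_isGivenBy_of_bounded (B := B) ((hgc.neg.pow k).mul hf.continuous) fun t => by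
      rw [norm_mul, norm_pow, norm_neg, ← one_mul B]
      exact mul_le_mul (pow_le_one₀ (norm_nonneg _) ((hgρ t).trans hρ.le)) (hB t)
        (norm_nonneg _) zero_le_one
  choose R hR using hR
  have hlow : ∀ t, 1 - ρ ≤ ‖1 + g t‖ := fun t => by
    have := norm_sub_le_norm_add (1 : ℂ) (g t)
    rw [norm_one] at this
    linarith [hgρ t]
  have hne : ∀ t, 1 + g t ≠ 0 := fun t h => by
    have := hlow t
    rw [h, norm_zero] at this
    linarith
  obtain ⟨w, hw⟩ := exists_isGivenBy_of_bounded (f := fun t => f t / (1 + g t))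
    (B := B / (1 - ρ)) (hf.continuous.div (continuous_const.add hgc) hne) fun t => by
      rw [norm_div]
      exact div_le_div₀ hB0 (hB t) (by linarith) (hlow t)
  refine ⟨w, ?_, hw⟩
  -- From here on slices are measured with the weight for this δ, in which the density has norm q <
  -- 1.
  obtain ⟨δ, hδ, hδ1, hlt⟩ := exists_lintegral_weight_lt hs hm hmw hm1
  set q := ∫⁻ τ, weight δ s τ * ‖m τ‖ₑ with hq
  set J : ℕ → ℝ≥0∞ := fun k => ∫⁻ ζ, weight δ s ζ * slice p φ (R k) ζ with hJ
  have hRm : ∀ k, Measurable (slice p φ (R k)) := fun k => measurable_slice hp hpt (R k)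
  have hR0 : R 0 = u := by
    have h := hR 0
    simp only [pow_zero, one_mul] at h
    ext ψ
    rw [h.apply_eq, hf.apply_eq]
  have hJ0 : J 0 ≠ ∞ := by
    refine ne_top_of_le_ne_top (lintegral_weight_mul_slice_ne_top hp hpt hs hu)
      (lintegral_mono fun ζ => ?_)
    rw [hR0]
    have := weight_mono hδ.le hs hδ1 ζ
    gcongr
  -- Each further factor -g convolves the slices with the density -m, so the norms decrease
  -- geometrically.
  have hstep : ∀ k, J (k + 1) ≤ q * J k := fun k => by
    have e : (fun t => (-g t) ^ (k + 1) * f t) =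
        fun t => (∫ τ, (-m τ) * character (-τ) (t - x₀)) * ((-g t) ^ k * f t) := by
      funext t
      simp only [neg_mul, integral_neg, pow_succ]
      ring
    refine le_trans (lintegral_mono fun ζ => mul_le_mul_right (slice_le_of_fourier_mul hp hpt
      hmi.neg hm.neg x₀ (hR k) (e ▸ hR (k + 1)) ζ) _) ?_
    simp only [Pi.neg_apply, enorm_neg]
    exact lintegral_weight_mul_conv_le hδ.le hs hm.enorm (hRm k)
  have hJk : ∀ k, J k ≤ q ^ k * J 0 := fun k => by
    induction k with
    | zero => simp
    | succ k ih =>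
      refine (hstep k).trans ?_
      rw [pow_succ', mul_assoc]
      gcongr
  have hsum : ∫⁻ ζ, weight δ s ζ * slice p φ w ζ ≠ ∞ := by
    refine ne_top_of_le_ne_top (b := (1 - q)⁻¹ * J 0) ?_ ?_
    · refine ENNReal.mul_ne_top ?_ hJ0
      rw [ENNReal.inv_ne_top]
      exact (tsub_pos_of_lt hlt).ne'
    · calc _ ≤ ∫⁻ ζ, ∑' k, weight δ s ζ * slice p φ (R k) ζ := by
            refine lintegral_mono fun ζ => ?_
            rw [ENNReal.tsum_mul_left]
            exact mul_le_mul_right (slice_le_tsum hp hpt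
              (hasSum_stft_of_geometric hρ hgρ hR hw) ζ) _
        _ = ∑' k, J k := lintegral_tsum fun k =>
            ((measurable_weight δ s).mul (hRm k)).aemeasurable
        _ ≤ ∑' k, q ^ k * J 0 := ENNReal.tsum_le_tsum hJk
        _ = _ := by rw [ENNReal.tsum_mul_right, ENNReal.tsum_geometric]
  refine mem_modulationSpace_of_lintegral_weight hs (ne_top_of_le_ne_top
    (ENNReal.mul_ne_top ENNReal.ofReal_ne_top hsum : ENNReal.ofReal (δ⁻¹ ^ s) * _ ≠ ∞) ?_)
  rw [← lintegral_const_mul' _ _ ENNReal.ofReal_ne_top]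
  refine lintegral_mono fun ζ => ?_
  rw [← mul_assoc]
  gcongr
  exact weight_one_le hδ hδ1 hs ζ

end Neumann

/-! ### Local inversion and the Tauberian theorem -/

section Tauberian

open Filter Topology

variable {n : ℕ} {p : ℝ≥0∞} {s : ℝ} {φ : 𝓢(EuclideanSpace ℝ (Fin n), ℂ)}
  {u v w : 𝓢'(EuclideanSpace ℝ (Fin n), ℂ)} {f g : EuclideanSpace ℝ (Fin n) → ℂ}
  {I : Submodule ℂ 𝓢'(EuclideanSpace ℝ (Fin n), ℂ)}

theorem IsClosedIdeal.exists_mul_mem (hI : IsClosedIdeal p s φ I)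
    (hv : v ∈ modulationSpace p s φ) (hg : IsGivenBy v g) (hu : u ∈ I) (hf : IsGivenBy u f) :
    ∃ w ∈ I, IsGivenBy w fun t => g t * f t := by
  obtain ⟨w, hw, g', f', hg', hf', hw'⟩ := hI.mul_mem v hv u hu
  rw [hg'.unique hg, hf'.unique hf] at hw'
  exact ⟨w, hw, hw'⟩

/-- A smooth bump function as a Schwartz function. -/
noncomputable def bumpSchwartz {c : EuclideanSpace ℝ (Fin n)} (b : ContDiffBump c) :
    𝓢(EuclideanSpace ℝ (Fin n), ℂ) :=
  (b.hasCompactSupport.comp_left Complex.ofReal_zero :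
    HasCompactSupport fun t => (b t : ℂ)).toSchwartzMap (Complex.ofRealCLM.contDiff.comp b.contDiff)

theorem bumpSchwartz_apply {c : EuclideanSpace ℝ (Fin n)} (b : ContDiffBump c)
    (t : EuclideanSpace ℝ (Fin n)) : bumpSchwartz b t = (b t : ℂ) := rfl

/-- Near `x₀`, an element of the modulation space is `f x₀ * (1 + g)`, where `g` is the Fourier
transform of a function of weighted `L¹` that is small in `L¹`. -/
theorem exists_small_density (hφ : φ ≠ 0) (hp : 1 ≤ p) (hpt : p ≠ ∞) (hs : 0 ≤ s)
    (hu : u ∈ modulationSpace p s φ) (hf : IsGivenBy u f) {x₀ : EuclideanSpace ℝ (Fin n)}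
    (hx₀ : f x₀ ≠ 0) :
    ∃ (m : EuclideanSpace ℝ (Fin n) → ℂ) (r : ℝ), 0 < r ∧ Measurable m ∧
      ∫⁻ τ, weight 1 s τ * ‖m τ‖ₑ ≠ ∞ ∧ ∫⁻ τ, ‖m τ‖ₑ < 1 ∧
      ∀ t, dist t x₀ < r → f t = f x₀ * (1 + ∫ τ, m τ * character (-τ) (t - x₀)) := by
  let b : ContDiffBump (0 : EuclideanSpace ℝ (Fin n)) := ⟨1, 2, one_pos, one_lt_two⟩
  have hb : ∀ y : EuclideanSpace ℝ (Fin n), ‖y‖ ≤ 1 → bumpSchwartz b y = 1 := fun y hy => by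
    rw [bumpSchwartz_apply, b.one_of_mem_closedBall (by simpa using hy), Complex.ofReal_one]
  obtain ⟨m, hmc, hmw, hm⟩ := exists_density_of_mem hφ hp hpt hs hu hf (bumpSchwartz b) x₀
  obtain ⟨k, hk⟩ := exists_schwartz_eq_fourierDensity (bumpSchwartz b)
  have hmi := integrable_of_lintegral_weight hs hmc.measurable hmw
  have hlt := (tendsto_lintegral_enorm_differenceDensity hmi hmc k).eventually_lt_const
    (enorm_pos.2 hx₀)
  -- Large r makes the L¹ norm smaller than ‖f x₀‖, so that division by f x₀ leaves it below 1; r ≥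
  -- 1 makes the ball of radius 1/r lie where both b(y) and b(r y) equal 1.
  obtain ⟨r, hr, hr1⟩ := (hlt.and (eventually_ge_atTop 1)).exists
  have hr0 : 0 < r := by linarith
  -- With y = t - x₀, M is the density of (f(x₀ + y) b(y) - f(x₀)) b(r y), which equals f(t) - f(x₀)
  -- for ‖y‖ < 1/r.
  set M := differenceDensity m (dilate r k) with hM
  have hMm : Measurable M := measurable_differenceDensity hmc (continuous_dilate r k)
  have hkw : ∫⁻ τ, weight 1 s τ * ‖dilate r k τ‖ₑ ≠ ∞ := by
    obtain ⟨N, hN⟩ : ∃ N : ℕ, s < N := exists_nat_gt _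
    simp only [mul_comm (weight 1 s _)]
    rw [lintegral_enorm_dilate hr0 k (g := fun τ => weight 1 s τ)]
    refine ne_top_of_le_ne_top (ENNReal.mul_ne_top ENNReal.ofReal_ne_top
      (lintegral_pow_mul_enorm_ne_top k N) : ENNReal.ofReal (r ^ N) * _ ≠ ∞) ?_
    rw [← lintegral_const_mul' _ _ ENNReal.ofReal_ne_top]
    refine lintegral_mono fun τ => ?_
    rw [mul_left_comm, ← ENNReal.ofReal_mul (by positivity), ← mul_pow]
    refine mul_le_mul_right (ENNReal.ofReal_le_ofReal ?_) _
    rw [one_mul, norm_smul, Real.norm_of_nonneg hr0.le]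
    calc (1 + r * ‖τ‖) ^ s ≤ (1 + r * ‖τ‖) ^ (N : ℝ) :=
          Real.rpow_le_rpow_of_exponent_le (by
            have := mul_nonneg hr0.le (norm_nonneg τ)
            linarith) hN.le
      _ = (1 + r * ‖τ‖) ^ N := Real.rpow_natCast _ _
      _ ≤ _ := by gcongr; linarith
  have hMw := lintegral_weight_mul_differenceDensity_ne_top hs hmc (continuous_dilate r k) hmw hkw
  have hc : ‖f x₀‖ₑ ≠ 0 := (enorm_pos.2 hx₀).ne'
  have hcn : ‖(f x₀)⁻¹‖ₑ = ‖f x₀‖ₑ⁻¹ := enorm_inv hx₀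
  refine ⟨fun τ => (f x₀)⁻¹ * M τ, r⁻¹, inv_pos.2 hr0, hMm.const_mul _, ?_, ?_, fun t ht => ?_⟩
  · simp only [enorm_mul, mul_left_comm (weight 1 s _)]
    rw [lintegral_const_mul' _ _ enorm_ne_top]
    exact ENNReal.mul_ne_top enorm_ne_top hMw
  · simp only [enorm_mul]
    rw [lintegral_const_mul' _ _ enorm_ne_top, hcn, mul_comm, ← div_eq_mul_inv,
      ENNReal.div_lt_iff (Or.inl hc) (Or.inl enorm_ne_top), one_mul]
    exact hr
  · have ht' : ‖t - x₀‖ < r⁻¹ := by rwa [← dist_eq_norm]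
    have h1 : ‖r • (t - x₀)‖ ≤ 1 := by
      rw [norm_smul, Real.norm_of_nonneg hr0.le]
      have := mul_le_mul_of_nonneg_left ht'.le hr0.le
      rwa [mul_inv_cancel₀ hr0.ne'] at this
    have h2 : ‖t - x₀‖ ≤ 1 := ht'.le.trans (inv_le_one_of_one_le₀ hr1)
    have h3 : ∫ ω, m ω = f x₀ := by
      have := hm 0
      simpa only [neg_zero, character_zero_right, mul_one, zero_add,
        hb 0 (by simp)] using this
    simp only [mul_assoc]
    rw [integral_const_mul, hM, integral_differenceDensity_mul_character hmi
      (integrable_dilate hr0 k), hm, h3, integral_dilate_mul_character hr0, ← hk, hb _ h1, hb _ h2,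
      sub_add_cancel]
    field_simp
    ring

/-- Wiener's local inversion: a closed ideal contains a bump function around every point at which
one of its elements does not vanish. -/
theorem IsClosedIdeal.exists_bump_mem (hI : IsClosedIdeal p s φ I) (hφ : φ ≠ 0) (hp : 1 ≤ p)
    (hpt : p ≠ ∞) (hs : 0 ≤ s) (hu : u ∈ I) (hf : IsGivenBy u f)
    {x₀ : EuclideanSpace ℝ (Fin n)} (hx₀ : f x₀ ≠ 0) :
    ∃ b : ContDiffBump x₀, ∃ w ∈ I, IsGivenBy w fun t => (b t : ℂ) := by
  obtain ⟨m, r, hr, hm, hmw, hm1, hfm⟩ :=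
    exists_small_density hφ hp hpt hs (hI.subset hu) hf hx₀
  -- The support radius r is the one on which the factorisation f = f(x₀)(1 + g) is valid.
  let b : ContDiffBump x₀ := ⟨r / 2, r, half_pos hr, half_lt_self hr⟩
  obtain ⟨v, hv, hvb⟩ := exists_mem_isGivenBy_of_hasCompactSupport hp hpt hs φ
    (f := fun t => (b t : ℂ)) (b.hasCompactSupport.comp_left Complex.ofReal_zero)
    (Complex.ofRealCLM.contDiff.comp b.contDiff)
  obtain ⟨h, hh, hhb⟩ := exists_div_one_add_mem hφ hp hpt hs hm hmw hm1 x₀ hv hvb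
  obtain ⟨w, hw, hwb⟩ := hI.exists_mul_mem hh hhb hu hf
  refine ⟨b, (f x₀)⁻¹ • w, I.smul_mem _ hw, ?_⟩
  have hne : ∀ t, 1 + ∫ τ, m τ * character (-τ) (t - x₀) ≠ 0 := fun t h0 => by
    have h1 := norm_integral_mul_character_le (integrable_of_lintegral_weight hs hm hmw) (t - x₀)
    rw [eq_neg_of_add_eq_zero_right h0, norm_neg, norm_one] at h1
    have h2 := (ENNReal.toReal_lt_toReal hm1.ne_top ENNReal.one_ne_top).2 hm1
    rw [ENNReal.toReal_one] at h2
    linarith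
  have e : (fun t => (f x₀)⁻¹ * ((b t : ℂ) / (1 + ∫ τ, m τ * character (-τ) (t - x₀)) * f t)) =
      fun t => (b t : ℂ) := by
    funext t
    by_cases ht : dist t x₀ < r
    · rw [hfm t ht]
      have := hne t
      field_simp
    · rw [b.zero_of_le_dist (not_lt.1 ht)]
      simp
  exact e ▸ hwb.const_smul (f x₀)⁻¹

/-- Compactness: finitely many bumps of I are positive on neighbourhoods covering K, and being
nonnegative they cannot cancel in the sum. -/
theorem exists_pos_mem
    (hb : ∀ x : EuclideanSpace ℝ (Fin n), ∃ b : ContDiffBump x, ∃ w ∈ I,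
      IsGivenBy w fun t => (b t : ℂ))
    {K : Set (EuclideanSpace ℝ (Fin n))} (hK : IsCompact K) :
    ∃ g : EuclideanSpace ℝ (Fin n) → ℝ, ContDiff ℝ ((⊤ : ℕ∞) : WithTop ℕ∞) g ∧ (∀ t, 0 ≤ g t) ∧
      (∀ t ∈ K, 0 < g t) ∧ ∃ w ∈ I, IsGivenBy w fun t => (g t : ℂ) := by
  refine hK.induction_on (p := fun K => ∃ g : EuclideanSpace ℝ (Fin n) → ℝ,
      ContDiff ℝ ((⊤ : ℕ∞) : WithTop ℕ∞) g ∧ (∀ t, 0 ≤ g t) ∧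
      (∀ t ∈ K, 0 < g t) ∧ ∃ w ∈ I, IsGivenBy w fun t => (g t : ℂ)) ?_ ?_ ?_ ?_
  · refine ⟨fun _ => 0, contDiff_const, fun _ => le_rfl, fun _ h => h.elim, 0, I.zero_mem,
      continuous_const, fun ψ => by simp, fun ψ => by simp⟩
  · rintro S T hST ⟨g, h1, h2, h3, h4⟩
    exact ⟨g, h1, h2, fun t ht => h3 t (hST ht), h4⟩
  · rintro S T ⟨g, h1, h2, h3, w, hw, hwg⟩ ⟨g', h1', h2', h3', w', hw', hwg'⟩
    refine ⟨fun t => g t + g' t, h1.add h1', fun t => add_nonneg (h2 t) (h2' t), ?_, w + w',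
      I.add_mem hw hw', by simpa using hwg.add hwg'⟩
    rintro t (ht | ht)
    · exact add_pos_of_pos_of_nonneg (h3 t ht) (h2' t)
    · exact add_pos_of_nonneg_of_pos (h2 t) (h3' t ht)
  · intro x _
    obtain ⟨b, w, hw, hwb⟩ := hb x
    refine ⟨Metric.ball x b.rOut, mem_nhdsWithin_of_mem_nhds (Metric.ball_mem_nhds x b.rOut_pos),
      b, b.contDiff, fun t => b.nonneg, fun t ht => b.pos_of_mem_ball ht, w, hw, hwb⟩

/-- With g ∈ I smooth and positive on the support of f, the quotient f / g is smooth with compact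
support, hence in the space, and f = (f / g) g is in I. -/
theorem IsClosedIdeal.exists_mem_of_hasCompactSupport (hI : IsClosedIdeal p s φ I)
    (hp : 1 ≤ p) (hpt : p ≠ ∞) (hs : 0 ≤ s)
    (hb : ∀ x : EuclideanSpace ℝ (Fin n), ∃ b : ContDiffBump x, ∃ w ∈ I,
      IsGivenBy w fun t => (b t : ℂ))
    (hf : HasCompactSupport f) (hf' : ContDiff ℝ ((⊤ : ℕ∞) : WithTop ℕ∞) f) :
    ∃ w ∈ I, IsGivenBy w f := by
  obtain ⟨g, hg, -, hpos, v, hv, hvg⟩ := exists_pos_mem hb hf.isCompact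
  have hgC : ContDiff ℝ ((⊤ : ℕ∞) : WithTop ℕ∞) fun t => (g t : ℂ) :=
    Complex.ofRealCLM.contDiff.comp hg
  have hne : ∀ t ∈ tsupport f, (g t : ℂ) ≠ 0 := fun t ht =>
    Complex.ofReal_ne_zero.2 (hpos t ht).ne'
  obtain ⟨h, hh, hhf⟩ := exists_mem_isGivenBy_of_hasCompactSupport hp hpt hs φ
    (f := fun t => f t * (g t : ℂ)⁻¹) hf.mul_right
    (contDiff_iff_contDiffAt.2 fun t => by
      by_cases ht : t ∈ tsupport f
      · exact hf'.contDiffAt.mul (hgC.contDiffAt.inv (hne t ht))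
      · refine (contDiffAt_const (c := (0 : ℂ))).congr_of_eventuallyEq ?_
        filter_upwards [notMem_tsupport_iff_eventuallyEq.1 ht] with x hx
        simp [hx])
  obtain ⟨w, hw, hwf⟩ := hI.exists_mul_mem hh hhf hv hvg
  refine ⟨w, hw, ?_⟩
  have e : (fun t => f t * (g t : ℂ)⁻¹ * (g t : ℂ)) = f := by
    funext t
    by_cases ht : t ∈ tsupport f
    · exact inv_mul_cancel_right₀ (hne t ht) _
    · simp [image_eq_zero_of_notMem_tsupport ht]
  exact e ▸ hwf

/-- A closed ideal containing an element without zeros is the whole modulation space. -/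
theorem IsClosedIdeal.mem_of_forall_ne_zero (hI : IsClosedIdeal p s φ I) (hφ : φ ≠ 0) (hp : 1 ≤ p)
    (hpt : p ≠ ∞) (hs : 0 ≤ s) (hu : u ∈ I) (hf : IsGivenBy u f) (hne : ∀ x, f x ≠ 0)
    (hv : v ∈ modulationSpace p s φ) : v ∈ I := by
  obtain ⟨g, hg⟩ := exists_isGivenBy_of_mem hφ hp hpt hs hv
  let b : ContDiffBump (0 : EuclideanSpace ℝ (Fin n)) := default
  have hb0 : bumpSchwartz b 0 = 1 := by
    rw [bumpSchwartz_apply, b.one_of_mem_closedBall (Metric.mem_closedBall_self b.rIn_pos.le),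
      Complex.ofReal_one]
  set r : ℕ → ℝ := fun k => 1 / ((k : ℝ) + 1) with hr
  have hr0 : ∀ k, 0 < r k := fun k => by positivity
  have hr1 : ∀ k, r k ≤ 1 := fun k => by
    rw [hr, div_le_one (by positivity)]; linarith [k.cast_nonneg (α := ℝ)]
  -- The dilated bump is smooth with compact support, hence in I; its product with g stays in I
  -- because I is an ideal.
  have hw : ∀ k, ∃ w ∈ I, IsGivenBy w fun t => bumpSchwartz b (r k • t) * g t := fun k => by
    obtain ⟨c, hc, hcb⟩ := hI.exists_mem_of_hasCompactSupport hp hpt hs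
      (fun x => hI.exists_bump_mem hφ hp hpt hs hu hf (hne x))
      (f := fun t => bumpSchwartz b (r k • t))
      (((b.hasCompactSupport.comp_left Complex.ofReal_zero :
        HasCompactSupport fun t => (b t : ℂ))).comp_smul (hr0 k).ne')
      (((bumpSchwartz b).smooth _).comp (contDiff_const_smul _))
    obtain ⟨w, hw, hwg⟩ := hI.exists_mul_mem hv hg hc hcb
    exact ⟨w, hw, by simpa only [mul_comm] using hwg⟩
  choose w hw hwg using hw
  refine hI.closed v hv fun ε hε => ?_
  obtain ⟨k, hk⟩ := ((tendsto_modNorm_cutoff hφ hp hpt hs (bumpSchwartz b) hb0 hv hg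
    tendsto_one_div_add_atTop_nhds_zero_nat hr0 hr1 hwg).eventually_lt_const hε).exists
  exact ⟨w k, hw k, hk⟩

end Tauberian

end ModulationSpace

theorem mainTheorem2 (n : ℕ) (p : ℝ≥0∞) (hp : 1 ≤ p) (hp_top : p ≠ ∞) (s : ℝ) (hs : 0 ≤ s)
    (φ : 𝓢(EuclideanSpace ℝ (Fin n), ℂ)) (hφ : φ ≠ 0)
    (u : 𝓢'(EuclideanSpace ℝ (Fin n), ℂ)) (hu : u ∈ ModulationSpace.modulationSpace p s φ) :
    ∃ f : EuclideanSpace ℝ (Fin n) → ℂ, ModulationSpace.IsGivenBy u f ∧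
      ((ModulationSpace.closedIdealGenerated p s φ u : Set 𝓢'(EuclideanSpace ℝ (Fin n), ℂ)) =
          ModulationSpace.modulationSpace p s φ ↔
        ∀ x, f x ≠ 0) := by
  obtain ⟨f, hf⟩ := ModulationSpace.exists_isGivenBy_of_mem hφ hp hp_top hs hu
  refine ⟨f, hf, fun h => ModulationSpace.ne_zero_of_closedIdealGenerated_eq hφ hp hp_top hs hu hf h,
    fun h => Set.Subset.antisymm (fun v hv => ?_) fun v hv => ?_⟩
  · exact Submodule.mem_sInf.1 hv (ModulationSpace.modSubmodule hp hp_top s φ)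
      ⟨ModulationSpace.isClosedIdeal_modSubmodule hφ hp hp_top hs, hu⟩
  · exact Submodule.mem_sInf.2 fun I hI => hI.1.mem_of_forall_ne_zero hφ hp hp_top hs hI.2 hf h hv
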